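/- Let $\mathbb D$ be the open unit disc and $\mathcal H(\mathbb D)$ the space of analytic functions in $\mathbb D$; write $f(z)=\sum_{n\ge0}\widehat f(n)z^n$ for $f\in\mathcal H(\mathbb D)$. Let $\mu\colon[0,1)\to[0,\infty)$ be integrable with $\widehat\mu(r)=\int_r^1\mu(s)\,ds>0$ for $0<r<1$, and put $\widehat\mu(z)=\widehat\mu(|z|)$ for $z\in\mathbb D$. Assume that $\mu\in\mathcal D$, that is, there are constants $C>0$, $K>1$ and $C'>1$ such that $$\widehat\mu(r)\le C\,\widehat\mu\left(\tfrac{1+r}{2}\right)\quad\text{and}\quad \widehat\mu(r)\ge C'\,\widehat\mu\left(1-\tfrac{1-r}{K}\right),\qquad 0\le r<1 .$$ With $\mu_{2n+1}=\int_0^1 s^{2n+1}\mu(s)\,ds$ put, for $f,g\in\mathcal H(\mathbb D)$, $$D^\mu(f)(z)=\sum_{n=0}^\infty\frac{\widehat f(n)}{\mu_{2n+1}}z^n,\qquad I^\mu(f)(z)=\sum_{n=0}^\infty\mu_{2n+1}\widehat f(n)z^n,\qquad V_{\mu,g}(f)=I^\mu\big(f\cdot D^\mu(g)\big).$$ Let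 $0<p<\infty$ and $\alpha>-1$, and let $A^p_\alpha$ be the space of $f\in\mathcal H(\mathbb D)$ with $$\|f\|_{A^p_\alpha}^p=\int_{\mathbb D}|f(z)|^p(\alpha+1)(1-|z|^2)^\alpha\,dA(z)<\infty,\qquad dA=\tfrac{dx\,dy}{\pi}.$$ Let $\mathcal B$ be the Bloch space of $g\in\mathcal H(\mathbb D)$ with $\|g\|_{\mathcal B}=|g(0)|+\sup_{z\in\mathbb D}(1-|z|^2)|g'(z)|<\infty$, and $\mathcal B_0$ the space of $g\in\mathcal B$ with $\lim_{|z|\to1^-}(1-|z|^2)|g'(z)|=0$. Let $\mathcal B^\mu$ be the space of $g\in\mathcal H(\mathbb D)$ with $\|g\|_{\mathcal B^\mu}=\sup_{z\in\mathbb D}\widehat\mu(z)|D^\mu(g)(z)|<\infty$, and $\mathcal B^\mu_0$ the space of $g\in\mathcal B^\mu$ with $\lim_{|z|\to1^-}\widehat\mu(z)|D^\mu(g)(z)|=0$. (a) For every $g\in\mathcal H(\mathbb D)$ the following are equivalent: $V_{\mu,g}$ is bounded on $A^p_\alpha$; $g\in\mathcal B^\mu$; $g\in\mathcal B$. Moreover,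 $$\|V_{\mu,g}\|_{A^p_\alpha\to A^p_\alpha}\asymp\|g\|_{\mathcal B^\mu}\asymp\|g\|_{\mathcal B},\qquad g\in\mathcal H(\mathbb D),$$ where the constants of comparison depend only on $\mu$, $p$ and $\alpha$ (and the three quantities are infinite simultaneously). (b) For every $g\in\mathcal H(\mathbb D)$ the following are equivalent: $V_{\mu,g}$ is compact on $A^p_\alpha$ (that is, it maps $A^p_\alpha$ into itself and the image of every bounded sequence has a subsequence converging in $A^p_\alpha$); $g\in\mathcal B^\mu_0$; $g\in\mathcal B_0$. -/

import Mathlib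

open Set Filter Topology MeasureTheory
open scoped NNReal ENNReal

noncomputable section

namespace FracVolterra

/-- The open unit disc of the complex plane. -/
def disc : Set ℂ := Metric.ball 0 1

/-- Analytic functions in the unit disc (values off the disc are irrelevant throughout). -/
def Hol : Set (ℂ → ℂ) := {f | DifferentiableOn ℂ f disc}

/-- The `n`-th Taylor coefficient of `f` at the origin. -/
def coeff (f : ℂ → ℂ) (n : ℕ) : ℂ := iteratedDeriv n f 0 / (n.factorial : ℂ)

/-- The tail integral `∫_r^1 μ(s) ds`. -/
def tail (μ : ℝ → ℝ) (r : ℝ) : ℝ := ∫ s in r..1, μ s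

/-- The moment `∫_0^1 s^n μ(s) ds`. -/
def moment (μ : ℝ → ℝ) (n : ℕ) : ℝ := ∫ s in (0 : ℝ)..1, s ^ n * μ s

/-- Radial weights, given by their radial profile on `[0,1)`. -/
structure IsRadialWeight (μ : ℝ → ℝ) : Prop where
  nonneg : ∀ r ∈ Ico (0 : ℝ) 1, 0 ≤ μ r
  integrable : IntegrableOn μ (Ico 0 1)
  tail_pos : ∀ r ∈ Ioo (0 : ℝ) 1, 0 < tail μ r

/-- The upper doubling condition. -/
def UpperDoubling (μ : ℝ → ℝ) : Prop :=
  ∃ C : ℝ, 0 < C ∧ ∀ r ∈ Ico (0 : ℝ) 1, tail μ r ≤ C * tail μ ((1 + r) / 2)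

/-- The lower (reverse) doubling condition. -/
def LowerDoubling (μ : ℝ → ℝ) : Prop :=
  ∃ K C : ℝ, 1 < K ∧ 1 < C ∧ ∀ r ∈ Ico (0 : ℝ) 1, C * tail μ (1 - (1 - r) / K) ≤ tail μ r

/-- Radial doubling weights: the class `𝒟`. -/
structure IsDoublingWeight (μ : ℝ → ℝ) : Prop extends IsRadialWeight μ where
  upper : UpperDoubling μ
  lower : LowerDoubling μ

/-- The fractional derivative `D^μ`. -/
def fracDeriv (μ : ℝ → ℝ) (f : ℂ → ℂ) (z : ℂ) : ℂ :=
  ∑' n : ℕ, coeff f n / (moment μ (2 * n + 1) : ℂ) * z ^ n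

/-- The fractional integral `I^μ`. -/
def fracInt (μ : ℝ → ℝ) (f : ℂ → ℂ) (z : ℂ) : ℂ :=
  ∑' n : ℕ, (moment μ (2 * n + 1) : ℂ) * coeff f n * z ^ n

/-- The fractional Volterra-type operator `V_{μ,g}`. -/
def volterra (μ : ℝ → ℝ) (g f : ℂ → ℂ) : ℂ → ℂ :=
  fracInt μ (fun z => f z * fracDeriv μ g z)

/-- Normalized area measure `dx dy / π` on the unit disc. -/
def dA : Measure ℂ := ENNReal.ofReal (Real.pi)⁻¹ • volume.restrict disc

/-- The (quasi-)norm of the standard weighted Bergman space `A^p_α`. -/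
def bergmanNorm (p α : ℝ) (f : ℂ → ℂ) : ℝ≥0∞ :=
  (∫⁻ z, ENNReal.ofReal (‖f z‖ ^ p * ((α + 1) * (1 - ‖z‖ ^ 2) ^ α)) ∂dA) ^ (1 / p)

/-- The standard weighted Bergman space `A^p_α`. -/
def bergman (p α : ℝ) : Set (ℂ → ℂ) := {f | f ∈ Hol ∧ bergmanNorm p α f < ∞}

/-- `T` is bounded on `A^p_α`. -/
def BoundedOn (p α : ℝ) (T : (ℂ → ℂ) → ℂ → ℂ) : Prop :=
  (∀ f ∈ bergman p α, T f ∈ bergman p α) ∧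
    ∃ C : ℝ≥0, ∀ f ∈ bergman p α, bergmanNorm p α (T f) ≤ C * bergmanNorm p α f

/-- The operator (quasi-)norm of `T` on `A^p_α`; it is `∞` for an unbounded linear operator. -/
def opNorm (p α : ℝ) (T : (ℂ → ℂ) → ℂ → ℂ) : ℝ≥0∞ :=
  ⨆ f ∈ {f | f ∈ bergman p α ∧ bergmanNorm p α f ≤ 1}, bergmanNorm p α (T f)

/-- `T` is compact on `A^p_α`: it maps `A^p_α` into itself, and the image of every bounded
sequence has a subsequence that converges in `A^p_α`. -/
def CompactOn (p α : ℝ) (T : (ℂ → ℂ) → ℂ → ℂ) : Prop :=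
  (∀ f ∈ bergman p α, T f ∈ bergman p α) ∧
    ∀ F : ℕ → ℂ → ℂ, (∀ n, F n ∈ bergman p α) →
      (∃ M : ℝ≥0, ∀ n, bergmanNorm p α (F n) ≤ M) →
      ∃ h ∈ bergman p α, ∃ φ : ℕ → ℕ, StrictMono φ ∧
        Tendsto (fun n => bergmanNorm p α (T (F (φ n)) - h)) atTop (𝓝 0)

/-- The Bloch norm. -/
def blochNorm (g : ℂ → ℂ) : ℝ≥0∞ :=
  ENNReal.ofReal ‖g 0‖ + ⨆ z ∈ disc, ENNReal.ofReal ((1 - ‖z‖ ^ 2) * ‖deriv g z‖)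

/-- The Bloch space. -/
def bloch : Set (ℂ → ℂ) := {g | g ∈ Hol ∧ blochNorm g < ∞}

/-- The filter `|z| → 1⁻`. -/
def toCircle : Filter ℂ := comap norm (𝓝[<] (1 : ℝ))

/-- The little Bloch space. -/
def littleBloch : Set (ℂ → ℂ) :=
  {g | g ∈ bloch ∧ Tendsto (fun z => (1 - ‖z‖ ^ 2) * ‖deriv g z‖) toCircle (𝓝 0)}

/-- The norm of the fractional Bloch space `ℬ^μ`. -/
def fracBlochNorm (μ : ℝ → ℝ) (g : ℂ → ℂ) : ℝ≥0∞ :=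
  ⨆ z ∈ disc, ENNReal.ofReal (tail μ ‖z‖ * ‖fracDeriv μ g z‖)

/-- The fractional Bloch space `ℬ^μ`. -/
def fracBloch (μ : ℝ → ℝ) : Set (ℂ → ℂ) := {g | g ∈ Hol ∧ fracBlochNorm μ g < ∞}

/-- The little fractional Bloch space `ℬ^μ_0`. -/
def littleFracBloch (μ : ℝ → ℝ) : Set (ℂ → ℂ) :=
  {g | g ∈ fracBloch μ ∧ Tendsto (fun z => tail μ ‖z‖ * ‖fracDeriv μ g z‖) toCircle (𝓝 0)}

end FracVolterra

end

open FracVolterra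

noncomputable section

namespace FracVolterra

/-! ### Power series in the unit disc -/

/-! Everything rests on the identity `D^μ(V_{μ,g} f) = f · D^μ g`: up to the weight `tail μ`, the
operator `V_{μ,g}` is multiplication by `D^μ g` followed by an inverse of `D^μ`. Three estimates for
`I^μ` and `D^μ` then give the theorem.

Upper estimate. Since `I^μ h(z) = ∫ s h(s² z) μ(s) ds`, cutting the radius at the points `1 - 2⁻ᵏ`
bounds `I^μ h` on the `n`-th annulus by `∑_{k ≤ n} (sup of |h| on the k-th radial piece) · tail μ
(rad k)`. Area means of `|h|^p` and a discrete Hardy inequality, valid for all `p > 0`, give `‖I^μ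
h‖ ≲ ‖tail μ · h‖` in the weighted `L^p` (`exists_lintegral_fracInt_le`). With `h = f · D^μ g` this
bounds `‖V_{μ,g}‖` by the norm of `g` in `ℬ^μ`.

Cauchy estimate for `D^μ`. At `z`, `|D^μ F|` is at most a constant times the maximum of `|F|` on the
disc of radius `(1 + |z|)/2`, divided by `tail μ |z|` (`exists_norm_fracDeriv_le`). The proof pairs
`F` with the kernel having coefficients `(n + 1)/μ_{2n+1}`. Summation by parts factors this kernel
into two series whose `L²` means are computed by Parseval, and a radial integration, where lower
doubling enters, removes the factor `n + 1`. Applied to `V_{μ,g} f`, together with the pointwise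
growth of Bergman functions, it bounds `tail μ |a| · |D^μ g(a)| · |f(a)| (1 - |a|)^{(2+α)/p}` by the
norm of `V_{μ,g} f`. Normalized powers of `1/(1 - āz)` (`exists_testFun`) make the last two factors
bounded below, which is necessity in (a).

Comparison of the two Bloch norms. One direction applies the Cauchy estimate to `(zg)'` and
integrates radially. The other writes `g'` as the fractional integral, for the weight `s² μ(s)`, of
`(D^μ g)'` and uses the ordinary Cauchy estimate on dyadic pieces. The little spaces follow by
applying the same inequalities to `g - g(ρ ·)`, because `D^μ` commutes with dilations.

Compactness. If `g ∈ ℬ^μ_0`, a bounded sequence has a pointwise convergent subsequence with analytic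
limit, and the integral in the upper estimate is split into a compact disc and a collar where `tail
μ · |D^μ g|` is small. Conversely, the images of test functions with `|a| → 1` tend to zero
pointwise, so compactness forces a subsequence of them to tend to zero in norm, which contradicts
the lower bound if `g ∉ ℬ^μ_0`. -/

theorem mem_disc {z : ℂ} : z ∈ disc ↔ ‖z‖ < 1 := by simp [disc]

theorem isOpen_disc : IsOpen disc := Metric.isOpen_ball

theorem zero_mem_disc : (0 : ℂ) ∈ disc := by simp [mem_disc]

theorem measurableSet_disc : MeasurableSet disc := isOpen_disc.measurableSet

theorem mul_mem_disc {c z : ℂ} (hc : ‖c‖ ≤ 1) (hz : z ∈ disc) : c * z ∈ disc := by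
  rw [mem_disc] at *
  rw [norm_mul]
  exact lt_of_le_of_lt (mul_le_of_le_one_left (norm_nonneg z) hc) hz

/-- Coefficient sequences of power series that converge absolutely in the unit disc. -/
def DiscSummable (a : ℕ → ℂ) : Prop :=
  ∀ r : ℝ, 0 ≤ r → r < 1 → Summable fun n => ‖a n‖ * r ^ n

/-- The sum of a power series. -/
def powerSum (a : ℕ → ℂ) (z : ℂ) : ℂ := ∑' n, a n * z ^ n

theorem DiscSummable.summable {a : ℕ → ℂ} (ha : DiscSummable a) {z : ℂ} (hz : z ∈ disc) :
    Summable fun n => a n * z ^ n := by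
  refine Summable.of_norm ?_
  simpa [norm_mul, norm_pow] using ha ‖z‖ (norm_nonneg z) (mem_disc.1 hz)

theorem DiscSummable.hasSum {a : ℕ → ℂ} (ha : DiscSummable a) {z : ℂ} (hz : z ∈ disc) :
    HasSum (fun n => a n * z ^ n) (powerSum a z) := (ha.summable hz).hasSum

theorem coeff_eq_of_hasSum {f : ℂ → ℂ} {a : ℕ → ℂ} (ha : DiscSummable a)
    (h : ∀ z ∈ disc, HasSum (fun n => a n * z ^ n) (f z)) (n : ℕ) : coeff f n = a n := by
  have hr : (1 : ℝ≥0∞) ≤ (FormalMultilinearSeries.ofScalars ℂ a).radius := by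
    refine ENNReal.le_of_forall_nnreal_lt fun r hr => ?_
    have hr' : (r : ℝ) < 1 := by exact_mod_cast hr
    refine FormalMultilinearSeries.le_radius_of_summable _ ?_
    simpa [FormalMultilinearSeries.ofScalars_norm] using ha r r.2 hr'
  have hp : HasFPowerSeriesOnBall f (FormalMultilinearSeries.ofScalars ℂ a) 0 1 := by
    refine ⟨hr, one_pos, fun {y} hy => ?_⟩
    have hy' : y ∈ disc := by
      rw [mem_disc]
      have : ‖y‖ₑ < 1 := by simpa [Metric.mem_eball, edist_zero_right] using hy
      rw [← ofReal_norm, ENNReal.ofReal_lt_one] at this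
      exact this
    have := h y hy'
    simpa [FormalMultilinearSeries.ofScalars_apply_eq, zero_add, smul_eq_mul, mul_comm] using this
  have h2 := hp.hasFPowerSeriesAt.analyticAt.hasFPowerSeriesAt
  have h3 := hp.hasFPowerSeriesAt.eq_formalMultilinearSeries h2
  have h4 := FormalMultilinearSeries.ofScalars_series_injective ℂ ℂ h3
  rw [h4]
  rfl

theorem hol_of_hasSum {f : ℂ → ℂ} {a : ℕ → ℂ} (ha : DiscSummable a)
    (h : ∀ z ∈ disc, HasSum (fun n => a n * z ^ n) (f z)) : f ∈ Hol := by
  have key : ∀ r : ℝ, 0 ≤ r → r < 1 → DifferentiableOn ℂ (powerSum a) (Metric.ball 0 r) := by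
    intro r hr0 hr1
    refine Complex.differentiableOn_tsum_of_summable_norm (ha r hr0 hr1)
      (fun i => by fun_prop) Metric.isOpen_ball fun i w hw => ?_
    rw [norm_mul, norm_pow]
    have : ‖w‖ ≤ r := by simpa using (Metric.mem_ball.1 hw).le
    gcongr
  have h2 : DifferentiableOn ℂ (powerSum a) disc := by
    intro z hz
    obtain ⟨r, h1, h2⟩ := exists_between (mem_disc.1 hz)
    have h0 : 0 ≤ r := (norm_nonneg z).trans h1.le
    exact ((key r h0 h2).differentiableAt (Metric.isOpen_ball.mem_nhds
      (by simpa using h1))).differentiableWithinAt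
  exact h2.congr fun z hz => (h z hz).tsum_eq.symm

theorem powerSum_hol {a : ℕ → ℂ} (ha : DiscSummable a) : powerSum a ∈ Hol :=
  hol_of_hasSum ha fun _ hz => ha.hasSum hz

theorem coeff_powerSum {a : ℕ → ℂ} (ha : DiscSummable a) (n : ℕ) : coeff (powerSum a) n = a n :=
  coeff_eq_of_hasSum ha (fun _ hz => ha.hasSum hz) n

theorem hasSum_coeff {f : ℂ → ℂ} (hf : f ∈ Hol) {z : ℂ} (hz : z ∈ disc) :
    HasSum (fun n => coeff f n * z ^ n) (f z) := by
  have := Complex.hasSum_taylorSeries_on_ball hf hz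
  have h : (fun n => coeff f n * z ^ n)
      = fun n : ℕ => (n.factorial : ℂ)⁻¹ • (z - 0) ^ n • iteratedDeriv n f 0 := by
    funext n
    simp only [coeff, sub_zero, smul_eq_mul]
    ring
  rw [h]
  exact this

theorem discSummable_of_forall_summable {a : ℕ → ℂ}
    (h : ∀ r : ℝ, 0 ≤ r → r < 1 → Summable fun n => a n * (r : ℂ) ^ n) : DiscSummable a := by
  intro r hr0 hr1
  have := (h r hr0 hr1).norm
  simpa [norm_mul, norm_pow, abs_of_nonneg hr0] using this

theorem discSummable_coeff {f : ℂ → ℂ} (hf : f ∈ Hol) : DiscSummable (coeff f) :=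
  discSummable_of_forall_summable fun r hr0 hr1 =>
    (hasSum_coeff hf (z := (r : ℂ)) (by simpa [mem_disc, abs_of_nonneg hr0] using hr1)).summable

theorem coeff_congr {f g : ℂ → ℂ} (h : ∀ z ∈ disc, f z = g z) (n : ℕ) :
    coeff f n = coeff g n := by
  have : f =ᶠ[𝓝 0] g := by
    filter_upwards [isOpen_disc.mem_nhds zero_mem_disc] with z hz using h z hz
  rw [coeff, coeff, this.iteratedDeriv_eq]

theorem coeff_zero (f : ℂ → ℂ) : coeff f 0 = f 0 := by simp [coeff]

theorem continuousOn_of_hol {f : ℂ → ℂ} (hf : f ∈ Hol) : ContinuousOn f disc :=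
  DifferentiableOn.continuousOn (𝕜 := ℂ) hf

theorem deriv_hol {f : ℂ → ℂ} (hf : f ∈ Hol) : deriv f ∈ Hol :=
  DifferentiableOn.deriv hf isOpen_disc

theorem mul_hol {f g : ℂ → ℂ} (hf : f ∈ Hol) (hg : g ∈ Hol) : (fun z => f z * g z) ∈ Hol :=
  DifferentiableOn.mul (show DifferentiableOn ℂ f disc from hf)
    (show DifferentiableOn ℂ g disc from hg)

theorem sub_hol {f g : ℂ → ℂ} (hf : f ∈ Hol) (hg : g ∈ Hol) : (f - g) ∈ Hol :=
  DifferentiableOn.sub (show DifferentiableOn ℂ f disc from hf)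
    (show DifferentiableOn ℂ g disc from hg)

theorem comp_mul_hol {f : ℂ → ℂ} (hf : f ∈ Hol) {c : ℂ} (hc : ‖c‖ ≤ 1) :
    (fun z => f (c * z)) ∈ Hol :=
  DifferentiableOn.comp (show DifferentiableOn ℂ f disc from hf) (by fun_prop)
    fun _ hz => mul_mem_disc hc hz

theorem coeff_deriv (f : ℂ → ℂ) (n : ℕ) : coeff (deriv f) n = (n + 1) * coeff f (n + 1) := by
  have h1 : ((n : ℂ) + 1) ≠ 0 := by exact_mod_cast n.succ_ne_zero
  have h2 : (n.factorial : ℂ) ≠ 0 := by exact_mod_cast n.factorial_ne_zero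
  rw [coeff, coeff, iteratedDeriv_succ', Nat.factorial_succ]
  push_cast
  field_simp

theorem coeff_comp_mul {f : ℂ → ℂ} (hf : f ∈ Hol) {c : ℂ} (hc : ‖c‖ ≤ 1) (n : ℕ) :
    coeff (fun z => f (c * z)) n = c ^ n * coeff f n := by
  refine coeff_eq_of_hasSum (a := fun n => c ^ n * coeff f n) ?_ (fun z hz => ?_) n
  · intro r hr0 hr1
    refine Summable.of_nonneg_of_le (fun n => by positivity) (fun n => ?_)
      (discSummable_coeff hf r hr0 hr1)
    rw [norm_mul, norm_pow]
    gcongr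
    exact mul_le_of_le_one_left (norm_nonneg _) (pow_le_one₀ (norm_nonneg c) hc)
  · have := hasSum_coeff hf (mul_mem_disc hc hz)
    convert this using 1
    funext n
    ring

/-- Moving from `r` to some `s` in `(r, 1)` gains the factor `(r/s)^n`, which absorbs any polynomial
growth. -/
theorem DiscSummable.mul_of_le {a b : ℕ → ℂ} (ha : DiscSummable a) {C : ℝ} {m : ℕ}
    (hb : ∀ n, ‖b n‖ ≤ C * ((n : ℝ) + 1) ^ m) : DiscSummable fun n => b n * a n := by
  intro r hr0 hr1
  obtain ⟨s, hs1, hs2⟩ := exists_between hr1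
  have hs0 : 0 < s := lt_of_le_of_lt hr0 hs1
  have ht : ‖r / s‖ < 1 := by
    rw [Real.norm_of_nonneg (by positivity), div_lt_one hs0]
    exact hs1
  have h1 : Tendsto (fun n : ℕ => ((n : ℝ) + 1) ^ m * (r / s) ^ n) atTop (𝓝 0) := by
    have h := (summable_descFactorial_mul_geometric_of_norm_lt_one m ht).tendsto_atTop_zero
    refine squeeze_zero (fun n => by positivity) (fun n => ?_) h
    gcongr
    have := Nat.pow_sub_le_descFactorial (n + m) m
    have h2 : (n + m + 1 - m) ^ m = (n + 1) ^ m := by congr 1; omega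
    rw [h2] at this
    exact_mod_cast this
  obtain ⟨K, hK⟩ := h1.bddAbove_range
  have hC : 0 ≤ C := by
    have := (norm_nonneg _).trans (hb 0)
    simpa using this
  refine Summable.of_nonneg_of_le (fun n => by positivity) (fun n => ?_)
    ((ha s hs0.le hs2).mul_left (C * K))
  have hKn : ((n : ℝ) + 1) ^ m * (r / s) ^ n ≤ K := hK ⟨n, rfl⟩
  have hrs : r ^ n = (r / s) ^ n * s ^ n := by rw [← mul_pow, div_mul_cancel₀ _ hs0.ne']
  calc ‖b n * a n‖ * r ^ n ≤ (C * ((n : ℝ) + 1) ^ m) * ‖a n‖ * r ^ n := by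
        rw [norm_mul]; gcongr; exact hb n
    _ = C * (((n : ℝ) + 1) ^ m * (r / s) ^ n) * (‖a n‖ * s ^ n) := by rw [hrs]; ring
    _ ≤ C * K * (‖a n‖ * s ^ n) := by gcongr

/-! ### Pairing of Fourier series -/

theorem integral_exp_sub_nat (m n : ℕ) :
    ∫ t in (0 : ℝ)..2 * Real.pi, Complex.exp (m * t * Complex.I) * Complex.exp (-(n * t * Complex.I))
      = if m = n then 2 * Real.pi else 0 := by
  have h : ∀ t : ℝ, Complex.exp (m * t * Complex.I) * Complex.exp (-(n * t * Complex.I))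
      = Complex.exp ((((m : ℂ) - n) * Complex.I) * t) := by
    intro t
    rw [← Complex.exp_add]
    congr 1
    ring
  simp_rw [h]
  split_ifs with hmn
  · subst hmn
    simp
  · have hc : ((m : ℂ) - n) * Complex.I ≠ 0 := by
      refine mul_ne_zero ?_ Complex.I_ne_zero
      rw [sub_ne_zero]
      exact_mod_cast hmn
    rw [integral_exp_mul_complex hc]
    have : Complex.exp (((m : ℂ) - n) * Complex.I * (2 * Real.pi : ℝ)) = 1 := by
      rw [Complex.exp_eq_one_iff]
      refine ⟨(m : ℤ) - n, ?_⟩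
      push_cast
      ring
    rw [this]
    simp

theorem norm_mul_exp_pos (c : ℂ) (n : ℕ) (t : ℝ) :
    ‖c * Complex.exp (n * t * Complex.I)‖ = ‖c‖ := by
  rw [norm_mul, show (n : ℂ) * t * Complex.I = ((n * t : ℝ) : ℂ) * Complex.I by push_cast; ring,
    Complex.norm_exp_ofReal_mul_I, mul_one]

theorem norm_mul_exp_neg (c : ℂ) (n : ℕ) (t : ℝ) :
    ‖c * Complex.exp (-(n * t * Complex.I))‖ = ‖c‖ := by
  rw [norm_mul, show -((n : ℂ) * t * Complex.I) = ((-(n * t) : ℝ) : ℂ) * Complex.I by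
    push_cast; ring, Complex.norm_exp_ofReal_mul_I, mul_one]

theorem hasSum_mul_of_summable_norm {u v : ℕ → ℂ} (hu : Summable fun n => ‖u n‖)
    (hv : Summable fun n => ‖v n‖) :
    HasSum (fun x : ℕ × ℕ => u x.1 * v x.2) ((∑' n, u n) * ∑' n, v n) := by
  have h := summable_mul_of_summable_norm hu hv
  rw [hu.of_norm.tsum_mul_tsum hv.of_norm h]
  exact h.hasSum

theorem hasSum_pairing {a b : ℕ → ℂ} (ha : Summable fun n => ‖a n‖)
    (hb : Summable fun n => ‖b n‖) (t : ℝ) :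
    HasSum (fun x : ℕ × ℕ => (a x.1 * Complex.exp (x.1 * t * Complex.I)) *
      (b x.2 * Complex.exp (-(x.2 * t * Complex.I))))
      ((∑' n, a n * Complex.exp (n * t * Complex.I)) *
      (∑' n, b n * Complex.exp (-(n * t * Complex.I)))) := by
  have h1 : Summable fun n => ‖a n * Complex.exp (n * t * Complex.I)‖ := by
    simp_rw [norm_mul_exp_pos]; exact ha
  have h2 : Summable fun n => ‖b n * Complex.exp (-(n * t * Complex.I))‖ := by
    simp_rw [norm_mul_exp_neg]; exact hb
  exact hasSum_mul_of_summable_norm (u := fun n => a n * Complex.exp (n * t * Complex.I))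
    (v := fun n => b n * Complex.exp (-(n * t * Complex.I))) h1 h2

theorem integral_pairing_term (c d : ℂ) (m n : ℕ) :
    ∫ t in (0 : ℝ)..2 * Real.pi,
      (c * Complex.exp (m * t * Complex.I)) * (d * Complex.exp (-(n * t * Complex.I)))
      = if m = n then 2 * Real.pi * (c * d) else 0 := by
  have : ∀ t : ℝ, (c * Complex.exp (m * t * Complex.I)) *
      (d * Complex.exp (-(n * t * Complex.I))) = (c * d) *
      (Complex.exp (m * t * Complex.I) * Complex.exp (-(n * t * Complex.I))) := by
    intro t; ring
  simp_rw [this]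
  rw [intervalIntegral.integral_const_mul, integral_exp_sub_nat]
  split_ifs <;> push_cast <;> ring

/-- The pairing of an analytic and an anti-analytic absolutely convergent Fourier series. -/
theorem integral_pairing {a b : ℕ → ℂ} (ha : Summable fun n => ‖a n‖)
    (hb : Summable fun n => ‖b n‖) :
    ∫ t in (0 : ℝ)..2 * Real.pi, (∑' n, a n * Complex.exp (n * t * Complex.I)) *
      (∑' n, b n * Complex.exp (-(n * t * Complex.I))) = 2 * Real.pi * ∑' n, a n * b n := by
  have hab : Summable fun x : ℕ × ℕ => ‖a x.1‖ * ‖b x.2‖ :=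
    ha.mul_of_nonneg hb (fun _ => norm_nonneg _) (fun _ => norm_nonneg _)
  have key : HasSum (fun x : ℕ × ℕ => ∫ t in (0 : ℝ)..2 * Real.pi,
      (a x.1 * Complex.exp (x.1 * t * Complex.I)) *
      (b x.2 * Complex.exp (-(x.2 * t * Complex.I))))
      (∫ t in (0 : ℝ)..2 * Real.pi, (∑' n, a n * Complex.exp (n * t * Complex.I)) *
      (∑' n, b n * Complex.exp (-(n * t * Complex.I)))) := by
    refine intervalIntegral.hasSum_integral_of_dominated_convergence
      (fun x _ => ‖a x.1‖ * ‖b x.2‖) ?_ ?_ ?_ ?_ ?_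
    · intro x
      exact Continuous.aestronglyMeasurable (by fun_prop)
    · intro x
      refine Eventually.of_forall fun t _ => ?_
      rw [norm_mul, norm_mul_exp_pos, norm_mul_exp_neg]
    · exact Eventually.of_forall fun t _ => hab
    · exact intervalIntegrable_const
    · exact Eventually.of_forall fun t _ => hasSum_pairing ha hb t
  simp_rw [integral_pairing_term] at key
  have hinj : Function.Injective fun n : ℕ => (n, n) := fun m n h => (Prod.ext_iff.1 h).1
  rw [← key.tsum_eq, ← tsum_mul_left, ← hinj.tsum_eq]
  · simp
  · intro x hx
    by_cases h : x.1 = x.2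
    · exact ⟨x.1, Prod.ext rfl h⟩
    · simp [h] at hx

/-- Parseval, from `integral_pairing` with the conjugate coefficients. -/
theorem integral_normSq_tsum {b : ℕ → ℂ} (hb : Summable fun n => ‖b n‖) :
    ∫ t in (0 : ℝ)..2 * Real.pi, ‖∑' n, b n * Complex.exp (-(n * t * Complex.I))‖ ^ 2
      = 2 * Real.pi * ∑' n, ‖b n‖ ^ 2 := by
  have h := integral_pairing (a := fun n => (starRingEnd ℂ) (b n)) (b := b) (by simpa using hb) hb
  have h1 : ∀ t : ℝ, (∑' n, (starRingEnd ℂ) (b n) * Complex.exp (n * t * Complex.I)) *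
      (∑' n, b n * Complex.exp (-(n * t * Complex.I)))
      = ((‖∑' n, b n * Complex.exp (-(n * t * Complex.I))‖ ^ 2 : ℝ) : ℂ) := by
    intro t
    have : (∑' n, (starRingEnd ℂ) (b n) * Complex.exp (n * t * Complex.I))
        = (starRingEnd ℂ) (∑' n, b n * Complex.exp (-(n * t * Complex.I))) := by
      rw [Complex.conj_tsum]
      congr 1
      ext n
      rw [map_mul, ← Complex.exp_conj]
      simp
    rw [this, Complex.conj_mul']
    push_cast
    rfl
  simp_rw [h1] at h
  have h2 : ∀ n, (starRingEnd ℂ) (b n) * b n = ((‖b n‖ ^ 2 : ℝ) : ℂ) := by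
    intro n; rw [Complex.conj_mul']; push_cast; rfl
  simp_rw [h2] at h
  rw [intervalIntegral.integral_ofReal, ← Complex.ofReal_tsum] at h
  exact_mod_cast h

/-! ### Tails of radial weights -/

theorem tail_eq (ν : ℝ → ℝ) {r : ℝ} (hr : r ≤ 1) : tail ν r = ∫ s in Ico r 1, ν s := by
  rw [tail, intervalIntegral.integral_of_le hr, integral_Ioc_eq_integral_Ioo,
    ← integral_Ico_eq_integral_Ioo]

theorem moment_eq (ν : ℝ → ℝ) (n : ℕ) : moment ν n = ∫ s in Ico (0 : ℝ) 1, s ^ n * ν s := by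
  rw [moment, intervalIntegral.integral_of_le zero_le_one, integral_Ioc_eq_integral_Ioo,
    ← integral_Ico_eq_integral_Ioo]

theorem ofReal_tail {ν : ℝ → ℝ} (h0 : ∀ r ∈ Ico (0 : ℝ) 1, 0 ≤ ν r)
    (hi : IntegrableOn ν (Ico 0 1)) {r : ℝ} (hr0 : 0 ≤ r) (hr1 : r ≤ 1) :
    ENNReal.ofReal (tail ν r) = ∫⁻ s in Ico r 1, ENNReal.ofReal (ν s) := by
  rw [tail_eq ν hr1]
  refine ofReal_integral_eq_lintegral_ofReal (hi.mono_set (Ico_subset_Ico_left hr0)) ?_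
  filter_upwards [ae_restrict_mem measurableSet_Ico] with s hs
  exact h0 s ⟨hr0.trans hs.1, hs.2⟩

theorem tail_antitone {ν : ℝ → ℝ} (h0 : ∀ r ∈ Ico (0 : ℝ) 1, 0 ≤ ν r)
    (hi : IntegrableOn ν (Ico 0 1)) {r t : ℝ} (hr0 : 0 ≤ r)
    (hrt : r ≤ t) (ht : t ≤ 1) : tail ν t ≤ tail ν r := by
  rw [tail_eq ν ht, tail_eq ν (hrt.trans ht)]
  refine setIntegral_mono_set (hi.mono_set (Ico_subset_Ico_left hr0)) ?_
    (Ico_subset_Ico_left hrt).eventuallyLE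
  filter_upwards [ae_restrict_mem measurableSet_Ico] with s hs
  exact h0 s ⟨hr0.trans hs.1, hs.2⟩

theorem integrableOn_pow_mul {ν : ℝ → ℝ} (h0 : ∀ r ∈ Ico (0 : ℝ) 1, 0 ≤ ν r)
    (hi : IntegrableOn ν (Ico 0 1)) (n : ℕ) :
    IntegrableOn (fun s => s ^ n * ν s) (Ico (0 : ℝ) 1) := by
  refine Integrable.mono' hi
    ((continuous_pow n).aestronglyMeasurable.mul hi.aestronglyMeasurable) ?_
  filter_upwards [ae_restrict_mem measurableSet_Ico] with s hs
  rw [norm_mul, norm_pow, Real.norm_of_nonneg hs.1, Real.norm_of_nonneg (h0 s hs)]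
  exact mul_le_of_le_one_left (h0 s hs) (pow_le_one₀ hs.1 hs.2.le)

theorem ofReal_moment {ν : ℝ → ℝ} (h0 : ∀ r ∈ Ico (0 : ℝ) 1, 0 ≤ ν r)
    (hi : IntegrableOn ν (Ico 0 1)) (n : ℕ) :
    ENNReal.ofReal (moment ν n) = ∫⁻ s in Ico (0 : ℝ) 1, ENNReal.ofReal (s ^ n) *
      ENNReal.ofReal (ν s) := by
  rw [moment_eq, ofReal_integral_eq_lintegral_ofReal (integrableOn_pow_mul h0 hi n)]
  · refine setLIntegral_congr_fun measurableSet_Ico fun s hs => ?_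
    exact ENNReal.ofReal_mul (pow_nonneg hs.1 n)
  · filter_upwards [ae_restrict_mem measurableSet_Ico] with s hs
    exact mul_nonneg (pow_nonneg hs.1 n) (h0 s hs)

/-! ### Dyadic decomposition -/

/-- The dyadic radii `1 - 2⁻ᵏ`. -/
def rad (k : ℕ) : ℝ := 1 - (1 / 2) ^ k

theorem rad_zero : rad 0 = 0 := by simp [rad]

theorem rad_nonneg (k : ℕ) : 0 ≤ rad k :=
  sub_nonneg.2 (pow_le_one₀ (by norm_num) (by norm_num))

theorem rad_lt_one (k : ℕ) : rad k < 1 := by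
  have : (0 : ℝ) < (1 / 2) ^ k := by positivity
  unfold rad; linarith

theorem rad_mono {j k : ℕ} (h : j ≤ k) : rad j ≤ rad k := by
  have := pow_le_pow_of_le_one (by norm_num : (0 : ℝ) ≤ 1 / 2) (by norm_num) h
  unfold rad; linarith

theorem exists_rad_le_lt {x : ℝ} (hx : 0 ≤ x) (n : ℕ) (hxn : x < rad (n + 1)) :
    ∃ k ≤ n, rad k ≤ x ∧ x < rad (k + 1) := by
  induction n with
  | zero => exact ⟨0, le_rfl, by rwa [rad_zero], hxn⟩
  | succ n ih =>
    rcases lt_or_ge x (rad (n + 1)) with h | h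
    · obtain ⟨k, hk, h1⟩ := ih h
      exact ⟨k, by omega, h1⟩
    · exact ⟨n + 1, le_rfl, h, hxn⟩

theorem exists_lt_rad {x : ℝ} (hx : x < 1) : ∃ n, x < rad (n + 1) := by
  obtain ⟨n, hn⟩ := exists_pow_lt_of_lt_one (sub_pos.2 hx) (by norm_num : (1 / 2 : ℝ) < 1)
  refine ⟨n, ?_⟩
  have : (1 / 2 : ℝ) ^ (n + 1) ≤ (1 / 2) ^ n :=
    pow_le_pow_of_le_one (by norm_num) (by norm_num) (Nat.le_succ n)
  unfold rad; linarith

theorem exists_rad {x : ℝ} (hx : 0 ≤ x) (hx1 : x < 1) : ∃ n, rad n ≤ x ∧ x < rad (n + 1) := by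
  obtain ⟨n, hn⟩ := exists_lt_rad hx1
  obtain ⟨k, -, hk⟩ := exists_rad_le_lt hx n hn
  exact ⟨k, hk⟩

/-- The points that receive the index `k` lie in `[rad k, 1)`, so a full tail bounds their mass.
Using the tail instead of the mass of one dyadic piece leaves the index free: later it is read off
from `s ^ 2 * ‖z‖`, not from `s`. -/
theorem lintegral_mul_le_sum_tail {ν : ℝ → ℝ} (h0 : ∀ r ∈ Ico (0 : ℝ) 1, 0 ≤ ν r)
    (hi : IntegrableOn ν (Ico 0 1)) {H : ℝ → ℝ≥0∞} {S : ℕ → ℝ≥0∞} (n : ℕ)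
    (hH : ∀ s ∈ Ico (0 : ℝ) 1, ∃ k ≤ n, rad k ≤ s ∧ H s ≤ S k) :
    ∫⁻ s in Ico (0 : ℝ) 1, H s * ENNReal.ofReal (ν s) ≤
      ∑ k ∈ Finset.range (n + 1), S k * ENNReal.ofReal (tail ν (rad k)) := by
  have hm : AEMeasurable (fun s => ENNReal.ofReal (ν s)) (volume.restrict (Ico (0 : ℝ) 1)) :=
    hi.aestronglyMeasurable.aemeasurable.ennreal_ofReal
  calc ∫⁻ s in Ico (0 : ℝ) 1, H s * ENNReal.ofReal (ν s)
      ≤ ∫⁻ s in Ico (0 : ℝ) 1, ∑ k ∈ Finset.range (n + 1),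
          S k * (Ico (rad k) 1).indicator (fun s => ENNReal.ofReal (ν s)) s := by
        refine setLIntegral_mono' measurableSet_Ico fun s hs => ?_
        obtain ⟨k, hk, h1, h2⟩ := hH s hs
        refine le_trans ?_ (Finset.single_le_sum (f := fun k => S k * (Ico (rad k) 1).indicator
          (fun s => ENNReal.ofReal (ν s)) s) (fun _ _ => zero_le) (Finset.mem_range.2
          (Nat.lt_succ_of_le hk)))
        have : s ∈ Ico (rad k) 1 := ⟨h1, hs.2⟩
        simp only [indicator_of_mem this]
        gcongr
    _ = ∑ k ∈ Finset.range (n + 1), S k * ENNReal.ofReal (tail ν (rad k)) := by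
        rw [lintegral_finsetSum']
        · refine Finset.sum_congr rfl fun k _ => ?_
          rw [lintegral_const_mul'' _ (hm.indicator measurableSet_Ico),
            lintegral_indicator measurableSet_Ico, Measure.restrict_restrict measurableSet_Ico,
            ofReal_tail h0 hi (rad_nonneg k) (rad_lt_one k).le]
          congr 3
          ext s
          simp only [mem_inter_iff, mem_Ico]
          constructor
          · rintro ⟨h, -⟩
            exact h
          · intro h
            exact ⟨h, (rad_nonneg k).trans h.1, h.2⟩
        · intro k _
          exact (hm.indicator measurableSet_Ico).const_mul _

/-- `s ^ n` is at most the mean of `1, s, ..., s ^ n`, and `1 - s` times their sum is `1 - s ^ (n +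
1)`. -/
theorem pow_mul_one_sub_le {s : ℝ} (hs0 : 0 ≤ s) (hs1 : s ≤ 1) (n : ℕ) :
    s ^ n * (1 - s) ≤ 1 / ((n : ℝ) + 1) := by
  rw [le_div_iff₀ (by positivity)]
  have h1 : ((n : ℝ) + 1) * s ^ n ≤ ∑ i ∈ Finset.range (n + 1), s ^ i := by
    calc ((n : ℝ) + 1) * s ^ n = ∑ i ∈ Finset.range (n + 1), s ^ n := by simp
      _ ≤ _ := Finset.sum_le_sum fun i hi => pow_le_pow_of_le_one hs0 hs1
          (Nat.lt_succ_iff.1 (Finset.mem_range.1 hi))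
  have h2 := geom_sum_mul_neg s (n + 1)
  have h3 : 0 ≤ s ^ (n + 1) := by positivity
  nlinarith

/-- Comparison of `(n + 1) ^ m` with `m! * (n + m).choose m`, whose generating function is a power
of `1 / (1 - r)`. -/
theorem summable_succ_pow_mul_geometric (m : ℕ) {r : ℝ} (hr0 : 0 ≤ r) (hr1 : r < 1) :
    Summable (fun n : ℕ => ((n : ℝ) + 1) ^ m * r ^ n) ∧
    ∑' n : ℕ, ((n : ℝ) + 1) ^ m * r ^ n ≤ m.factorial / (1 - r) ^ (m + 1) := by
  have hr : ‖r‖ < 1 := by rwa [Real.norm_of_nonneg hr0]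
  have hs := hasSum_choose_mul_geometric_of_norm_lt_one m hr
  have hle : ∀ n : ℕ, ((n : ℝ) + 1) ^ m * r ^ n ≤
      m.factorial * (((n + m).choose m : ℝ) * r ^ n) := by
    intro n
    rw [← mul_assoc]
    refine mul_le_mul_of_nonneg_right ?_ (pow_nonneg hr0 n)
    have h1 := Nat.pow_sub_le_descFactorial (n + m) m
    have h2 : (n + m + 1 - m) ^ m = (n + 1) ^ m := by congr 1; omega
    rw [h2, Nat.descFactorial_eq_factorial_mul_choose] at h1
    exact_mod_cast h1
  have hs2 := hs.summable.mul_left (m.factorial : ℝ)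
  have hs1 : Summable (fun n : ℕ => ((n : ℝ) + 1) ^ m * r ^ n) :=
    Summable.of_nonneg_of_le (fun n => by positivity) hle hs2
  refine ⟨hs1, (hs1.tsum_le_tsum hle hs2).trans ?_⟩
  rw [tsum_mul_left, hs.tsum_eq, mul_one_div]

/-! ### Doubling weights -/

theorem IsDoublingWeight.antitone {μ : ℝ → ℝ} (hμ : IsDoublingWeight μ)
    {r t : ℝ} (hr0 : 0 ≤ r) (hrt : r ≤ t) (ht : t ≤ 1) :
    tail μ t ≤ tail μ r := tail_antitone hμ.nonneg hμ.integrable hr0 hrt ht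

theorem IsDoublingWeight.pos {μ : ℝ → ℝ} (hμ : IsDoublingWeight μ)
    {r : ℝ} (hr0 : 0 ≤ r) (hr1 : r < 1) : 0 < tail μ r := by
  rcases hr0.eq_or_lt with rfl | h
  · exact (hμ.tail_pos (1 / 2) (by norm_num)).trans_le
      (hμ.antitone le_rfl (by norm_num) (by norm_num))
  · exact hμ.tail_pos r ⟨h, hr1⟩

/-- The upper condition is iterated `j + 1` times, where `2 ^ j ≤ (1 - r) / (1 - t) < 2 ^ (j + 1)`.
Bounding its constant by `2 ^ γ` turns the iterates into a power of the ratio; `γ` is an integer so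
that ordinary powers suffice later. -/
theorem IsDoublingWeight.exists_upper_pow {μ : ℝ → ℝ} (hμ : IsDoublingWeight μ)
    : ∃ C : ℝ, ∃ γ : ℕ, 1 ≤ C ∧ ∀ r t : ℝ, 0 ≤ r → r ≤ t →
    t < 1 → tail μ r ≤ C * ((1 - r) / (1 - t)) ^ γ * tail μ t := by
  obtain ⟨A, hA, h⟩ := hμ.upper
  obtain ⟨γ, hγ⟩ := pow_unbounded_of_one_lt A (by norm_num : (1 : ℝ) < 2)
  have iter : ∀ (j : ℕ) (r : ℝ), 0 ≤ r → r < 1 →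
      tail μ r ≤ A ^ j * tail μ (1 - (1 - r) / 2 ^ j) := by
    intro j
    induction j with
    | zero => intro r _ _; simp
    | succ j ih =>
      intro r hr0 hr1
      have h1 := ih r hr0 hr1
      have hx : (1 - r) / 2 ^ j ≤ 1 := by
        rw [div_le_one (by positivity)]
        exact (by linarith : 1 - r ≤ 1).trans (one_le_pow₀ (by norm_num))
      have hx0 : 0 < (1 - r) / 2 ^ j := div_pos (by linarith) (by positivity)
      have h2 := h (1 - (1 - r) / 2 ^ j) ⟨by linarith, by linarith⟩
      have h3 : (1 + (1 - (1 - r) / 2 ^ j)) / 2 = 1 - (1 - r) / 2 ^ (j + 1) := by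
        rw [pow_succ]; field_simp; ring
      rw [h3] at h2
      calc tail μ r ≤ A ^ j * tail μ (1 - (1 - r) / 2 ^ j) := h1
        _ ≤ A ^ j * (A * tail μ (1 - (1 - r) / 2 ^ (j + 1))) := by gcongr
        _ = _ := by ring
  refine ⟨2 ^ γ, γ, one_le_pow₀ (by norm_num), fun r t hr0 hrt ht => ?_⟩
  have hr1 : 0 < 1 - r := by linarith
  have ht1 : 0 < 1 - t := by linarith
  have hq : 1 ≤ (1 - r) / (1 - t) := by rw [le_div_iff₀ ht1]; linarith
  obtain ⟨j, hj1, hj2⟩ := exists_nat_pow_near hq (by norm_num : (1 : ℝ) < 2)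
  have h1 := iter (j + 1) r hr0 (by linarith)
  have hle : (1 - r) / 2 ^ (j + 1) ≤ 1 - t := by
    rw [div_le_iff₀ (by positivity)]
    rw [div_lt_iff₀ ht1] at hj2
    linarith
  have hle1 : (1 - r) / 2 ^ (j + 1) ≥ 0 := by positivity
  have h2 : tail μ (1 - (1 - r) / 2 ^ (j + 1)) ≤ tail μ t :=
    hμ.antitone (by linarith) (by linarith) (by linarith)
  have htp := hμ.pos (hr0.trans hrt) ht
  calc tail μ r ≤ A ^ (j + 1) * tail μ (1 - (1 - r) / 2 ^ (j + 1)) := h1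
    _ ≤ (2 ^ γ) ^ (j + 1) * tail μ t := by
        have := hμ.pos (r := 1 - (1 - r) / 2 ^ (j + 1)) (by linarith)
          (by have : 0 < (1 - r) / 2 ^ (j + 1) := by positivity
              linarith)
        gcongr
    _ = 2 ^ γ * (2 ^ j) ^ γ * tail μ t := by ring
    _ ≤ 2 ^ γ * ((1 - r) / (1 - t)) ^ γ * tail μ t := by gcongr

/-- The iterated lower condition, with `η` chosen so that `K ^ η = A`. The lower condition enters
the proof only here, and serves to sum `1 / tail` geometrically and to see that the tail vanishes at
`1`. -/
theorem IsDoublingWeight.exists_lower_pow {μ : ℝ → ℝ} (hμ : IsDoublingWeight μ)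
    : ∃ C η : ℝ, 0 < C ∧ 0 < η ∧ ∀ r t : ℝ, 0 ≤ r → r ≤ t →
    t < 1 → tail μ t ≤ C * ((1 - t) / (1 - r)) ^ η * tail μ r := by
  obtain ⟨K, A, hK, hA, h⟩ := hμ.lower
  have hK0 : 0 < K := by linarith
  have iter : ∀ (j : ℕ) (r : ℝ), 0 ≤ r → r < 1 →
      A ^ j * tail μ (1 - (1 - r) / K ^ j) ≤ tail μ r := by
    intro j
    induction j with
    | zero => intro r _ _; simp
    | succ j ih =>
      intro r hr0 hr1
      have h1 := ih r hr0 hr1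
      have hx : (1 - r) / K ^ j ≤ 1 := by
        rw [div_le_one (by positivity)]
        exact (by linarith : 1 - r ≤ 1).trans (one_le_pow₀ hK.le)
      have hx0 : 0 < (1 - r) / K ^ j := div_pos (by linarith) (by positivity)
      have h2 := h (1 - (1 - r) / K ^ j) ⟨by linarith, by linarith⟩
      have h3 : 1 - (1 - (1 - (1 - r) / K ^ j)) / K = 1 - (1 - r) / K ^ (j + 1) := by
        rw [pow_succ]; field_simp; ring
      rw [h3] at h2
      calc A ^ (j + 1) * tail μ (1 - (1 - r) / K ^ (j + 1))
          = A ^ j * (A * tail μ (1 - (1 - r) / K ^ (j + 1))) := by ring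
        _ ≤ A ^ j * tail μ (1 - (1 - r) / K ^ j) := by gcongr
        _ ≤ _ := h1
  set η := Real.log A / Real.log K with hη
  have hη0 : 0 < η := div_pos (Real.log_pos hA) (Real.log_pos hK)
  have hKη : K ^ η = A := by
    rw [Real.rpow_def_of_pos hK0, hη, mul_div_cancel₀ _ (Real.log_pos hK).ne',
      Real.exp_log (by linarith)]
  refine ⟨A, η, by linarith, hη0, fun r t hr0 hrt ht => ?_⟩
  have hr1 : 0 < 1 - r := by linarith
  have ht1 : 0 < 1 - t := by linarith
  have hq : 1 ≤ (1 - r) / (1 - t) := by rw [le_div_iff₀ ht1]; linarith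
  obtain ⟨j, hj1, hj2⟩ := exists_nat_pow_near hq hK
  have h1 := iter j r hr0 (by linarith)
  have hle : 1 - t ≤ (1 - r) / K ^ j := by
    rw [le_div_iff₀ (by positivity)]
    rw [le_div_iff₀ ht1] at hj1
    linarith
  have hx : (1 - r) / K ^ j ≤ 1 := by
    rw [div_le_one (by positivity)]
    exact (by linarith : 1 - r ≤ 1).trans (one_le_pow₀ hK.le)
  have h2 : tail μ t ≤ tail μ (1 - (1 - r) / K ^ j) :=
    hμ.antitone (by linarith) (by linarith) (by linarith)
  have htp := hμ.pos (hr0.trans hrt) ht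
  -- The right side is the `η`-th power of `K ^ (j + 1) * (1 - t) / (1 - r)`, which exceeds `1` by
  -- the choice of `j`.
  have hAj : 1 ≤ A * ((1 - t) / (1 - r)) ^ η * A ^ j := by
    have e : ((1 - t) / (1 - r)) = ((1 - r) / (1 - t))⁻¹ := by rw [inv_div]
    rw [e, Real.inv_rpow (by positivity), ← hKη, ← Real.rpow_natCast, ← Real.rpow_mul hK0.le,
      mul_comm η, Real.rpow_mul hK0.le, Real.rpow_natCast, mul_right_comm,
      ← Real.mul_rpow hK0.le (by positivity), ← pow_succ']
    have : 0 < ((1 - r) / (1 - t)) ^ η := by positivity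
    rw [← div_eq_mul_inv, le_div_iff₀ this, one_mul]
    exact Real.rpow_le_rpow (by positivity) hj2.le hη0.le
  have hpow : 0 < ((1 - t) / (1 - r)) ^ η := by positivity
  calc tail μ t ≤ A * ((1 - t) / (1 - r)) ^ η * A ^ j * tail μ t :=
        le_mul_of_one_le_left htp.le hAj
    _ = A * ((1 - t) / (1 - r)) ^ η * (A ^ j * tail μ t) := by ring
    _ ≤ A * ((1 - t) / (1 - r)) ^ η * tail μ r := by
        gcongr
        exact le_trans (by gcongr) h1

theorem IsDoublingWeight.tendsto_tail {μ : ℝ → ℝ} (hμ : IsDoublingWeight μ)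
    : Tendsto (tail μ) (𝓝[<] 1) (𝓝 0) := by
  obtain ⟨C, η, hC, hη, h⟩ := hμ.exists_lower_pow
  have h1 : Tendsto (fun t : ℝ => C * ((1 - t) / (1 - 0)) ^ η * tail μ 0) (𝓝[<] 1) (𝓝 0) := by
    have : ContinuousAt (fun t : ℝ => C * ((1 - t) / (1 - 0)) ^ η * tail μ 0) 1 := by
      refine ContinuousAt.mul (ContinuousAt.mul continuousAt_const ?_) continuousAt_const
      exact ContinuousAt.rpow_const (by fun_prop) (Or.inr hη.le)
    have h2 := this.tendsto.mono_left (nhdsWithin_le_nhds (s := Iio 1))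
    simpa [Real.zero_rpow hη.ne'] using h2
  refine tendsto_of_tendsto_of_tendsto_of_le_of_le' tendsto_const_nhds h1 ?_ ?_
  · filter_upwards [Ioo_mem_nhdsLT (zero_lt_one' ℝ)] with t ht using (hμ.pos ht.1.le ht.2).le
  · filter_upwards [Ioo_mem_nhdsLT (zero_lt_one' ℝ)] with t ht using h 0 t le_rfl ht.1.le ht.2

/-! ### Moments of doubling weights -/

/-- With `x = 1 / (n + 1)`, Bernoulli's inequality gives `s ^ (2 * n + 1) ≥ 1 / 2` on `[1 - x / 4,
1)`, since `(2 * n + 1) * x ≤ 2`. Upper doubling moves the tail from `1 - x` to `1 - x / 4` at the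
cost of `4 ^ γ`. -/
theorem IsDoublingWeight.exists_tail_le_moment {μ : ℝ → ℝ} (hμ : IsDoublingWeight μ)
    : ∃ C : ℝ, 0 < C ∧ ∀ n : ℕ,
    tail μ (1 - 1 / ((n : ℝ) + 1)) ≤ C * moment μ (2 * n + 1) := by
  obtain ⟨C, γ, hC, h⟩ := hμ.exists_upper_pow
  refine ⟨C * 4 ^ γ * 2, by positivity, fun n => ?_⟩
  set x : ℝ := 1 / ((n : ℝ) + 1) with hx
  have hx0 : 0 < x := by positivity
  have hx1 : x ≤ 1 := by
    rw [hx, div_le_one (by positivity)]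
    have : (0 : ℝ) ≤ n := by positivity
    linarith
  have h1 := h (1 - x) (1 - x / 4) (by linarith) (by linarith) (by linarith)
  have h2 : (1 - (1 - x)) / (1 - (1 - x / 4)) = 4 := by
    rw [div_eq_iff] <;> linarith
  rw [h2] at h1
  have h3 : tail μ (1 - x / 4) ≤ 2 * moment μ (2 * n + 1) := by
    rw [moment_eq, tail_eq _ (by linarith), ← integral_const_mul]
    have hsub : Ico (1 - x / 4) 1 ⊆ Ico (0 : ℝ) 1 := Ico_subset_Ico_left (by linarith)
    have hintg := (integrableOn_pow_mul hμ.nonneg hμ.integrable (2 * n + 1)).const_mul 2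
    calc ∫ s in Ico (1 - x / 4) 1, μ s
        ≤ ∫ s in Ico (1 - x / 4) 1, 2 * (s ^ (2 * n + 1) * μ s) := by
          refine setIntegral_mono_on (hμ.integrable.mono_set hsub)
            (IntegrableOn.mono_set hintg hsub) measurableSet_Ico
            fun s hs => ?_
          have hb : 1 / 2 ≤ s ^ (2 * n + 1) := by
            have h5 := one_add_mul_le_pow (a := -(x / 4)) (by linarith) (2 * n + 1)
            have h6 : (1 + -(x / 4)) ^ (2 * n + 1) ≤ s ^ (2 * n + 1) :=
              pow_le_pow_left₀ (by linarith) (by linarith [hs.1]) _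
            have h7 : ((2 * n + 1 : ℕ) : ℝ) * x ≤ 2 := by
              rw [hx, mul_one_div, div_le_iff₀ (by positivity)]
              push_cast; linarith
            nlinarith
          have := hμ.nonneg s (hsub hs)
          nlinarith
      _ ≤ ∫ s in Ico 0 1, 2 * (s ^ (2 * n + 1) * μ s) := by
          refine setIntegral_mono_set hintg ?_ hsub.eventuallyLE
          filter_upwards [ae_restrict_mem measurableSet_Ico] with s hs
          exact mul_nonneg (by norm_num) (mul_nonneg (pow_nonneg hs.1 _) (hμ.nonneg s hs))
  calc _ ≤ C * 4 ^ γ * tail μ (1 - x / 4) := h1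
    _ ≤ C * 4 ^ γ * (2 * moment μ (2 * n + 1)) := by gcongr
    _ = _ := by ring

theorem IsDoublingWeight.moment_pos {μ : ℝ → ℝ} (hμ : IsDoublingWeight μ)
    (n : ℕ) : 0 < moment μ (2 * n + 1) := by
  obtain ⟨C, hC, h⟩ := hμ.exists_tail_le_moment
  have h1 : (0 : ℝ) < 1 / ((n : ℝ) + 1) := by positivity
  have h2 : 1 / ((n : ℝ) + 1) ≤ 1 := by
    rw [div_le_one (by positivity)]
    have : (0 : ℝ) ≤ n := by positivity
    linarith
  have := (hμ.pos (r := 1 - 1 / ((n : ℝ) + 1)) (by linarith) (by linarith)).trans_le (h n)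
  exact pos_of_mul_pos_right this hC.le

/-- On the `k`-th dyadic piece `s ^ (n + 1)` decays exponentially in `N / 2 ^ k`, while the tail
exceeds its value at `1 - 1 / N` by at most a multiple of `(N / 2 ^ k) ^ γ`. Decay of order `γ + 1`
is enough and leaves `∑ 2 ^ k / N`. The exponent is `n + 1`, not `2 * n + 1`, because
`exists_moment_sub_le` spends a factor `s ^ n` first. -/
theorem IsDoublingWeight.exists_moment_le_tail {μ : ℝ → ℝ} (hμ : IsDoublingWeight μ)
    : ∃ C : ℝ, 0 < C ∧ ∀ n : ℕ,
    moment μ (n + 1) ≤ C * tail μ (1 - 1 / ((n : ℝ) + 1)) := by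
  obtain ⟨C, γ, hC, h⟩ := hμ.exists_upper_pow
  refine ⟨C * (γ + 1).factorial * 2 ^ (γ + 1) * 2, by positivity, fun n => ?_⟩
  set N : ℝ := (n : ℝ) + 1 with hN
  have hN1 : 1 ≤ N := by
    have : (0 : ℝ) ≤ n := by positivity
    linarith
  have hN0 : 0 < N := by linarith
  obtain ⟨j, hj1, hj2⟩ := exists_nat_pow_near hN1 (by norm_num : (1 : ℝ) < 2)
  set S : ℕ → ℝ := fun k => (γ + 1).factorial / (N * (1 / 2) ^ (k + 1)) ^ (γ + 1) with hS
  have hS0 : ∀ k, 0 ≤ S k := fun k => by positivity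
  have hexp : ∀ k : ℕ, Real.exp (-(N * (1 / 2) ^ (k + 1))) ≤ S k := by
    intro k
    have hx : 0 < N * (1 / 2) ^ (k + 1) := by positivity
    have := Real.pow_div_factorial_le_exp _ hx.le (γ + 1)
    rw [Real.exp_neg, hS]
    simp only
    rw [inv_le_comm₀ (Real.exp_pos _) (by positivity), inv_div]
    exact this
  -- The last index also serves every `s ≥ rad (j + 1)`, where only `s ^ (n + 1) ≤ 1` is used.
  have hSj : 1 ≤ S j := by
    rw [hS]
    simp only
    rw [le_div_iff₀ (by positivity), one_mul]
    have h1 : N * (1 / 2) ^ (j + 1) ≤ 1 := by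
      rw [one_div, inv_pow, ← div_eq_mul_inv, div_le_one (by positivity)]
      exact hj2.le
    exact (pow_le_one₀ (by positivity) h1).trans (by exact_mod_cast (γ + 1).factorial_pos)
  have key := lintegral_mul_le_sum_tail hμ.nonneg hμ.integrable
    (H := fun s => ENNReal.ofReal (s ^ (n + 1))) (S := fun k => ENNReal.ofReal (S k)) j
    (by
      intro s hs
      rcases lt_or_ge s (rad (j + 1)) with h1 | h1
      · obtain ⟨k, hk, h2, h3⟩ := exists_rad_le_lt hs.1 j h1
        refine ⟨k, hk, h2, ENNReal.ofReal_le_ofReal ((?_ : _ ≤ _).trans (hexp k))⟩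
        calc s ^ (n + 1) ≤ (Real.exp (-(1 / 2) ^ (k + 1))) ^ (n + 1) := by
              refine pow_le_pow_left₀ hs.1 ?_ _
              have := Real.add_one_le_exp (-(1 / 2 : ℝ) ^ (k + 1))
              unfold rad at h3
              linarith
          _ = Real.exp (-(N * (1 / 2) ^ (k + 1))) := by
              rw [← Real.exp_nat_mul]
              congr 1
              push_cast
              ring
      · exact ⟨j, le_rfl, (rad_mono (Nat.le_succ j)).trans h1, ENNReal.ofReal_le_ofReal
          ((pow_le_one₀ hs.1 hs.2.le).trans hSj)⟩)
  rw [← ofReal_moment hμ.nonneg hμ.integrable] at key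
  have h2 : ∑ k ∈ Finset.range (j + 1), ENNReal.ofReal (S k) * ENNReal.ofReal (tail μ (rad k))
      = ENNReal.ofReal (∑ k ∈ Finset.range (j + 1), S k * tail μ (rad k)) := by
    rw [ENNReal.ofReal_sum_of_nonneg]
    · refine Finset.sum_congr rfl fun k _ => (ENNReal.ofReal_mul (hS0 k)).symm
    · intro k _
      exact mul_nonneg (hS0 k) (hμ.pos (rad_nonneg k) (rad_lt_one k)).le
  have hT0 : 0 < tail μ (1 - 1 / N) := by
    refine hμ.pos ?_ ?_
    · rw [sub_nonneg, div_le_one hN0]; exact hN1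
    · have : 0 < 1 / N := by positivity
      linarith
  rw [h2, ENNReal.ofReal_le_ofReal_iff (Finset.sum_nonneg fun k _ =>
    mul_nonneg (hS0 k) (hμ.pos (rad_nonneg k) (rad_lt_one k)).le)] at key
  refine key.trans ?_
  have hterm : ∀ k ∈ Finset.range (j + 1), S k * tail μ (rad k) ≤
      (C * (γ + 1).factorial * 2 ^ (γ + 1) * tail μ (1 - 1 / N)) * (2 ^ k / N) := by
    intro k hk
    have hkj : k ≤ j := Nat.lt_succ_iff.1 (Finset.mem_range.1 hk)
    have h2k : (2 : ℝ) ^ k ≤ N := (pow_le_pow_right₀ (by norm_num) hkj).trans hj1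
    have h1N : 1 / N ≤ (1 / 2) ^ k := by
      rw [div_pow, one_pow]
      exact one_div_le_one_div_of_le (by positivity) h2k
    have h1N0 : 0 < 1 / N := by positivity
    have h3 := h (rad k) (1 - 1 / N) (rad_nonneg k) (by unfold rad; linarith) (by linarith)
    have h4 : (1 - rad k) / (1 - (1 - 1 / N)) = N / 2 ^ k := by
      unfold rad
      rw [div_pow, one_pow]
      field_simp
      ring
    rw [h4] at h3
    calc S k * tail μ (rad k) ≤ S k * (C * (N / 2 ^ k) ^ γ * tail μ (1 - 1 / N)) := by
          gcongr
      _ = _ := by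
          have h5 : N * (1 / 2) ^ (k + 1) = N / 2 ^ k / 2 := by
            rw [div_pow 1 2 (k + 1), one_pow, pow_succ (2 : ℝ) k]
            field_simp
          have h6 : (2 : ℝ) ^ k / N = (N / 2 ^ k)⁻¹ := by rw [inv_div]
          have h7 : 0 < N / 2 ^ k := by positivity
          simp only [hS]
          rw [h5, h6, div_pow _ 2, pow_succ (N / 2 ^ k)]
          generalize N / 2 ^ k = x at h7
          field_simp
  refine (Finset.sum_le_sum hterm).trans ?_
  rw [← Finset.mul_sum, ← Finset.sum_div]
  have hg : (∑ k ∈ Finset.range (j + 1), (2 : ℝ) ^ k) / N ≤ 2 := by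
    rw [geom_sum_eq (by norm_num), div_le_iff₀ hN0, pow_succ]
    linarith
  calc _ ≤ (C * (γ + 1).factorial * 2 ^ (γ + 1) * tail μ (1 - 1 / N)) * 2 := by gcongr
    _ = _ := by ring

/-- The integrand of the difference is `s ^ n * (1 - s)`, at most `1 / (n + 1)`, times `(1 + s) * s
^ (n + 1)`. The moments of order `n + 1` and `2 * n + 1` are compared through the tail at `1 - 1 /
(n + 1)`. -/
theorem IsDoublingWeight.exists_moment_sub_le {μ : ℝ → ℝ} (hμ : IsDoublingWeight μ)
    : ∃ C : ℝ, 0 < C ∧ ∀ n : ℕ,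
    moment μ (2 * n + 1) - moment μ (2 * (n + 1) + 1) ≤
      C * moment μ (2 * n + 1) / ((n : ℝ) + 1) ∧
    moment μ (2 * (n + 1) + 1) ≤ moment μ (2 * n + 1) := by
  obtain ⟨C₁, hC₁, h₁⟩ := hμ.exists_tail_le_moment
  obtain ⟨C₂, hC₂, h₂⟩ := hμ.exists_moment_le_tail
  have hintg := integrableOn_pow_mul hμ.nonneg hμ.integrable
  refine ⟨2 * (C₂ * C₁), by positivity, fun n => ⟨?_, ?_⟩⟩
  · have h3 : moment μ (2 * n + 1) - moment μ (2 * (n + 1) + 1) ≤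
        2 / ((n : ℝ) + 1) * moment μ (n + 1) := by
      simp only [moment_eq]
      rw [← integral_sub (hintg _) (hintg _), ← integral_const_mul]
      refine setIntegral_mono_on ((hintg _).sub (hintg _)) ((hintg _).const_mul _) measurableSet_Ico
        fun s hs => ?_
      have h4 := pow_mul_one_sub_le hs.1 hs.2.le n
      have h5 : s ^ (2 * n + 1) * μ s - s ^ (2 * (n + 1) + 1) * μ s
          = (s ^ n * (1 - s)) * (1 + s) * (s ^ (n + 1) * μ s) := by ring
      rw [h5]
      have h6 : 0 ≤ s ^ (n + 1) * μ s := mul_nonneg (pow_nonneg hs.1 _) (hμ.nonneg s hs)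
      have h7 : (s ^ n * (1 - s)) * (1 + s) ≤ 1 / ((n : ℝ) + 1) * 2 :=
        mul_le_mul h4 (by linarith [hs.2]) (by linarith [hs.1]) (by positivity)
      calc _ ≤ 1 / ((n : ℝ) + 1) * 2 * (s ^ (n + 1) * μ s) := by gcongr
        _ = _ := by ring
    calc _ ≤ 2 / ((n : ℝ) + 1) * moment μ (n + 1) := h3
      _ ≤ 2 / ((n : ℝ) + 1) * (C₂ * (C₁ * moment μ (2 * n + 1))) := by
          gcongr
          exact (h₂ n).trans (by gcongr; exact h₁ n)
      _ = _ := by ring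
  · simp only [moment_eq]
    refine setIntegral_mono_on (hintg _) (hintg _) measurableSet_Ico fun s hs => ?_
    refine mul_le_mul_of_nonneg_right ?_ (hμ.nonneg s hs)
    exact pow_le_pow_of_le_one hs.1 hs.2.le (by omega)

/-- The moment is bounded below by the tail at `1 - 1 / (n + 1)`. If `r` lies to its left, upper
doubling costs a power of `(n + 1) * (1 - r)`; if to its right, monotonicity suffices. -/
theorem IsDoublingWeight.exists_inv_moment_le {μ : ℝ → ℝ} (hμ : IsDoublingWeight μ)
    : ∃ C : ℝ, ∃ γ : ℕ, 0 < C ∧ ∀ (n : ℕ) (r : ℝ),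
    0 ≤ r → r < 1 →
    1 / moment μ (2 * n + 1) ≤ C * (1 + (((n : ℝ) + 1) * (1 - r)) ^ γ) / tail μ r := by
  obtain ⟨C₁, hC₁, h₁⟩ := hμ.exists_tail_le_moment
  obtain ⟨C, γ, hC, h⟩ := hμ.exists_upper_pow
  refine ⟨C₁ * C, γ, by positivity, fun n r hr0 hr1 => ?_⟩
  have hm := hμ.moment_pos n
  have hr := hμ.pos hr0 hr1
  have hN : (0 : ℝ) < (n : ℝ) + 1 := by positivity
  have h1r : 0 < 1 - r := by linarith
  rw [div_le_div_iff₀ hm hr, one_mul]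
  have hmain : tail μ r ≤ C * (1 + (((n : ℝ) + 1) * (1 - r)) ^ γ) *
      tail μ (1 - 1 / ((n : ℝ) + 1)) := by
    have h2 : 1 / ((n : ℝ) + 1) ≤ 1 := by
      rw [div_le_one hN]
      have : (0 : ℝ) ≤ n := by positivity
      linarith
    have h3 : 0 < 1 / ((n : ℝ) + 1) := by positivity
    have h4 := hμ.pos (r := 1 - 1 / ((n : ℝ) + 1)) (by linarith) (by linarith)
    have h5 : 0 ≤ (((n : ℝ) + 1) * (1 - r)) ^ γ := by positivity
    rcases le_total r (1 - 1 / ((n : ℝ) + 1)) with h6 | h6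
    · have h7 := h r _ hr0 h6 (by linarith)
      have h8 : (1 - r) / (1 - (1 - 1 / ((n : ℝ) + 1))) = ((n : ℝ) + 1) * (1 - r) := by
        field_simp
        ring
      rw [h8] at h7
      refine h7.trans ?_
      gcongr
      linarith
    · refine (hμ.antitone (by linarith) h6 hr1.le).trans ?_
      refine le_mul_of_one_le_left h4.le ?_
      nlinarith
  calc tail μ r ≤ C * (1 + (((n : ℝ) + 1) * (1 - r)) ^ γ) * tail μ (1 - 1 / ((n : ℝ) + 1)) := hmain
    _ ≤ C * (1 + (((n : ℝ) + 1) * (1 - r)) ^ γ) * (C₁ * moment μ (2 * n + 1)) := by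
        gcongr; exact h₁ n
    _ = _ := by ring

theorem IsDoublingWeight.exists_inv_moment_le_pow {μ : ℝ → ℝ} (hμ : IsDoublingWeight μ)
    : ∃ C : ℝ, ∃ γ : ℕ, 0 < C ∧ ∀ n : ℕ,
    1 / moment μ (2 * n + 1) ≤ C * ((n : ℝ) + 1) ^ γ := by
  obtain ⟨C, γ, hC, h⟩ := hμ.exists_inv_moment_le
  have ht := hμ.pos le_rfl one_pos
  refine ⟨C * 2 / tail μ 0, γ, by positivity, fun n => (h n 0 le_rfl one_pos).trans ?_⟩
  have h1 : (1 : ℝ) ≤ ((n : ℝ) + 1) ^ γ := one_le_pow₀ (by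
    have : (0 : ℝ) ≤ n := by positivity
    linarith)
  rw [sub_zero, mul_one, div_mul_eq_mul_div, mul_assoc]
  gcongr
  linarith

/-- By Parseval this is the `L²` mean, on the circle of radius `r`, of the kernel with coefficients
`1 / moment`. Summing the polynomial factor against `r ^ n` returns `(1 - r) ^ (-2 * γ - 1)`, which
cancels all but one power of `1 - r`. -/
theorem IsDoublingWeight.exists_tsum_inv_moment_sq_le {μ : ℝ → ℝ} (hμ : IsDoublingWeight μ)
    : ∃ C : ℝ, 0 < C ∧ ∀ r : ℝ,
    0 ≤ r → r < 1 → Summable (fun n : ℕ => (1 / moment μ (2 * n + 1)) ^ 2 * r ^ (2 * n)) ∧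
    ∑' n : ℕ, (1 / moment μ (2 * n + 1)) ^ 2 * r ^ (2 * n) ≤ C / ((1 - r) * tail μ r ^ 2) := by
  obtain ⟨C, γ, hC, h⟩ := hμ.exists_inv_moment_le
  refine ⟨2 * C ^ 2 * (1 + (2 * γ).factorial), by positivity, fun r hr0 hr1 => ?_⟩
  have ht := hμ.pos hr0 hr1
  have h1r : 0 < 1 - r := by linarith
  obtain ⟨hs, hle⟩ := summable_succ_pow_mul_geometric (2 * γ) hr0 hr1
  have hg := summable_geometric_of_lt_one hr0 hr1
  set B : ℕ → ℝ := fun n => 2 * C ^ 2 / tail μ r ^ 2 *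
    (r ^ n + (1 - r) ^ (2 * γ) * (((n : ℝ) + 1) ^ (2 * γ) * r ^ n)) with hB
  have hBs : Summable B := (hg.add (hs.mul_left _)).mul_left _
  have hterm : ∀ n : ℕ, (1 / moment μ (2 * n + 1)) ^ 2 * r ^ (2 * n) ≤ B n := by
    intro n
    have hm := hμ.moment_pos n
    have h1 := h n r hr0 hr1
    set y := (((n : ℝ) + 1) * (1 - r)) ^ γ with hy
    have hy0 : 0 ≤ y := by positivity
    have hrn : r ^ (2 * n) ≤ r ^ n := pow_le_pow_of_le_one hr0 hr1.le (by omega)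
    calc (1 / moment μ (2 * n + 1)) ^ 2 * r ^ (2 * n)
        ≤ (C * (1 + y) / tail μ r) ^ 2 * r ^ n := by gcongr
      _ = C ^ 2 / tail μ r ^ 2 * (1 + y) ^ 2 * r ^ n := by ring
      _ ≤ C ^ 2 / tail μ r ^ 2 * (2 * (1 + y ^ 2)) * r ^ n := by
          gcongr
          nlinarith [sq_nonneg (1 - y)]
      _ = B n := by
          simp only [hB, hy, mul_pow]
          ring
  have hs0 : Summable (fun n : ℕ => (1 / moment μ (2 * n + 1)) ^ 2 * r ^ (2 * n)) :=
    Summable.of_nonneg_of_le (fun n => by positivity) hterm hBs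
  refine ⟨hs0, (hs0.tsum_le_tsum hterm hBs).trans ?_⟩
  rw [tsum_mul_left, hg.tsum_add (hs.mul_left _), tsum_mul_left, tsum_geometric_of_lt_one hr0 hr1]
  calc 2 * C ^ 2 / tail μ r ^ 2 * ((1 - r)⁻¹ + (1 - r) ^ (2 * γ) *
        ∑' n : ℕ, ((n : ℝ) + 1) ^ (2 * γ) * r ^ n)
      ≤ 2 * C ^ 2 / tail μ r ^ 2 * ((1 - r)⁻¹ + (1 - r) ^ (2 * γ) *
        ((2 * γ).factorial / (1 - r) ^ (2 * γ + 1))) := by gcongr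
    _ = _ := by
        field_simp
        ring

/-! ### The fractional integral as an average -/

theorem sq_mul_mem_disc {s : ℝ} (hs : s ∈ Ico (0 : ℝ) 1) {z : ℂ} (hz : z ∈ disc) :
    (s : ℂ) ^ 2 * z ∈ disc := by
  refine mul_mem_disc ?_ hz
  rw [norm_pow, Complex.norm_real, Real.norm_of_nonneg hs.1]
  exact pow_le_one₀ hs.1 hs.2.le

/-- Termwise integration: the odd exponent `2 * n + 1` is `s` times `(s ^ 2) ^ n`. -/
theorem hasSum_integral_moment {ν : ℝ → ℝ} (hi : IntegrableOn ν (Ico 0 1)) {h : ℂ → ℂ}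
    (hh : h ∈ Hol) {z : ℂ} (hz : z ∈ disc) :
    HasSum (fun n => (moment ν (2 * n + 1) : ℂ) * coeff h n * z ^ n)
      (∫ s in Ico (0 : ℝ) 1, (s : ℂ) * h ((s : ℂ) ^ 2 * z) * (ν s : ℂ)) := by
  have hsum := discSummable_coeff hh ‖z‖ (norm_nonneg z) (mem_disc.1 hz)
  have key : HasSum (fun n => ∫ s in Ico (0 : ℝ) 1,
      (coeff h n * z ^ n) * ((s ^ (2 * n + 1) * ν s : ℝ) : ℂ))
      (∫ s in Ico (0 : ℝ) 1, (s : ℂ) * h ((s : ℂ) ^ 2 * z) * (ν s : ℂ)) := by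
    refine hasSum_integral_of_dominated_convergence
      (fun n s => (‖coeff h n‖ * ‖z‖ ^ n) * |ν s|) ?_ ?_ ?_ ?_ ?_
    · intro n
      refine AEStronglyMeasurable.const_mul ?_ _
      exact Complex.continuous_ofReal.comp_aestronglyMeasurable
        ((continuous_pow _).aestronglyMeasurable.mul hi.aestronglyMeasurable)
    · intro n
      filter_upwards [ae_restrict_mem measurableSet_Ico] with s hs
      rw [norm_mul, norm_mul, norm_pow, Complex.norm_real, norm_mul, norm_pow,
        Real.norm_of_nonneg hs.1, Real.norm_eq_abs]
      gcongr
      exact mul_le_of_le_one_left (abs_nonneg _) (pow_le_one₀ hs.1 hs.2.le)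
    · exact Eventually.of_forall fun s => hsum.mul_right _
    · simp_rw [tsum_mul_right]
      exact hi.abs.const_mul _
    · filter_upwards [ae_restrict_mem measurableSet_Ico] with s hs
      have h1 := ((hasSum_coeff hh (sq_mul_mem_disc hs hz)).mul_left (s : ℂ)).mul_right (ν s : ℂ)
      have h2 : (fun n => (coeff h n * z ^ n) * ((s ^ (2 * n + 1) * ν s : ℝ) : ℂ))
          = fun n => (s : ℂ) * (coeff h n * ((s : ℂ) ^ 2 * z) ^ n) * (ν s : ℂ) := by
        funext n
        push_cast
        ring
      rw [h2]
      exact h1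
  have h3 : ∀ n, ∫ s in Ico (0 : ℝ) 1, (coeff h n * z ^ n) * ((s ^ (2 * n + 1) * ν s : ℝ) : ℂ)
      = (moment ν (2 * n + 1) : ℂ) * coeff h n * z ^ n := by
    intro n
    rw [integral_const_mul, integral_complex_ofReal, ← moment_eq]
    ring
  simp_rw [h3] at key
  exact key

theorem fracInt_eq_integral {ν : ℝ → ℝ} (hi : IntegrableOn ν (Ico 0 1)) {h : ℂ → ℂ}
    (hh : h ∈ Hol) {z : ℂ} (hz : z ∈ disc) :
    fracInt ν h z = ∫ s in Ico (0 : ℝ) 1, (s : ℂ) * h ((s : ℂ) ^ 2 * z) * (ν s : ℂ) :=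
  (hasSum_integral_moment hi hh hz).tsum_eq

theorem discSummable_moment_mul {ν : ℝ → ℝ} (hi : IntegrableOn ν (Ico 0 1)) {h : ℂ → ℂ}
    (hh : h ∈ Hol) : DiscSummable fun n => (moment ν (2 * n + 1) : ℂ) * coeff h n :=
  discSummable_of_forall_summable fun r hr0 hr1 =>
    (hasSum_integral_moment hi hh (z := (r : ℂ))
      (by simpa [mem_disc, abs_of_nonneg hr0] using hr1)).summable

theorem fracInt_hol {ν : ℝ → ℝ} (hi : IntegrableOn ν (Ico 0 1)) {h : ℂ → ℂ} (hh : h ∈ Hol) :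
    fracInt ν h ∈ Hol := powerSum_hol (discSummable_moment_mul hi hh)

theorem coeff_fracInt {ν : ℝ → ℝ} (hi : IntegrableOn ν (Ico 0 1)) {h : ℂ → ℂ} (hh : h ∈ Hol)
    (n : ℕ) : coeff (fracInt ν h) n = (moment ν (2 * n + 1) : ℂ) * coeff h n :=
  coeff_powerSum (discSummable_moment_mul hi hh) n

theorem fracInt_congr {ν : ℝ → ℝ} {h k : ℂ → ℂ} (hk : ∀ z ∈ disc, h z = k z) (z : ℂ) :
    fracInt ν h z = fracInt ν k z := by
  unfold fracInt
  simp_rw [coeff_congr hk]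

/-- If `s ^ 2 * ‖z‖` lies in the `k`-th dyadic piece then `s ≥ s ^ 2 * ‖z‖ ≥ rad k`, so those `s`
carry mass at most `tail ν (rad k)`. The estimate is used with the weights `2`, `s ^ 2 * μ s` and
`μ`. -/
theorem ofReal_norm_fracInt_le_sum {ν : ℝ → ℝ} (h0 : ∀ r ∈ Ico (0 : ℝ) 1, 0 ≤ ν r)
    (hi : IntegrableOn ν (Ico 0 1)) {h : ℂ → ℂ} (hh : h ∈ Hol) {z : ℂ} {n : ℕ}
    (hzn : ‖z‖ < rad (n + 1)) {S : ℕ → ℝ≥0∞}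
    (hS : ∀ k ≤ n, ∀ x : ℝ, 0 ≤ x → x ≤ 1 → rad k ≤ x * ‖z‖ → x * ‖z‖ < rad (k + 1) →
      ENNReal.ofReal ‖h ((x : ℂ) * z)‖ ≤ S k) :
    ENNReal.ofReal ‖fracInt ν h z‖ ≤
      ∑ k ∈ Finset.range (n + 1), S k * ENNReal.ofReal (tail ν (rad k)) := by
  rw [fracInt_eq_integral hi hh (mem_disc.2 (hzn.trans (rad_lt_one _))), ofReal_norm]
  refine (enorm_integral_le_lintegral_enorm _).trans (le_trans ?_
    (lintegral_mul_le_sum_tail h0 hi (H := fun s => ENNReal.ofReal ‖h (((s ^ 2 : ℝ) : ℂ) * z)‖)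
      (S := S) n ?_))
  · refine setLIntegral_mono' measurableSet_Ico fun s hs => ?_
    rw [← ofReal_norm, ← ENNReal.ofReal_mul (norm_nonneg _)]
    refine ENNReal.ofReal_le_ofReal ?_
    rw [norm_mul, norm_mul, Complex.norm_real, Complex.norm_real, Real.norm_of_nonneg (h0 s hs),
      Real.norm_of_nonneg hs.1]
    push_cast
    refine mul_le_mul_of_nonneg_right ?_ (h0 s hs)
    exact mul_le_of_le_one_left (norm_nonneg _) hs.2.le
  · intro s hs
    have h1 : s ^ 2 ≤ 1 := pow_le_one₀ hs.1 hs.2.le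
    have h2 : s ^ 2 * ‖z‖ ≤ ‖z‖ := mul_le_of_le_one_left (norm_nonneg z) h1
    obtain ⟨k, hk, h3, h4⟩ := exists_rad_le_lt (x := s ^ 2 * ‖z‖) (by positivity) n
      (h2.trans_lt hzn)
    refine ⟨k, hk, h3.trans ?_, hS k hk _ (by positivity) h1 h3 h4⟩
    have h5 : ‖z‖ ≤ 1 := hzn.le.trans (rad_lt_one _).le
    nlinarith [hs.1, hs.2, norm_nonneg z, sq_nonneg s]

/-! ### The fractional derivative -/

theorem IsDoublingWeight.discSummable_div_moment {μ : ℝ → ℝ} (hμ : IsDoublingWeight μ)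
    {a : ℕ → ℂ} (ha : DiscSummable a) :
    DiscSummable fun n => a n / (moment μ (2 * n + 1) : ℂ) := by
  obtain ⟨C, γ, -, h⟩ := hμ.exists_inv_moment_le_pow
  have := ha.mul_of_le (b := fun n => (1 / (moment μ (2 * n + 1) : ℂ))) (C := C) (m := γ)
    (fun n => by
      rw [norm_div, norm_one, Complex.norm_real, Real.norm_of_nonneg (hμ.moment_pos n).le]
      exact h n)
  convert this using 2 with n
  ring

theorem IsDoublingWeight.fracDeriv_hol {μ : ℝ → ℝ} (hμ : IsDoublingWeight μ)
    {g : ℂ → ℂ} (hg : g ∈ Hol) : fracDeriv μ g ∈ Hol :=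
  powerSum_hol (hμ.discSummable_div_moment (discSummable_coeff hg))

theorem IsDoublingWeight.coeff_fracDeriv {μ : ℝ → ℝ} (hμ : IsDoublingWeight μ)
    {g : ℂ → ℂ} (hg : g ∈ Hol) (n : ℕ) :
    coeff (fracDeriv μ g) n = coeff g n / (moment μ (2 * n + 1) : ℂ) :=
  coeff_powerSum (hμ.discSummable_div_moment (discSummable_coeff hg)) n

theorem IsDoublingWeight.moment_ne_zero {μ : ℝ → ℝ} (hμ : IsDoublingWeight μ)
    (n : ℕ) : (moment μ (2 * n + 1) : ℂ) ≠ 0 := by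
  exact_mod_cast (hμ.moment_pos n).ne'

theorem IsDoublingWeight.fracDeriv_fracInt {μ : ℝ → ℝ} (hμ : IsDoublingWeight μ)
    {h : ℂ → ℂ} (hh : h ∈ Hol) {z : ℂ} (hz : z ∈ disc) :
    fracDeriv μ (fracInt μ h) z = h z := by
  rw [← (hasSum_coeff hh hz).tsum_eq, fracDeriv]
  simp_rw [coeff_fracInt hμ.integrable hh, mul_div_cancel_left₀ _ (hμ.moment_ne_zero _)]

theorem IsDoublingWeight.volterra_hol {μ : ℝ → ℝ} (hμ : IsDoublingWeight μ)
    {f g : ℂ → ℂ} (hf : f ∈ Hol) (hg : g ∈ Hol) :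
    volterra μ g f ∈ Hol := fracInt_hol hμ.integrable (mul_hol hf (hμ.fracDeriv_hol hg))

theorem IsDoublingWeight.fracDeriv_volterra {μ : ℝ → ℝ} (hμ : IsDoublingWeight μ)
    {f g : ℂ → ℂ} (hf : f ∈ Hol) (hg : g ∈ Hol) {z : ℂ}
    (hz : z ∈ disc) : fracDeriv μ (volterra μ g f) z = f z * fracDeriv μ g z :=
  hμ.fracDeriv_fracInt (mul_hol hf (hμ.fracDeriv_hol hg)) hz

/-! ### Radial primitives -/

theorem integrableOn_two : IntegrableOn (fun _ : ℝ => (2 : ℝ)) (Ico 0 1) := by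
  simp

theorem tail_two (r : ℝ) : tail (fun _ => 2) r = 2 * (1 - r) := by
  simp [tail, mul_comm]

theorem moment_two (n : ℕ) : moment (fun _ => 2) (2 * n + 1) = 1 / ((n : ℝ) + 1) := by
  rw [moment, intervalIntegral.integral_mul_const, integral_pow]
  push_cast
  have : (n : ℝ) + 1 ≠ 0 := by positivity
  field_simp
  simp
  ring

theorem discSummable_succ_mul {a : ℕ → ℂ} (ha : DiscSummable a) :
    DiscSummable fun n => ((n : ℂ) + 1) * a n :=
  ha.mul_of_le (C := 1) (m := 1) fun n => by
    rw [show (n : ℂ) + 1 = ((n + 1 : ℕ) : ℂ) by push_cast; rfl, Complex.norm_natCast]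
    push_cast
    simp

/-- The constant weight `2` has moments `1 / (n + 1)`, so its fractional integral inverts `f ↦ (z
f)'`; a bound on `(z f)'` can thus be integrated along the radius. -/
theorem powerSum_eq_fracInt_two {a : ℕ → ℂ} (ha : DiscSummable a) (z : ℂ) :
    powerSum a z = fracInt (fun _ => 2) (powerSum fun n => ((n : ℂ) + 1) * a n) z := by
  unfold fracInt
  simp_rw [coeff_powerSum (discSummable_succ_mul ha), moment_two]
  rw [powerSum]
  congr 1
  funext n
  have : (n : ℂ) + 1 ≠ 0 := by exact_mod_cast n.succ_ne_zero
  push_cast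
  field_simp

/-- Lower doubling compares each term with the last one times a power of `q < 1`, so the last term
dominates; upper doubling compares that term with `1 / tail μ x`. -/
theorem IsDoublingWeight.exists_sum_inv_tail_le {μ : ℝ → ℝ} (hμ : IsDoublingWeight μ) :
    ∃ C : ℝ, 0 < C ∧ ∀ (n : ℕ) (x : ℝ), rad n ≤ x → x < rad (n + 1) →
      ∑ k ∈ Finset.range (n + 1), 1 / tail μ (rad (k + 1)) ≤ C / tail μ x := by
  obtain ⟨C, γ, hC, hup⟩ := hμ.exists_upper_pow
  obtain ⟨A, η, hA, hη, hlow⟩ := hμ.exists_lower_pow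
  set q : ℝ := (1 / 2 : ℝ) ^ η with hq
  have hq0 : 0 < q := by positivity
  have hq1 : q < 1 := Real.rpow_lt_one (by norm_num) (by norm_num) hη
  have h1q : 0 < 1 - q := by linarith
  refine ⟨A * (1 - q)⁻¹ * (C * 2 ^ γ), by positivity, fun n x hx1 hx2 => ?_⟩
  have hx0 : 0 ≤ x := (rad_nonneg n).trans hx1
  have htx := hμ.pos hx0 (hx2.trans (rad_lt_one _))
  have htn := hμ.pos (rad_nonneg (n + 1)) (rad_lt_one (n + 1))
  have h1 : tail μ x ≤ C * 2 ^ γ * tail μ (rad (n + 1)) := by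
    have h2 := hup (rad n) (rad (n + 1)) (rad_nonneg n) (rad_mono (Nat.le_succ n)) (rad_lt_one _)
    have h3 : (1 - rad n) / (1 - rad (n + 1)) = 2 := by
      unfold rad
      rw [pow_succ]
      field_simp
      ring
    rw [h3] at h2
    exact (hμ.antitone (rad_nonneg n) hx1 (hx2.trans (rad_lt_one _)).le).trans h2
  have hterm : ∀ k ∈ Finset.range (n + 1), 1 / tail μ (rad (k + 1)) ≤
      A * q ^ (n + 1 - 1 - k) * (1 / tail μ (rad (n + 1))) := by
    intro k hk
    have hkn : k ≤ n := Nat.lt_succ_iff.1 (Finset.mem_range.1 hk)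
    have h2 := hlow (rad (k + 1)) (rad (n + 1)) (rad_nonneg _) (rad_mono (by omega)) (rad_lt_one _)
    have h3 : (1 - rad (n + 1)) / (1 - rad (k + 1)) = (1 / 2) ^ (n - k) := by
      unfold rad
      rw [sub_sub_cancel, sub_sub_cancel, show n + 1 = (n - k) + (k + 1) by omega, pow_add]
      field_simp
    rw [h3, ← Real.rpow_natCast, ← Real.rpow_mul (by norm_num), mul_comm ((n - k : ℕ) : ℝ),
      Real.rpow_mul (by norm_num), Real.rpow_natCast] at h2
    have htk := hμ.pos (rad_nonneg (k + 1)) (rad_lt_one (k + 1))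
    rw [mul_one_div, div_le_div_iff₀ htk htn, one_mul, Nat.add_sub_cancel]
    exact h2
  refine (Finset.sum_le_sum hterm).trans ?_
  rw [← Finset.sum_mul, ← Finset.mul_sum, Finset.sum_range_reflect (fun j => q ^ j) (n + 1)]
  have hg : ∑ j ∈ Finset.range (n + 1), q ^ j ≤ (1 - q)⁻¹ := by
    rw [← tsum_geometric_of_lt_one hq0.le hq1]
    exact (summable_geometric_of_lt_one hq0.le hq1).sum_le_tsum _ fun _ _ => by positivity
  have h4 : 1 / tail μ (rad (n + 1)) ≤ C * 2 ^ γ / tail μ x := by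
    rw [div_le_div_iff₀ htn htx, one_mul]
    exact h1
  calc _ ≤ A * (1 - q)⁻¹ * (C * 2 ^ γ / tail μ x) := by gcongr
    _ = _ := by ring

/-- Radial integration gains exactly the factor `1 - ‖z‖`: on the `k`-th piece it cancels against
the mass `2 * (1 - rad k)` of the weight `2`, and `exists_sum_inv_tail_le` sums what is left. -/
theorem IsDoublingWeight.exists_norm_powerSum_le {μ : ℝ → ℝ} (hμ : IsDoublingWeight μ) :
    ∃ C : ℝ, 0 < C ∧ ∀ (M : ℝ) (a : ℕ → ℂ), 0 ≤ M → DiscSummable a →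
      (∀ w ∈ disc, ‖powerSum (fun n => ((n : ℂ) + 1) * a n) w‖ ≤ M / ((1 - ‖w‖) * tail μ ‖w‖)) →
      ∀ z ∈ disc, ‖powerSum a z‖ ≤ C * M / tail μ ‖z‖ := by
  obtain ⟨C, hC, h⟩ := hμ.exists_sum_inv_tail_le
  refine ⟨4 * C, by positivity, fun M a hM ha hle z hz => ?_⟩
  obtain ⟨n, hn1, hn2⟩ := exists_rad (norm_nonneg z) (mem_disc.1 hz)
  have htz := hμ.pos (norm_nonneg z) (mem_disc.1 hz)
  have ht : ∀ k, 0 < tail μ (rad k) := fun k => hμ.pos (rad_nonneg k) (rad_lt_one k)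
  rw [powerSum_eq_fracInt_two ha]
  have key := ofReal_norm_fracInt_le_sum (ν := fun _ => 2) (fun _ _ => zero_le_two) integrableOn_two
    (powerSum_hol (discSummable_succ_mul ha)) hn2
    (S := fun k => ENNReal.ofReal (M * 2 ^ (k + 1) / tail μ (rad (k + 1)))) (by
      intro k hk x hx0 hx1 h1 h2
      refine ENNReal.ofReal_le_ofReal ?_
      have hw : ‖(x : ℂ) * z‖ = x * ‖z‖ := by
        rw [norm_mul, Complex.norm_real, Real.norm_of_nonneg hx0]
      have hlt : x * ‖z‖ < 1 := h2.trans (rad_lt_one _)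
      refine (hle _ (mem_disc.2 (by rw [hw]; exact hlt))).trans ?_
      rw [hw, mul_div_assoc, div_eq_mul_inv]
      refine mul_le_mul_of_nonneg_left ?_ hM
      rw [← one_div, div_le_div_iff₀ (mul_pos (by linarith)
        (hμ.pos (by positivity) hlt)) (ht _), one_mul]
      have h3 : tail μ (rad (k + 1)) ≤ tail μ (x * ‖z‖) :=
        hμ.antitone (by positivity) h2.le (rad_lt_one _).le
      have h4 : 1 ≤ 2 ^ (k + 1) * (1 - x * ‖z‖) := by
        have h5 : (1 / 2 : ℝ) ^ (k + 1) ≤ 1 - x * ‖z‖ := by unfold rad at h2; linarith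
        calc (1 : ℝ) = 2 ^ (k + 1) * (1 / 2) ^ (k + 1) := by rw [← mul_pow]; norm_num
          _ ≤ _ := by gcongr
      calc tail μ (rad (k + 1)) ≤ tail μ (x * ‖z‖) := h3
        _ ≤ 2 ^ (k + 1) * (1 - x * ‖z‖) * tail μ (x * ‖z‖) :=
            le_mul_of_one_le_left ((ht _).le.trans h3) h4
        _ = _ := by ring)
  have h2 : ∑ k ∈ Finset.range (n + 1), ENNReal.ofReal (M * 2 ^ (k + 1) / tail μ (rad (k + 1))) *
      ENNReal.ofReal (tail (fun _ => 2) (rad k))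
      = ENNReal.ofReal (∑ k ∈ Finset.range (n + 1), 4 * M * (1 / tail μ (rad (k + 1)))) := by
    rw [ENNReal.ofReal_sum_of_nonneg fun k _ => by have := ht (k + 1); positivity]
    refine Finset.sum_congr rfl fun k _ => ?_
    rw [← ENNReal.ofReal_mul (by have := ht (k + 1); positivity), tail_two]
    congr 1
    have := (ht (k + 1)).ne'
    have h5 : (1 - rad k) = (2 ^ k)⁻¹ := by unfold rad; rw [sub_sub_cancel, one_div, inv_pow]
    rw [h5, pow_succ]
    field_simp
    ring
  rw [h2, ENNReal.ofReal_le_ofReal_iff (Finset.sum_nonneg fun k _ => by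
    have := ht (k + 1); positivity), ← Finset.mul_sum] at key
  calc _ ≤ _ := key
    _ ≤ 4 * M * (C / tail μ ‖z‖) := by gcongr; exact h n _ hn1 hn2
    _ = _ := by ring

/-! ### The kernel of the fractional derivative -/

theorem continuous_tsum_exp {b : ℕ → ℂ} (hb : Summable fun n => ‖b n‖) :
    Continuous fun t : ℝ => ∑' n, b n * Complex.exp (-(n * t * Complex.I)) := by
  refine continuous_tsum (fun n => by fun_prop) hb fun n t => ?_
  rw [norm_mul_exp_neg]

/-- The sum is a pairing of the two Fourier series, hence at most `M` times the `L¹` mean of the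
second. That series is a product, and the weighted inequality `2xy ≤ l x² + y² / l` replaces
Cauchy–Schwarz; `l` is chosen in the application. -/
theorem norm_tsum_mul_le {a b d u : ℕ → ℂ} {M l : ℝ} (hl : 0 < l)
    (ha : Summable fun n => ‖a n‖) (hb : Summable fun n => ‖b n‖)
    (hd : Summable fun n => ‖d n‖) (hu : Summable fun n => ‖u n‖)
    (hA : ∀ t : ℝ, ‖∑' n, a n * Complex.exp (n * t * Complex.I)‖ ≤ M)
    (hfac : ∀ t : ℝ, ∑' n, b n * Complex.exp (-(n * t * Complex.I)) =
      (∑' n, d n * Complex.exp (-(n * t * Complex.I))) *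
        ∑' n, u n * Complex.exp (-(n * t * Complex.I))) :
    ‖∑' n, a n * b n‖ ≤ M * ((l * ∑' n, ‖d n‖ ^ 2) + (∑' n, ‖u n‖ ^ 2) / l) / 2 := by
  have hpi := Real.pi_pos
  have hM : 0 ≤ M := (norm_nonneg _).trans (hA 0)
  have h1 := integral_pairing ha hb
  set D : ℝ → ℂ := fun t => ∑' n, d n * Complex.exp (-(n * t * Complex.I)) with hD
  set U : ℝ → ℂ := fun t => ∑' n, u n * Complex.exp (-(n * t * Complex.I)) with hU
  have hDc : Continuous D := continuous_tsum_exp hd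
  have hUc : Continuous U := continuous_tsum_exp hu
  have h2 := intervalIntegral.norm_integral_le_of_norm_le (μ := volume)
    (f := fun t : ℝ => (∑' n, a n * Complex.exp (n * t * Complex.I)) *
      (∑' n, b n * Complex.exp (-(n * t * Complex.I))))
    (g := fun t => M / 2 * (l * ‖D t‖ ^ 2 + ‖U t‖ ^ 2 / l)) (by positivity : 0 ≤ 2 * Real.pi)
    (Eventually.of_forall fun t _ => by
      rw [norm_mul, hfac t, norm_mul]
      have h3 : ‖D t‖ * ‖U t‖ ≤ (l * ‖D t‖ ^ 2 + ‖U t‖ ^ 2 / l) / 2 := by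
        have h4 : l * ‖D t‖ ^ 2 + ‖U t‖ ^ 2 / l - 2 * (‖D t‖ * ‖U t‖)
            = (l * ‖D t‖ - ‖U t‖) ^ 2 / l := by
          field_simp
          ring
        have : 0 ≤ (l * ‖D t‖ - ‖U t‖) ^ 2 / l := by positivity
        linarith
      calc _ ≤ M * ((l * ‖D t‖ ^ 2 + ‖U t‖ ^ 2 / l) / 2) :=
            mul_le_mul (hA t) h3 (by positivity) hM
        _ = _ := by ring)
    (Continuous.intervalIntegrable (by fun_prop) _ _)
  rw [h1, norm_mul, intervalIntegral.integral_const_mul, intervalIntegral.integral_add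
    (Continuous.intervalIntegrable (by fun_prop) _ _)
    (Continuous.intervalIntegrable (by fun_prop) _ _), intervalIntegral.integral_const_mul,
    intervalIntegral.integral_div, integral_normSq_tsum hd, integral_normSq_tsum hu] at h2
  have h5 : ‖(2 * Real.pi : ℂ)‖ = 2 * Real.pi := by
    rw [norm_mul, Complex.norm_real, Real.norm_of_nonneg hpi.le]
    simp
  rw [h5] at h2
  have h6 : M / 2 * (l * (2 * Real.pi * ∑' n, ‖d n‖ ^ 2) + 2 * Real.pi * (∑' n, ‖u n‖ ^ 2) / l)
      = 2 * Real.pi * (M * ((l * ∑' n, ‖d n‖ ^ 2) + (∑' n, ‖u n‖ ^ 2) / l) / 2) := by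
    ring
  rw [h6] at h2
  exact le_of_mul_le_mul_left h2 (by positivity)

/-- Backward differences of a sequence, with the convention `k (-1) = 0`. -/
def bdiff (k : ℕ → ℝ) : ℕ → ℝ
  | 0 => k 0
  | n + 1 => k (n + 1) - k n

/-- Summation by parts: multiplication by `1 - x` takes differences of the coefficients. -/
theorem tsum_bdiff_mul_geometric {k : ℕ → ℝ} {x : ℂ} (hx : ‖x‖ < 1)
    (hk : Summable fun n => ‖(k n : ℂ) * x ^ n‖) :
    ∑' n, (k n : ℂ) * x ^ n = (∑' n, (bdiff k n : ℂ) * x ^ n) * ∑' n, x ^ n := by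
  have hks : Summable fun n => (k n : ℂ) * x ^ n := hk.of_norm
  have h1 : Summable fun n => (k (n + 1) : ℂ) * x ^ (n + 1) := (summable_nat_add_iff 1).2 hks
  have h2 : Summable fun n => x * ((k n : ℂ) * x ^ n) := hks.mul_left x
  have e : ∀ n, (bdiff k (n + 1) : ℂ) * x ^ (n + 1)
      = (k (n + 1) : ℂ) * x ^ (n + 1) - x * ((k n : ℂ) * x ^ n) := by
    intro n
    simp only [bdiff]
    push_cast
    ring
  have hd : Summable fun n => (bdiff k n : ℂ) * x ^ n := by
    rw [← summable_nat_add_iff 1]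
    simp_rw [e]
    exact h1.sub h2
  have h3 : ∑' n, (bdiff k n : ℂ) * x ^ n = (1 - x) * ∑' n, (k n : ℂ) * x ^ n := by
    rw [hd.tsum_eq_zero_add]
    simp_rw [e]
    rw [h1.tsum_sub h2, tsum_mul_left, sub_mul, one_mul, hks.tsum_eq_zero_add]
    simp only [bdiff]
    ring
  rw [h3, tsum_geometric_of_norm_lt_one hx]
  have : 1 - x ≠ 0 := by
    intro h
    rw [sub_eq_zero] at h
    rw [← h] at hx
    simp at hx
  field_simp

theorem fracDeriv_comp_mul (μ : ℝ → ℝ) {F : ℂ → ℂ} (hF : F ∈ Hol) {c : ℂ} (hc : ‖c‖ ≤ 1)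
    (z : ℂ) : fracDeriv μ (fun w => F (c * w)) z = fracDeriv μ F (c * z) := by
  unfold fracDeriv
  simp_rw [coeff_comp_mul hF hc]
  congr 1
  funext n
  ring

/-- The relative decrease of the moments is `O(1 / (n + 1))`, so differencing removes the factor `n
+ 1`. -/
theorem IsDoublingWeight.exists_abs_bdiff_le {μ : ℝ → ℝ} (hμ : IsDoublingWeight μ)
    : ∃ C : ℝ, 0 < C ∧ ∀ n : ℕ,
    |bdiff (fun n => ((n : ℝ) + 1) / moment μ (2 * n + 1)) n| ≤ C * (1 / moment μ (2 * n + 1)) := by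
  obtain ⟨C, hC, h⟩ := hμ.exists_moment_sub_le
  refine ⟨1 + C, by positivity, fun n => ?_⟩
  cases n with
  | zero =>
    have := hμ.moment_pos 0
    simp only [bdiff]
    rw [abs_of_nonneg (by positivity)]
    simp only [Nat.cast_zero, zero_add]
    refine le_mul_of_one_le_left (by positivity) (by linarith)
  | succ n =>
    obtain ⟨h1, h2⟩ := h n
    have ha := hμ.moment_pos n
    have hb := hμ.moment_pos (n + 1)
    simp only [bdiff]
    set a := moment μ (2 * n + 1)
    set b := moment μ (2 * (n + 1) + 1)
    have hN : (0 : ℝ) < (n : ℝ) + 1 := by positivity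
    have e : (((n + 1 : ℕ) : ℝ) + 1) / b - ((n : ℝ) + 1) / a
        = (1 + ((n : ℝ) + 1) * ((a - b) / a)) * (1 / b) := by
      push_cast
      field_simp
      ring
    have h3 : 0 ≤ (a - b) / a := div_nonneg (by linarith) ha.le
    rw [e, abs_of_nonneg (by positivity)]
    refine mul_le_mul_of_nonneg_right ?_ (by positivity)
    have h4 : ((n : ℝ) + 1) * ((a - b) / a) ≤ C := by
      rw [← mul_div_assoc, div_le_iff₀ ha]
      rw [le_div_iff₀ hN] at h1
      linarith
    linarith

theorem IsDoublingWeight.exists_tail_le_half {μ : ℝ → ℝ} (hμ : IsDoublingWeight μ)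
    : ∃ A : ℝ, 1 ≤ A ∧ ∀ r t : ℝ, 0 ≤ r → r ≤ t →
    t ≤ (1 + r) / 2 → r < 1 → tail μ r ≤ A * tail μ t := by
  obtain ⟨C, γ, hC, h⟩ := hμ.exists_upper_pow
  refine ⟨C * 2 ^ γ, ?_, fun r t hr0 hrt ht hr1 => ?_⟩
  · have : (1 : ℝ) ≤ 2 ^ γ := one_le_pow₀ (by norm_num)
    nlinarith
  · have h1 := h r ((1 + r) / 2) hr0 (by linarith) (by linarith)
    have h2 : (1 - r) / (1 - (1 + r) / 2) = 2 := by
      rw [div_eq_iff] <;> linarith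
    rw [h2] at h1
    exact h1.trans (by gcongr; exact hμ.antitone (hr0.trans hrt) ht (by linarith))

/-- The kernel with coefficients `k n = (n + 1) / moment` is the product of the series of its
differences and a geometric series, and the two `L²` means are `≲ 1 / ((1 - s) * tail ^ 2)` and `≤ 1
/ (1 - s)`. The extra `n + 1` is deliberate: after differencing it leaves coefficients of size `1 /
moment`, whose square sum `exists_tsum_inv_moment_sq_le` controls for every doubling weight. -/
theorem IsDoublingWeight.exists_norm_succ_fracDeriv_le {μ : ℝ → ℝ} (hμ : IsDoublingWeight μ)
    : ∃ C : ℝ, 0 < C ∧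
    ∀ (M : ℝ) (F : ℂ → ℂ), F ∈ Hol → (∀ w ∈ disc, ‖F w‖ ≤ M) → ∀ z ∈ disc,
    ‖powerSum (fun n => ((n : ℂ) + 1) * (coeff F n / (moment μ (2 * n + 1) : ℂ))) z‖ ≤
      C * M / ((1 - ‖z‖) * tail μ ‖z‖) := by
  obtain ⟨C₁, hC₁, h₁⟩ := hμ.exists_abs_bdiff_le
  obtain ⟨C₂, hC₂, h₂⟩ := hμ.exists_tsum_inv_moment_sq_le
  obtain ⟨A, hA, hhalf⟩ := hμ.exists_tail_le_half
  refine ⟨(C₁ ^ 2 * C₂ + 1) * A, by positivity, fun M F hF hM z hz => ?_⟩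
  have hM0 : 0 ≤ M := (norm_nonneg _).trans (hM 0 zero_mem_disc)
  have hz1 : ‖z‖ < 1 := mem_disc.1 hz
  set r := ‖z‖ with hr
  have hr0 : 0 ≤ r := norm_nonneg z
  -- `F` is evaluated on the circle of radius `ρ` and the kernel at `ζ = z / ρ`. Since `r ≤ ‖ζ‖ ≤
  -- ρ`, both `1 - ‖ζ‖` and the tail at `‖ζ‖` remain comparable to their values at `r`.
  set ρ : ℝ := (1 + r) / 2 with hρ
  have hρ0 : 0 < ρ := by positivity
  have hρ1 : ρ < 1 := by rw [hρ]; linarith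
  set ζ : ℂ := z / ρ with hζ
  set s : ℝ := ‖ζ‖ with hs
  have hsr : s = r / ρ := by
    rw [hs, hζ, norm_div, Complex.norm_real, Real.norm_of_nonneg hρ0.le]
  have hs0 : 0 ≤ s := norm_nonneg ζ
  have hsle : s ≤ ρ := by
    rw [hsr, div_le_iff₀ hρ0, hρ]
    nlinarith [sq_nonneg (1 - r)]
  have hs1 : s < 1 := hsle.trans_lt hρ1
  have hrs : r ≤ s := by
    rw [hsr, le_div_iff₀ hρ0]
    nlinarith
  have hts := hμ.pos hs0 hs1
  set k : ℕ → ℝ := fun n => ((n : ℝ) + 1) / moment μ (2 * n + 1) with hk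
  set a : ℕ → ℂ := fun n => coeff F n * (ρ : ℂ) ^ n with ha'
  set b : ℕ → ℂ := fun n => (k n : ℂ) * ζ ^ n with hb'
  set d : ℕ → ℂ := fun n => (bdiff k n : ℂ) * ζ ^ n with hd'
  set u : ℕ → ℂ := fun n => ζ ^ n with hu'
  have hone : DiscSummable fun _ => 1 := by
    intro x hx0 hx1
    simpa using summable_geometric_of_lt_one hx0 hx1
  have hζd : ζ ∈ disc := mem_disc.2 hs1
  have hinv : DiscSummable fun n => 1 / (moment μ (2 * n + 1) : ℂ) :=
    hμ.discSummable_div_moment hone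
  have ha : Summable fun n => ‖a n‖ := by
    have := discSummable_coeff hF ρ hρ0.le hρ1
    simpa [ha', norm_mul, norm_pow, abs_of_pos hρ0] using this
  have hb : Summable fun n => ‖b n‖ := by
    have := (discSummable_succ_mul hinv) s hs0 hs1
    refine this.congr fun n => ?_
    rw [hb', hk]
    simp only [norm_mul, norm_pow]
    congr 2
    push_cast
    rw [← norm_mul, mul_one_div]
  have hd : Summable fun n => ‖d n‖ := by
    refine Summable.of_nonneg_of_le (fun n => norm_nonneg _) (fun n => ?_)
      ((hinv s hs0 hs1).mul_left C₁)
    rw [hd']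
    simp only [norm_mul, norm_pow, norm_div, norm_one, Complex.norm_real]
    rw [Real.norm_of_nonneg (hμ.moment_pos n).le, ← mul_assoc, Real.norm_eq_abs]
    gcongr
    exact h₁ n
  have hu : Summable fun n => ‖u n‖ := by
    simp only [hu', norm_pow]
    exact summable_geometric_of_lt_one hs0 hs1
  have hsplit : ∀ (n : ℕ) (t : ℝ), ζ ^ n * Complex.exp (-(n * t * Complex.I))
      = (ζ * Complex.exp (-(t * Complex.I))) ^ n := by
    intro n t
    rw [mul_pow, ← Complex.exp_nat_mul]
    congr 2
    ring
  have hnorm : ∀ t : ℝ, ‖ζ * Complex.exp (-(t * Complex.I))‖ = s := by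
    intro t
    rw [norm_mul, show -((t : ℂ) * Complex.I) = ((-t : ℝ) : ℂ) * Complex.I by push_cast; ring,
      Complex.norm_exp_ofReal_mul_I, mul_one]
  -- The choice `l = tail μ s` balances the two square sums: each contributes order `1 / ((1 - s) *
  -- tail μ s)`.
  have main := norm_tsum_mul_le (M := M) hts ha hb hd hu
    (by
      intro t
      have hw : (ρ : ℂ) * Complex.exp (t * Complex.I) ∈ disc := by
        rw [mem_disc, norm_mul, Complex.norm_exp_ofReal_mul_I, mul_one, Complex.norm_real,
          Real.norm_of_nonneg hρ0.le]
        exact hρ1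
      have h3 := (hasSum_coeff hF hw).tsum_eq
      have h4 : ∀ n : ℕ, a n * Complex.exp (n * t * Complex.I)
          = coeff F n * ((ρ : ℂ) * Complex.exp (t * Complex.I)) ^ n := by
        intro n
        rw [mul_pow, ← Complex.exp_nat_mul, ha']
        simp only
        rw [mul_assoc, mul_assoc (n : ℂ)]
      simp_rw [h4]
      rw [h3]
      exact hM _ hw)
    (by
      intro t
      have h5 := tsum_bdiff_mul_geometric (k := k) (x := ζ * Complex.exp (-(t * Complex.I)))
        (by rw [hnorm]; exact hs1) (by
          refine hb.congr fun n => ?_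
          rw [hb', norm_mul, norm_mul, norm_pow, norm_pow, hnorm])
      simp_rw [← hsplit, ← mul_assoc] at h5
      exact h5)
  have hX : ∑' n, ‖d n‖ ^ 2 ≤ C₁ ^ 2 * (C₂ / ((1 - s) * tail μ s ^ 2)) := by
    obtain ⟨h6, h7⟩ := h₂ s hs0 hs1
    refine le_trans ?_ (mul_le_mul_of_nonneg_left h7 (by positivity))
    rw [← tsum_mul_left]
    have hle : ∀ n, ‖d n‖ ^ 2 ≤ C₁ ^ 2 * ((1 / moment μ (2 * n + 1)) ^ 2 * s ^ (2 * n)) := by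
      intro n
      rw [hd']
      simp only [norm_mul, norm_pow, Complex.norm_real, Real.norm_eq_abs]
      rw [mul_pow, ← pow_mul, ← hs, mul_comm n 2, ← mul_assoc, ← mul_pow]
      gcongr
      exact h₁ n
    exact (Summable.of_nonneg_of_le (fun n => by positivity) hle (h6.mul_left _)).tsum_le_tsum hle
      (h6.mul_left _)
  have hY : ∑' n, ‖u n‖ ^ 2 ≤ 1 / (1 - s) := by
    have hg := summable_geometric_of_lt_one hs0 hs1
    rw [one_div, ← tsum_geometric_of_lt_one hs0 hs1]
    have hle : ∀ n, ‖u n‖ ^ 2 ≤ s ^ n := by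
      intro n
      rw [hu']
      simp only [norm_pow]
      rw [← pow_mul]
      exact pow_le_pow_of_le_one hs0 hs1.le (by omega)
    exact (Summable.of_nonneg_of_le (fun n => by positivity) hle hg).tsum_le_tsum hle hg
  have hfin : powerSum (fun n => ((n : ℂ) + 1) * (coeff F n / (moment μ (2 * n + 1) : ℂ))) z
      = ∑' n, a n * b n := by
    rw [powerSum]
    congr 1
    funext n
    have hρc : (ρ : ℂ) ≠ 0 := by exact_mod_cast hρ0.ne'
    simp only [ha', hb', hk, hζ, div_pow]
    push_cast
    field_simp
  rw [hfin]
  have h1s : 0 < 1 - s := by linarith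
  have h1r : 0 < 1 - r := by linarith
  have htr := hμ.pos hr0 hz1
  have h8 : tail μ r ≤ A * tail μ s := hhalf r s hr0 hrs hsle hz1
  have h9 : 1 - r ≤ 2 * (1 - s) := by linarith
  calc ‖∑' n, a n * b n‖
      ≤ M * ((tail μ s * ∑' n, ‖d n‖ ^ 2) + (∑' n, ‖u n‖ ^ 2) / tail μ s) / 2 := main
    _ ≤ M * ((tail μ s * (C₁ ^ 2 * (C₂ / ((1 - s) * tail μ s ^ 2)))) +
          (1 / (1 - s)) / tail μ s) / 2 := by gcongr
    _ = (C₁ ^ 2 * C₂ + 1) * M / (2 * ((1 - s) * tail μ s)) := by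
        field_simp
    _ ≤ (C₁ ^ 2 * C₂ + 1) * M / ((1 - r) * tail μ r / A) := by
        gcongr
        rw [div_le_iff₀ (by positivity)]
        calc (1 - r) * tail μ r ≤ (2 * (1 - s)) * (A * tail μ s) := by gcongr
          _ = _ := by ring
    _ = _ := by
        field_simp

theorem IsDoublingWeight.exists_norm_fracDeriv_le_of_bounded {μ : ℝ → ℝ} (hμ : IsDoublingWeight μ)
    : ∃ C : ℝ, 0 < C ∧
    ∀ (M : ℝ) (F : ℂ → ℂ), F ∈ Hol → (∀ w ∈ disc, ‖F w‖ ≤ M) → ∀ z ∈ disc,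
    ‖fracDeriv μ F z‖ ≤ C * M / tail μ ‖z‖ := by
  obtain ⟨C₁, hC₁, h₁⟩ := hμ.exists_norm_succ_fracDeriv_le
  obtain ⟨C₂, hC₂, h₂⟩ := hμ.exists_norm_powerSum_le
  refine ⟨C₂ * C₁, by positivity, fun M F hF hM z hz => ?_⟩
  have hM0 : 0 ≤ M := (norm_nonneg _).trans (hM 0 zero_mem_disc)
  have := h₂ (C₁ * M) _ (by positivity) (hμ.discSummable_div_moment (discSummable_coeff hF))
    (h₁ M F hF hM) z hz
  rwa [← mul_assoc] at this

/-- The fractional derivative at `z` is controlled by the maximum modulus on the disc of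
radius `(1 + |z|) / 2`. -/
theorem IsDoublingWeight.exists_norm_fracDeriv_le {μ : ℝ → ℝ} (hμ : IsDoublingWeight μ)
    : ∃ C : ℝ, 0 < C ∧
    ∀ (M : ℝ) (F : ℂ → ℂ) (z : ℂ), F ∈ Hol → z ∈ disc →
    (∀ w : ℂ, ‖w‖ ≤ (1 + ‖z‖) / 2 → ‖F w‖ ≤ M) → ‖fracDeriv μ F z‖ ≤ C * M / tail μ ‖z‖ := by
  obtain ⟨C, hC, h⟩ := hμ.exists_norm_fracDeriv_le_of_bounded
  obtain ⟨A, hA, hhalf⟩ := hμ.exists_tail_le_half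
  refine ⟨C * A, by positivity, fun M F z hF hz hM => ?_⟩
  have hM0 : 0 ≤ M := (norm_nonneg _).trans (hM 0 (by simp; positivity))
  have hz1 : ‖z‖ < 1 := mem_disc.1 hz
  have hr0 : 0 ≤ ‖z‖ := norm_nonneg z
  set ρ : ℝ := (1 + ‖z‖) / 2 with hρ
  have hρ0 : 0 < ρ := by positivity
  have hρ1 : ρ < 1 := by rw [hρ]; linarith
  have hρn : ‖(ρ : ℂ)‖ = ρ := by rw [Complex.norm_real, Real.norm_of_nonneg hρ0.le]
  have hρc : (ρ : ℂ) ≠ 0 := by exact_mod_cast hρ0.ne'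
  have hsr : ‖z / ρ‖ = ‖z‖ / ρ := by rw [norm_div, hρn]
  have hsle : ‖z / ρ‖ ≤ ρ := by
    rw [hsr, div_le_iff₀ hρ0, hρ]
    nlinarith [sq_nonneg (1 - ‖z‖)]
  have hrs : ‖z‖ ≤ ‖z / ρ‖ := by
    rw [hsr, le_div_iff₀ hρ0]
    nlinarith
  -- The dilate `F (ρ * ·)` is bounded on the whole disc, and its fractional derivative at `z / ρ`
  -- is that of `F` at `z`.
  have h1 := h M (fun w => F (ρ * w)) (comp_mul_hol hF (by rw [hρn]; exact hρ1.le))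
    (fun w hw => hM _ (by
      rw [norm_mul, hρn]
      exact mul_le_of_le_one_right hρ0.le (mem_disc.1 hw).le)) (z / ρ)
    (mem_disc.2 (hsle.trans_lt hρ1))
  rw [fracDeriv_comp_mul μ hF (by rw [hρn]; exact hρ1.le), mul_div_cancel₀ _ hρc] at h1
  refine h1.trans ?_
  have ht := hμ.pos hr0 hz1
  have ht2 := hμ.pos (norm_nonneg (z / ρ)) (hsle.trans_lt hρ1)
  rw [div_le_div_iff₀ ht2 ht]
  calc C * M * tail μ ‖z‖ ≤ C * M * (A * tail μ ‖z / ρ‖) := by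
        gcongr
        exact hhalf _ _ hr0 hrs hsle hz1
    _ = _ := by ring

/-! ### Comparison of the Bloch norms -/

/-- For a Bloch function, `G = (z g)'` is `O(1 / (1 - |w|))`. The Cauchy estimate for `D^μ` applied
to `G` bounds `(z D^μ g)' = D^μ G` by `1 / ((1 - |w|) * tail)`, and radial integration gives the
bound for `D^μ g`. The crude growth `2 * N / (1 - ‖v‖)` of `g` is enough for this. -/
theorem IsDoublingWeight.exists_fracBloch_le_bloch {μ : ℝ → ℝ} (hμ : IsDoublingWeight μ)
    : ∃ C : ℝ, 0 < C ∧
    ∀ (N : ℝ) (g : ℂ → ℂ), g ∈ Hol → ‖g 0‖ ≤ N →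
    (∀ z ∈ disc, (1 - ‖z‖ ^ 2) * ‖deriv g z‖ ≤ N) →
    ∀ z ∈ disc, tail μ ‖z‖ * ‖fracDeriv μ g z‖ ≤ C * N := by
  obtain ⟨C₁, hC₁, h₁⟩ := hμ.exists_norm_fracDeriv_le
  obtain ⟨C₂, hC₂, h₂⟩ := hμ.exists_norm_powerSum_le
  refine ⟨C₂ * (C₁ * 6), by positivity, fun N g hg hg0 hg1 z hz => ?_⟩
  have hN : 0 ≤ N := (norm_nonneg _).trans hg0
  have hgs := discSummable_coeff hg
  have hd1 : ∀ w ∈ disc, ∀ v ∈ disc, ‖w‖ ≤ ‖v‖ → ‖deriv g w‖ ≤ N / (1 - ‖v‖) := by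
    intro w hw v hv hwv
    have hv1 := mem_disc.1 hv
    have h3 := hg1 w hw
    rw [le_div_iff₀ (by linarith)]
    have h4 : 1 - ‖v‖ ≤ 1 - ‖w‖ ^ 2 := by nlinarith [norm_nonneg w, mem_disc.1 hw]
    nlinarith [norm_nonneg (deriv g w)]
  have hgb : ∀ v ∈ disc, ‖g v‖ ≤ 2 * N / (1 - ‖v‖) := by
    intro v hv
    have hv1 := mem_disc.1 hv
    have hsub : Metric.closedBall (0 : ℂ) ‖v‖ ⊆ disc := by
      intro w hw
      rw [mem_closedBall_zero_iff] at hw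
      exact mem_disc.2 (hw.trans_lt hv1)
    have h3 := Convex.norm_image_sub_le_of_norm_deriv_le (f := g) (C := N / (1 - ‖v‖))
      (s := Metric.closedBall 0 ‖v‖) (x := 0) (y := v)
      (fun w hw => DifferentiableOn.differentiableAt hg (isOpen_disc.mem_nhds (hsub hw)))
      (fun w hw => hd1 w (hsub hw) v hv (mem_closedBall_zero_iff.1 hw))
      (convex_closedBall 0 _) (by simp) (by simp)
    rw [sub_zero] at h3
    have h1v : 0 < 1 - ‖v‖ := by linarith
    have h4 : ‖g v‖ ≤ ‖g v - g 0‖ + ‖g 0‖ := by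
      simpa using norm_add_le (g v - g 0) (g 0)
    have h5 : N / (1 - ‖v‖) * ‖v‖ ≤ N / (1 - ‖v‖) :=
      mul_le_of_le_one_right (by positivity) hv1.le
    have h6 : N ≤ N / (1 - ‖v‖) := by
      rw [le_div_iff₀ h1v]
      nlinarith [norm_nonneg v]
    calc ‖g v‖ ≤ N / (1 - ‖v‖) + N / (1 - ‖v‖) := by linarith
      _ = _ := by ring
  set G : ℂ → ℂ := powerSum fun n => ((n : ℂ) + 1) * coeff g n with hG
  have hGh : G ∈ Hol := powerSum_hol (discSummable_succ_mul hgs)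
  have hGeq : ∀ w ∈ disc, G w = g w + w * deriv g w := by
    intro w hw
    have h3 := hasSum_coeff hg hw
    have h4 := (hasSum_coeff (deriv_hol hg) hw).mul_left w
    have h5 : HasSum (fun n : ℕ => (n : ℂ) * coeff g n * w ^ n) (w * deriv g w) := by
      rw [← hasSum_nat_add_iff' 1]
      simp only [Finset.range_one, Finset.sum_singleton, Nat.cast_zero, zero_mul, sub_zero]
      have e : (fun n : ℕ => ((n + 1 : ℕ) : ℂ) * coeff g (n + 1) * w ^ (n + 1))
          = fun n => w * (coeff (deriv g) n * w ^ n) := by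
        funext n
        rw [coeff_deriv]
        push_cast
        ring
      rw [e]
      exact h4
    have h6 := (h3.add h5).tsum_eq
    rw [← h6, hG, powerSum]
    congr 1
    funext n
    ring
  have hGb : ∀ w ∈ disc, ‖G w‖ ≤ 3 * N / (1 - ‖w‖) := by
    intro w hw
    have hw1 := mem_disc.1 hw
    rw [hGeq w hw]
    calc ‖g w + w * deriv g w‖ ≤ ‖g w‖ + ‖w‖ * ‖deriv g w‖ := by
          rw [← norm_mul]; exact norm_add_le _ _
      _ ≤ 2 * N / (1 - ‖w‖) + 1 * (N / (1 - ‖w‖)) := by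
          gcongr
          · exact hgb w hw
          · exact hd1 w hw w hw le_rfl
      _ = _ := by ring
  have hP : ∀ w ∈ disc, ‖powerSum (fun n => ((n : ℂ) + 1) *
      (coeff g n / (moment μ (2 * n + 1) : ℂ))) w‖ ≤ C₁ * 6 * N / ((1 - ‖w‖) * tail μ ‖w‖) := by
    intro w hw
    have hw1 := mem_disc.1 hw
    have h3 : powerSum (fun n => ((n : ℂ) + 1) * (coeff g n / (moment μ (2 * n + 1) : ℂ))) w
        = fracDeriv μ G w := by
      rw [powerSum, fracDeriv]
      congr 1
      funext n
      rw [hG, coeff_powerSum (discSummable_succ_mul hgs)]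
      ring
    rw [h3]
    -- On the disc of radius `(1 + ‖w‖) / 2` the distance to the circle at most halves, which
    -- doubles the constant `3`.
    have h4 := h₁ (6 * N / (1 - ‖w‖)) G w hGh hw (by
      intro v hv
      have hv1 : ‖v‖ < 1 := by linarith
      refine (hGb v (mem_disc.2 hv1)).trans ?_
      rw [div_le_div_iff₀ (by linarith) (by linarith)]
      nlinarith)
    refine h4.trans (le_of_eq ?_)
    have : 1 - ‖w‖ ≠ 0 := by linarith
    field_simp
  have h7 := h₂ (C₁ * 6 * N) _ (by positivity) (hμ.discSummable_div_moment hgs) hP z hz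
  have ht := hμ.pos (norm_nonneg z) (mem_disc.1 hz)
  have h8 : ‖fracDeriv μ g z‖ ≤ C₂ * (C₁ * 6 * N) / tail μ ‖z‖ := h7
  rw [le_div_iff₀ ht] at h8
  linarith

/-- With `h = D^μ g`, the derivative `g'` is a fractional integral of `h'`. Cauchy's estimate gives
`|h'| ≲ 2 ^ k / tail` on the `k`-th piece; the tails cancel by upper doubling, and `∑ 2 ^ k` is of
order `1 / (1 - |z|)`. -/
theorem IsDoublingWeight.exists_bloch_le_fracBloch {μ : ℝ → ℝ} (hμ : IsDoublingWeight μ)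
    : ∃ C : ℝ, 0 < C ∧
    ∀ (N : ℝ) (g : ℂ → ℂ), g ∈ Hol →
    (∀ z ∈ disc, tail μ ‖z‖ * ‖fracDeriv μ g z‖ ≤ N) →
    ‖g 0‖ ≤ C * N ∧ ∀ z ∈ disc, (1 - ‖z‖ ^ 2) * ‖deriv g z‖ ≤ C * N := by
  obtain ⟨A, hA, hhalf⟩ := hμ.exists_tail_le_half
  have ht0 := hμ.pos le_rfl one_pos
  have hm1 := hμ.moment_pos 0
  refine ⟨moment μ 1 / tail μ 0 + 16 * A ^ 2, by positivity, fun N g hg hN => ?_⟩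
  have hN0 : 0 ≤ N := (mul_nonneg (by simpa using ht0.le) (norm_nonneg _)).trans (hN 0 zero_mem_disc)
  set h := fracDeriv μ g with hh'
  have hh : h ∈ Hol := hμ.fracDeriv_hol hg
  have ht : ∀ k, 0 < tail μ (rad k) := fun k => hμ.pos (rad_nonneg k) (rad_lt_one k)
  constructor
  · have h1 := hμ.coeff_fracDeriv hg 0
    rw [coeff_zero, coeff_zero] at h1
    have h2 := hN 0 zero_mem_disc
    rw [hh', h1, norm_zero, norm_div, Complex.norm_real, Real.norm_of_nonneg hm1.le] at h2
    simp only [mul_zero, zero_add] at h2 hm1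
    have h3 : ‖g 0‖ ≤ moment μ 1 / tail μ 0 * N := by
      rw [div_mul_eq_mul_div, le_div_iff₀ ht0]
      rw [← mul_div_assoc, div_le_iff₀ hm1] at h2
      linarith
    refine h3.trans ?_
    gcongr
    have : 0 ≤ 16 * A ^ 2 := by positivity
    linarith
  · intro z hz
    have hz1 := mem_disc.1 hz
    obtain ⟨n, hn1, hn2⟩ := exists_rad (norm_nonneg z) hz1
    -- Differentiation shifts the coefficient index by one, and the factor `s ^ 2` shifts the
    -- moments to match.
    set ν : ℝ → ℝ := fun s => s ^ 2 * μ s with hν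
    have hν0 : ∀ s ∈ Ico (0 : ℝ) 1, 0 ≤ ν s := fun s hs =>
      mul_nonneg (sq_nonneg s) (hμ.nonneg s hs)
    have hνi : IntegrableOn ν (Ico 0 1) := integrableOn_pow_mul hμ.nonneg hμ.integrable 2
    have hνt : ∀ k, tail ν (rad k) ≤ tail μ (rad k) := by
      intro k
      have hsub : Ico (rad k) 1 ⊆ Ico (0 : ℝ) 1 := Ico_subset_Ico_left (rad_nonneg k)
      rw [tail_eq _ (rad_lt_one k).le, tail_eq _ (rad_lt_one k).le]
      refine setIntegral_mono_on (hνi.mono_set hsub) (hμ.integrable.mono_set hsub)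
        measurableSet_Ico fun s hs => ?_
      exact mul_le_of_le_one_left (hμ.nonneg s (hsub hs))
        (pow_le_one₀ (hsub hs).1 hs.2.le)
    have hνm : ∀ m : ℕ, moment ν (2 * m + 1) = moment μ (2 * (m + 1) + 1) := by
      intro m
      simp only [moment_eq, hν]
      congr 1
      funext s
      ring
    have hderiv : deriv g z = fracInt ν (deriv h) z := by
      rw [← (hasSum_coeff (deriv_hol hg) hz).tsum_eq, fracInt]
      congr 1
      funext m
      rw [coeff_deriv, coeff_deriv, hνm, hh', hμ.coeff_fracDeriv hg]
      have := hμ.moment_ne_zero (m + 1)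
      field_simp
    -- Cauchy's circle has radius `(1 - ‖w‖) / 2 ≥ 2 ^ (-(k + 2))` and lies in the disc of radius
    -- `rad (k + 2)`, hence the two shifts by `2`.
    have key := ofReal_norm_fracInt_le_sum hν0 hνi (deriv_hol hh) hn2
      (S := fun k => ENNReal.ofReal (N * 2 ^ (k + 2) / tail μ (rad (k + 2)))) (by
        intro k hk x hx0 hx1 h1 h2
        refine ENNReal.ofReal_le_ofReal ?_
        set w : ℂ := (x : ℂ) * z with hw'
        have hw : ‖w‖ = x * ‖z‖ := by
          rw [hw', norm_mul, Complex.norm_real, Real.norm_of_nonneg hx0]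
        rw [← hw] at h1 h2
        have hw1 : ‖w‖ < 1 := h2.trans (rad_lt_one _)
        have hR : 0 < (1 - ‖w‖) / 2 := by linarith
        have hpow : (1 / 2 : ℝ) ^ (k + 1) ≤ 1 - ‖w‖ := by unfold rad at h2; linarith
        have hball : ∀ v : ℂ, ‖v - w‖ ≤ (1 - ‖w‖) / 2 → ‖v‖ ≤ rad (k + 2) := by
          intro v hv
          have h3 : ‖v‖ ≤ ‖v - w‖ + ‖w‖ := by simpa using norm_add_le (v - w) w
          have h4 : rad (k + 2) = (1 + rad (k + 1)) / 2 := by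
            unfold rad
            rw [pow_succ _ (k + 1)]
            ring
          rw [h4]
          linarith
        have hdiff : DiffContOnCl ℂ h (Metric.ball w ((1 - ‖w‖) / 2)) := by
          refine (DifferentiableOn.mono hh ?_).diffContOnCl
          rw [closure_ball _ hR.ne']
          intro v hv
          rw [Metric.mem_closedBall, dist_eq_norm] at hv
          exact mem_disc.2 ((hball v hv).trans_lt (rad_lt_one _))
        have h5 := Complex.norm_deriv_le_of_forall_mem_sphere_norm_le
          (C := N / tail μ (rad (k + 2))) hR hdiff (by
            intro v hv
            rw [mem_sphere_iff_norm] at hv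
            have h6 := hball v hv.le
            have h7 := hN v (mem_disc.2 (h6.trans_lt (rad_lt_one _)))
            rw [le_div_iff₀ (ht _)]
            have h8 := hμ.antitone (norm_nonneg v) h6 (rad_lt_one _).le
            nlinarith [norm_nonneg (h v)])
        refine h5.trans ?_
        rw [div_div, div_le_div_iff₀ (mul_pos (ht _) hR) (ht _)]
        have h9 : 1 ≤ 2 ^ (k + 2) * ((1 - ‖w‖) / 2) := by
          calc (1 : ℝ) = 2 ^ (k + 2) * ((1 / 2) ^ (k + 1) / 2) := by
                rw [pow_succ (2 : ℝ) (k + 1), div_pow, one_pow]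
                field_simp
            _ ≤ _ := by gcongr
        have h10 : 0 ≤ N * tail μ (rad (k + 2)) := mul_nonneg hN0 (ht _).le
        calc N * tail μ (rad (k + 2)) ≤ N * tail μ (rad (k + 2)) * (2 ^ (k + 2) * ((1 - ‖w‖) / 2)) :=
              le_mul_of_one_le_right h10 h9
          _ = _ := by ring)
    rw [← hderiv] at key
    have hsum : ∑ k ∈ Finset.range (n + 1), ENNReal.ofReal (N * 2 ^ (k + 2) / tail μ (rad (k + 2))) *
        ENNReal.ofReal (tail ν (rad k)) ≤
        ENNReal.ofReal (∑ k ∈ Finset.range (n + 1), 4 * A ^ 2 * N * 2 ^ k) := by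
      rw [ENNReal.ofReal_sum_of_nonneg fun k _ => by positivity]
      refine Finset.sum_le_sum fun k _ => ?_
      rw [← ENNReal.ofReal_mul (by have := ht (k + 2); positivity)]
      refine ENNReal.ofReal_le_ofReal ?_
      have hstep : ∀ j, tail μ (rad j) ≤ A * tail μ (rad (j + 1)) := by
        intro j
        refine hhalf _ _ (rad_nonneg j) (rad_mono (Nat.le_succ j)) (le_of_eq ?_) (rad_lt_one j)
        unfold rad
        rw [pow_succ]
        ring
      have h3 : tail ν (rad k) ≤ A ^ 2 * tail μ (rad (k + 2)) := by
        calc _ ≤ A * tail μ (rad (k + 1)) := (hνt k).trans (hstep k)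
          _ ≤ A * (A * tail μ (rad (k + 2))) := by gcongr; exact hstep (k + 1)
          _ = _ := by ring
      have h4 := ht (k + 2)
      calc N * 2 ^ (k + 2) / tail μ (rad (k + 2)) * tail ν (rad k)
          ≤ N * 2 ^ (k + 2) / tail μ (rad (k + 2)) * (A ^ 2 * tail μ (rad (k + 2))) := by gcongr
        _ = _ := by
            field_simp
            ring
    have h3 := key.trans hsum
    rw [ENNReal.ofReal_le_ofReal_iff (Finset.sum_nonneg fun k _ => by positivity),
      ← Finset.mul_sum, geom_sum_eq (by norm_num)] at h3
    have h4 : (1 - ‖z‖) * 2 ^ n ≤ 1 := by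
      have h5 : 1 - ‖z‖ ≤ (1 / 2) ^ n := by unfold rad at hn1; linarith
      calc (1 - ‖z‖) * 2 ^ n ≤ (1 / 2) ^ n * 2 ^ n := by gcongr
        _ = 1 := by rw [← mul_pow]; norm_num
    have h6 : ‖deriv g z‖ ≤ 8 * A ^ 2 * N * 2 ^ n := by
      refine h3.trans ?_
      have : 0 ≤ 4 * A ^ 2 * N := by positivity
      have h7 : ((2 : ℝ) ^ (n + 1) - 1) / (2 - 1) ≤ 2 * 2 ^ n := by
        rw [pow_succ]
        linarith
      calc _ ≤ 4 * A ^ 2 * N * (2 * 2 ^ n) := by gcongr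
        _ = _ := by ring
    have h7 : 1 - ‖z‖ ^ 2 ≤ 2 * (1 - ‖z‖) := by nlinarith [norm_nonneg z]
    have h1z : 0 < 1 - ‖z‖ := by linarith
    calc (1 - ‖z‖ ^ 2) * ‖deriv g z‖ ≤ (2 * (1 - ‖z‖)) * (8 * A ^ 2 * N * 2 ^ n) := by
          gcongr
      _ = 16 * A ^ 2 * N * ((1 - ‖z‖) * 2 ^ n) := by ring
      _ ≤ 16 * A ^ 2 * N * 1 := by gcongr
      _ ≤ (moment μ 1 / tail μ 0 + 16 * A ^ 2) * N := by
          have : 0 ≤ moment μ 1 / tail μ 0 * N := mul_nonneg (div_nonneg hm1.le ht0.le) hN0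
          linarith

/-! ### Sub-mean value estimates -/

/-- An argument that avoids subharmonicity of `|h|^p`. Maximize `(R / 2 - ‖w - c‖) ^ 2 * ‖h w‖ ^ p`
at `w₀`. Near `w₀`, at the scale of the first factor `d`, maximality gives `‖h‖ ≤ K * ‖h w₀‖`;
Cauchy then bounds `h'`, so `‖h‖ ≥ ‖h w₀‖ / 2` on a ball of radius `ε * d`. The integral over that
ball already dominates the maximum, hence the value at `c`. -/
theorem exists_subMean {p : ℝ} (hp : 0 < p) : ∃ C : ℝ, 0 < C ∧
    ∀ (h : ℂ → ℂ) (c : ℂ) (R : ℝ), 0 < R → DifferentiableOn ℂ h (Metric.ball c R) →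
    ENNReal.ofReal (R ^ 2 * ‖h c‖ ^ p) ≤
      ENNReal.ofReal C * ∫⁻ w in Metric.ball c R, ENNReal.ofReal (‖h w‖ ^ p) := by
  -- The factor `d` drops to no less than `d / 2` within distance `d / 2` of `w₀`, so `‖h‖ ^ p`
  -- grows there by at most `4`. Cauchy on radius `d / 4` then allows a variation `4 * K * ε * m = m
  -- / 2`, which fixes `ε`.
  set K : ℝ := (4 : ℝ) ^ (1 / p) with hK
  have hK1 : 1 ≤ K := Real.one_le_rpow (by norm_num) (by positivity)
  set ε : ℝ := 1 / (8 * K) with hε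
  have hε0 : 0 < ε := by positivity
  have hε1 : ε ≤ 1 / 8 := by
    rw [hε]
    refine one_div_le_one_div_of_le (by norm_num) ?_
    linarith
  have hpi := Real.pi_pos
  refine ⟨4 * 2 ^ p / (ε ^ 2 * Real.pi), by positivity, fun h c R hR hh => ?_⟩
  rcases eq_or_ne (h c) 0 with hc | hc
  · simp [hc, Real.zero_rpow hp.ne']
  have hsub : Metric.closedBall c (R / 2) ⊆ Metric.ball c R :=
    Metric.closedBall_subset_ball (by linarith)
  set φ : ℂ → ℝ := fun w => (R / 2 - ‖w - c‖) ^ 2 * ‖h w‖ ^ p with hφ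
  have hφc : ContinuousOn φ (Metric.closedBall c (R / 2)) := by
    refine ContinuousOn.mul (by fun_prop) ?_
    exact ContinuousOn.rpow_const (hh.continuousOn.mono hsub).norm fun _ _ => Or.inr hp.le
  obtain ⟨w₀, hw₀, hmax⟩ := (isCompact_closedBall c (R / 2)).exists_isMaxOn
    ⟨c, Metric.mem_closedBall_self (by positivity)⟩ hφc
  have hφ0 : φ c ≤ φ w₀ := hmax (Metric.mem_closedBall_self (by positivity))
  have hφcv : φ c = (R / 2) ^ 2 * ‖h c‖ ^ p := by simp [hφ]
  have hcp : 0 < ‖h c‖ := norm_pos_iff.2 hc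
  have hφpos : 0 < φ w₀ := lt_of_lt_of_le (by rw [hφcv]; positivity) hφ0
  set d : ℝ := R / 2 - ‖w₀ - c‖ with hd
  set m : ℝ := ‖h w₀‖ with hm
  have hd0 : 0 < d := by
    have h1 : 0 ≤ d := by
      rw [Metric.mem_closedBall, dist_eq_norm] at hw₀
      linarith
    refine lt_of_le_of_ne h1 fun h2 => ?_
    rw [hφ] at hφpos
    simp only [← hd, ← h2] at hφpos
    norm_num at hφpos
  have hm0 : 0 < m := by
    refine lt_of_le_of_ne (norm_nonneg _) fun h2 => ?_
    rw [hφ] at hφpos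
    simp only [← hm, ← h2, Real.zero_rpow hp.ne', mul_zero, lt_irrefl] at hφpos
  have hbound : ∀ w : ℂ, ‖w - w₀‖ ≤ d / 2 → ‖w - c‖ ≤ R / 2 ∧ ‖h w‖ ≤ K * m := by
    intro w hw
    have h1 : ‖w - c‖ ≤ ‖w - w₀‖ + ‖w₀ - c‖ := by
      simpa using norm_add_le (w - w₀) (w₀ - c)
    have h2 : d / 2 ≤ R / 2 - ‖w - c‖ := by rw [hd] at *; linarith
    have h3 : ‖w - c‖ ≤ R / 2 := by linarith
    refine ⟨h3, ?_⟩
    have h4 : φ w ≤ φ w₀ := hmax (by rw [Metric.mem_closedBall, dist_eq_norm]; exact h3)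
    have h5 : (d / 2) ^ 2 * ‖h w‖ ^ p ≤ d ^ 2 * m ^ p := by
      refine le_trans ?_ h4
      rw [hφ]
      simp only
      gcongr
    have h6 : ‖h w‖ ^ p ≤ 4 * m ^ p := by
      have h7 : d ^ 2 * ‖h w‖ ^ p ≤ d ^ 2 * (4 * m ^ p) := by nlinarith
      exact le_of_mul_le_mul_left h7 (by positivity)
    have h8 : 4 * m ^ p = (K * m) ^ p := by
      rw [Real.mul_rpow (by positivity) hm0.le, hK, ← Real.rpow_mul (by norm_num),
        one_div_mul_cancel hp.ne', Real.rpow_one]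
    rw [h8] at h6
    exact (Real.rpow_le_rpow_iff (norm_nonneg _) (by positivity) hp).1 h6
  have hderiv : ∀ w : ℂ, ‖w - w₀‖ ≤ d / 4 → DifferentiableAt ℂ h w ∧
      ‖deriv h w‖ ≤ K * m / (d / 4) := by
    intro w hw
    have hb : ∀ v : ℂ, ‖v - w‖ ≤ d / 4 → ‖v - w₀‖ ≤ d / 2 := by
      intro v hv
      have : ‖v - w₀‖ ≤ ‖v - w‖ + ‖w - w₀‖ := by simpa using norm_add_le (v - w) (w - w₀)
      linarith
    have hin : ∀ v : ℂ, ‖v - w‖ ≤ d / 4 → v ∈ Metric.ball c R := fun v hv => hsub (by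
      rw [Metric.mem_closedBall, dist_eq_norm]
      exact (hbound v (hb v hv)).1)
    refine ⟨hh.differentiableAt (Metric.isOpen_ball.mem_nhds (hin w (by simp; positivity))), ?_⟩
    refine Complex.norm_deriv_le_of_forall_mem_sphere_norm_le (by positivity) ?_ fun v hv => ?_
    · refine (hh.mono ?_).diffContOnCl
      rw [closure_ball _ (by positivity)]
      intro v hv
      rw [Metric.mem_closedBall, dist_eq_norm] at hv
      exact hin v hv
    · rw [mem_sphere_iff_norm] at hv
      exact (hbound v (hb v hv.le)).2
  have hlow : ∀ w ∈ Metric.ball w₀ (ε * d), m / 2 ≤ ‖h w‖ := by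
    intro w hw
    have hεd : ε * d ≤ d / 4 := by nlinarith
    rw [mem_ball_iff_norm] at hw
    have h1 := Convex.norm_image_sub_le_of_norm_deriv_le (f := h) (C := K * m / (d / 4))
      (s := Metric.closedBall w₀ (d / 4)) (x := w₀) (y := w)
      (fun v hv => (hderiv v (by rwa [← dist_eq_norm])).1)
      (fun v hv => (hderiv v (by rwa [← dist_eq_norm])).2)
      (convex_closedBall _ _) (Metric.mem_closedBall_self (by positivity))
      (by rw [Metric.mem_closedBall, dist_eq_norm]; linarith)
    have h2 : K * m / (d / 4) * ‖w - w₀‖ ≤ m / 2 := by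
      calc K * m / (d / 4) * ‖w - w₀‖ ≤ K * m / (d / 4) * (ε * d) := by gcongr
        _ = m / 2 := by rw [hε]; field_simp; norm_num
    have h3 : m ≤ ‖h w‖ + ‖h w - h w₀‖ := by
      have := norm_sub_le (h w) (h w - h w₀)
      simpa using this
    linarith
  have hball : Metric.ball w₀ (ε * d) ⊆ Metric.ball c R := fun w hw => hsub (by
    rw [mem_ball_iff_norm] at hw
    rw [Metric.mem_closedBall, dist_eq_norm]
    exact (hbound w (by nlinarith)).1)
  have hintg : ENNReal.ofReal ((m / 2) ^ p * ((ε * d) ^ 2 * Real.pi)) ≤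
      ∫⁻ w in Metric.ball c R, ENNReal.ofReal (‖h w‖ ^ p) := by
    calc ENNReal.ofReal ((m / 2) ^ p * ((ε * d) ^ 2 * Real.pi))
        = ∫⁻ w in Metric.ball w₀ (ε * d), ENNReal.ofReal ((m / 2) ^ p) := by
          rw [setLIntegral_const, Complex.volume_ball, ENNReal.ofReal_mul (by positivity),
            ENNReal.ofReal_mul (by positivity), ENNReal.ofReal_pow (by positivity)]
          congr 2
          rw [← NNReal.coe_real_pi, ENNReal.ofReal_coe_nnreal]
      _ ≤ ∫⁻ w in Metric.ball w₀ (ε * d), ENNReal.ofReal (‖h w‖ ^ p) := by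
          refine setLIntegral_mono' measurableSet_ball fun w hw => ENNReal.ofReal_le_ofReal ?_
          exact Real.rpow_le_rpow (by positivity) (hlow w hw) hp.le
      _ ≤ _ := lintegral_mono_set hball
  calc ENNReal.ofReal (R ^ 2 * ‖h c‖ ^ p)
      ≤ ENNReal.ofReal (4 * 2 ^ p / (ε ^ 2 * Real.pi) *
          ((m / 2) ^ p * ((ε * d) ^ 2 * Real.pi))) := by
        refine ENNReal.ofReal_le_ofReal ?_
        have e : 4 * 2 ^ p / (ε ^ 2 * Real.pi) * ((m / 2) ^ p * ((ε * d) ^ 2 * Real.pi))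
            = 4 * φ w₀ := by
          rw [Real.div_rpow hm0.le (by norm_num), hφ]
          simp only [← hd, ← hm]
          field_simp
        rw [e]
        rw [hφcv] at hφ0
        linarith
    _ = ENNReal.ofReal (4 * 2 ^ p / (ε ^ 2 * Real.pi)) *
          ENNReal.ofReal ((m / 2) ^ p * ((ε * d) ^ 2 * Real.pi)) :=
        ENNReal.ofReal_mul (by positivity)
    _ ≤ _ := by gcongr

theorem exists_rpow_le_of_comparable (α : ℝ) : ∃ c : ℝ, 0 < c ∧ ∀ x y : ℝ, 0 < x → x / 8 ≤ y →
    y ≤ 8 * x → y ^ α ≤ c * x ^ α := by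
  refine ⟨8 ^ |α|, by positivity, fun x y hx h1 h2 => ?_⟩
  have hy : 0 < y := lt_of_lt_of_le (by positivity) h1
  have h3 : (y / x) ^ α ≤ 8 ^ |α| := by
    have hyx : 0 < y / x := by positivity
    rcases le_total 0 α with h | h
    · rw [abs_of_nonneg h]
      exact Real.rpow_le_rpow hyx.le (by rw [div_le_iff₀ hx]; exact h2) h
    · rw [abs_of_nonpos h, ← inv_inv (y / x), Real.inv_rpow (by positivity), ← Real.rpow_neg
        (by positivity)]
      refine Real.rpow_le_rpow (by positivity) ?_ (by linarith)
      rw [inv_div, div_le_iff₀ hy]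
      linarith
  rw [Real.div_rpow hy.le hx.le, div_le_iff₀ (by positivity)] at h3
  exact h3

/-! ### A discrete Hardy inequality -/

theorem tsum_ite_le_pow (s : ℝ≥0∞) (j : ℕ) :
    ∑' n, (if j ≤ n then s ^ n else 0) = s ^ j * (1 - s)⁻¹ := by
  rw [← Summable.sum_add_tsum_nat_add' (k := j) ENNReal.summable]
  rw [Finset.sum_eq_zero fun i hi => by
    rw [if_neg (not_le.2 (Finset.mem_range.1 hi))], zero_add]
  simp only [Nat.le_add_left, if_true, pow_add]
  rw [ENNReal.tsum_mul_right, ENNReal.tsum_geometric, mul_comm]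

/-- Half of the weight, `s ^ n` with `s = √q`, is moved inside the sum: the terms become `m ^ (n -
k) * c k` with `m ^ p = s`, and each `c k` is at most the `ℓ^p` size of `c`, so a geometric series
bounds the sum. The other half of the weight pays for exchanging the summations. No convexity is
involved, so `p < 1` is allowed. -/
theorem exists_discrete_hardy {p : ℝ} (hp : 0 < p) {q : ℝ} (hq0 : 0 < q) (hq1 : q < 1) :
    ∃ C : ℝ≥0∞, C ≠ ∞ ∧ ∀ b : ℕ → ℝ≥0∞,
      ∑' n, ENNReal.ofReal q ^ n * (∑ k ∈ Finset.range (n + 1), b k) ^ p ≤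
        C * ∑' n, ENNReal.ofReal q ^ n * b n ^ p := by
  set s : ℝ≥0∞ := ENNReal.ofReal (Real.sqrt q) with hs
  have hsq0 : 0 < Real.sqrt q := Real.sqrt_pos.2 hq0
  have hsq1 : Real.sqrt q < 1 := by
    rw [Real.sqrt_lt' one_pos]
    simpa using hq1
  have hs0 : s ≠ 0 := by simpa [hs] using hq0
  have hst : s ≠ ∞ := ENNReal.ofReal_ne_top
  have hs1 : s < 1 := by rw [hs, ENNReal.ofReal_lt_one]; exact hsq1
  have hss : ENNReal.ofReal q = s * s := by
    rw [hs, ← ENNReal.ofReal_mul hsq0.le, Real.mul_self_sqrt hq0.le]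
  set m : ℝ≥0∞ := s ^ (1 / p) with hm
  have hmp : m ^ p = s := by
    rw [hm, ← ENNReal.rpow_mul, one_div_mul_cancel hp.ne', ENNReal.rpow_one]
  have hm1 : m < 1 := ENNReal.rpow_lt_one hs1 (by positivity)
  have hm0 : m ≠ 0 := by
    intro h
    rw [h, ENNReal.zero_rpow_of_pos hp] at hmp
    exact hs0 hmp.symm
  have hmt : m ≠ ∞ := (hm1.trans ENNReal.one_lt_top).ne
  set G : ℝ≥0∞ := (1 - m)⁻¹ with hG
  have hGt : G ≠ ∞ := by
    rw [hG, Ne, ENNReal.inv_eq_top, tsub_eq_zero_iff_le, not_le]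
    exact hm1
  refine ⟨G ^ p * (1 - s)⁻¹, ?_, fun b => ?_⟩
  · refine ENNReal.mul_ne_top (ENNReal.rpow_ne_top_of_nonneg hp.le hGt) ?_
    rw [Ne, ENNReal.inv_eq_top, tsub_eq_zero_iff_le, not_le]
    exact hs1
  set c : ℕ → ℝ≥0∞ := fun k => m ^ k * b k with hc
  have hcp : ∀ k, c k ^ p = s ^ k * b k ^ p := by
    intro k
    rw [hc]
    simp only
    rw [ENNReal.mul_rpow_of_nonneg _ _ hp.le, ← ENNReal.rpow_natCast, ← ENNReal.rpow_mul,
      mul_comm (k : ℝ), ENNReal.rpow_mul, hmp, ENNReal.rpow_natCast]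
  have hsum : ∀ n, s ^ n * (∑ k ∈ Finset.range (n + 1), b k) ^ p ≤
      G ^ p * ∑ k ∈ Finset.range (n + 1), c k ^ p := by
    intro n
    set T := ∑ k ∈ Finset.range (n + 1), c k ^ p with hT
    have h1 : ∀ k ∈ Finset.range (n + 1), c k ≤ T ^ (1 / p) := by
      intro k hk
      rw [← ENNReal.rpow_le_rpow_iff hp, ← ENNReal.rpow_mul, one_div_mul_cancel hp.ne',
        ENNReal.rpow_one]
      exact Finset.single_le_sum (f := fun k => c k ^ p) (fun _ _ => zero_le) hk
    have h2 : m ^ n * ∑ k ∈ Finset.range (n + 1), b k ≤ G * T ^ (1 / p) := by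
      calc m ^ n * ∑ k ∈ Finset.range (n + 1), b k
          = ∑ k ∈ Finset.range (n + 1), m ^ (n + 1 - 1 - k) * c k := by
            rw [Finset.mul_sum]
            refine Finset.sum_congr rfl fun k hk => ?_
            have hkn : k ≤ n := Nat.lt_succ_iff.1 (Finset.mem_range.1 hk)
            rw [hc]
            simp only
            rw [← mul_assoc, ← pow_add]
            congr 2
            omega
        _ ≤ ∑ k ∈ Finset.range (n + 1), m ^ (n + 1 - 1 - k) * T ^ (1 / p) :=
            Finset.sum_le_sum fun k hk => by gcongr; exact h1 k hk
        _ = (∑ j ∈ Finset.range (n + 1), m ^ j) * T ^ (1 / p) := by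
            rw [← Finset.sum_mul, Finset.sum_range_reflect (fun j => m ^ j) (n + 1)]
        _ ≤ G * T ^ (1 / p) := by
            gcongr
            rw [hG, ← ENNReal.tsum_geometric]
            exact ENNReal.sum_le_tsum _
    have h3 := ENNReal.rpow_le_rpow h2 hp.le
    rw [ENNReal.mul_rpow_of_nonneg _ _ hp.le, ENNReal.mul_rpow_of_nonneg _ _ hp.le,
      ← ENNReal.rpow_mul, one_div_mul_cancel hp.ne', ENNReal.rpow_one, ← ENNReal.rpow_natCast,
      ← ENNReal.rpow_mul, mul_comm (n : ℝ), ENNReal.rpow_mul, hmp, ENNReal.rpow_natCast] at h3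
    exact h3
  calc ∑' n, ENNReal.ofReal q ^ n * (∑ k ∈ Finset.range (n + 1), b k) ^ p
      ≤ ∑' n, G ^ p * ∑' k, (if k ≤ n then s ^ n else 0) * c k ^ p := by
        refine ENNReal.tsum_le_tsum fun n => ?_
        have h4 : ∑' k, (if k ≤ n then s ^ n else 0) * c k ^ p
            = s ^ n * ∑ k ∈ Finset.range (n + 1), c k ^ p := by
          rw [tsum_eq_sum (s := Finset.range (n + 1)) fun k hk => by
            rw [if_neg (by simpa [Nat.lt_succ_iff] using hk), zero_mul], Finset.mul_sum]
          refine Finset.sum_congr rfl fun k hk => ?_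
          rw [if_pos (Nat.lt_succ_iff.1 (Finset.mem_range.1 hk))]
        rw [h4, hss, mul_pow, mul_assoc]
        calc s ^ n * (s ^ n * (∑ k ∈ Finset.range (n + 1), b k) ^ p)
            ≤ s ^ n * (G ^ p * ∑ k ∈ Finset.range (n + 1), c k ^ p) := by
              exact mul_le_mul_right (hsum n) _
          _ = _ := by ring
    _ = G ^ p * (1 - s)⁻¹ * ∑' n, ENNReal.ofReal q ^ n * b n ^ p := by
        rw [ENNReal.tsum_mul_left, ENNReal.tsum_comm, mul_assoc, ← ENNReal.tsum_mul_left
          (a := (1 - s)⁻¹)]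
        congr 2
        funext k
        rw [ENNReal.tsum_mul_right, tsum_ite_le_pow, hcp, hss, mul_pow]
        ring

/-! ### Polar coordinates -/

/-- The point `e^{iθ}` of the unit circle. -/
def cis (θ : ℝ) : ℂ := Complex.exp (θ * Complex.I)

theorem norm_cis (θ : ℝ) : ‖cis θ‖ = 1 := Complex.norm_exp_ofReal_mul_I θ

theorem continuous_cis : Continuous cis := by unfold cis; fun_prop

theorem cis_add (θ t : ℝ) : cis (θ + t) = cis θ * cis t := by
  unfold cis
  rw [← Complex.exp_add]
  congr 1
  push_cast
  ring

theorem periodic_cis : Function.Periodic cis (2 * Real.pi) := by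
  intro θ
  rw [cis_add]
  have : cis (2 * Real.pi) = 1 := by
    unfold cis
    push_cast
    exact Complex.exp_two_pi_mul_I
  rw [this, mul_one]

theorem norm_ofReal_mul_cis {r : ℝ} (hr : 0 ≤ r) (θ : ℝ) : ‖(r : ℂ) * cis θ‖ = r := by
  rw [norm_mul, norm_cis, mul_one, Complex.norm_real, Real.norm_of_nonneg hr]

theorem lintegral_polar (f : ℂ → ℝ≥0∞) :
    ∫⁻ z, f z = ∫⁻ x in Ioi (0 : ℝ) ×ˢ Ioo (-Real.pi) Real.pi,
      ENNReal.ofReal x.1 * f (x.1 * cis x.2) := by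
  rw [← Complex.lintegral_comp_polarCoord_symm]
  refine lintegral_congr fun x => ?_
  rw [Complex.polarCoord_symm_apply, smul_eq_mul]
  congr 3
  rw [cis, Complex.exp_mul_I, Complex.ofReal_cos, Complex.ofReal_sin]

theorem lintegral_disc_polar (f : ℂ → ℝ≥0∞) :
    ∫⁻ z in disc, f z = ∫⁻ x in Ioo (0 : ℝ) 1 ×ˢ Ioo (-Real.pi) Real.pi,
      ENNReal.ofReal x.1 * f (x.1 * cis x.2) := by
  rw [← lintegral_indicator measurableSet_disc, lintegral_polar,
    ← lintegral_indicator (measurableSet_Ioi.prod measurableSet_Ioo),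
    ← lintegral_indicator (measurableSet_Ioo.prod measurableSet_Ioo)]
  refine lintegral_congr fun x => ?_
  by_cases h1 : x ∈ Ioi (0 : ℝ) ×ˢ Ioo (-Real.pi) Real.pi
  · rw [indicator_of_mem h1]
    have hn := norm_ofReal_mul_cis (le_of_lt h1.1) x.2
    by_cases h2 : x.1 < 1
    · rw [indicator_of_mem (mem_disc.2 (by rw [hn]; exact h2)),
        indicator_of_mem (show x ∈ Ioo (0 : ℝ) 1 ×ˢ Ioo (-Real.pi) Real.pi from ⟨⟨h1.1, h2⟩, h1.2⟩)]
    · rw [indicator_of_notMem (by rw [mem_disc, hn]; exact h2), mul_zero,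
        indicator_of_notMem fun h3 => h2 h3.1.2]
  · rw [indicator_of_notMem h1, indicator_of_notMem fun h3 => h1 ⟨h3.1.1, h3.2⟩]

/-- Two intervals of one period are fundamental domains for the same translations; this form
requires no measurability of `f`. -/
theorem lintegral_cis_add (f : ℂ → ℝ≥0∞) (t : ℝ) :
    ∫⁻ θ in Ioo (-Real.pi) Real.pi, f (cis (θ + t)) = ∫⁻ θ in Ioo (-Real.pi) Real.pi, f (cis θ) := by
  have hT : (0 : ℝ) < 2 * Real.pi := by positivity
  have hper : ∀ (g : AddSubgroup.zmultiples (2 * Real.pi)) (x : ℝ), f (cis (g +ᵥ x)) = f (cis x) := by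
    intro g x
    have := periodic_cis.map_vadd_zmultiples g x
    rw [this]
  have h1 := (isAddFundamentalDomain_Ioc hT (-Real.pi)).setLIntegral_eq
    (isAddFundamentalDomain_Ioc hT (-Real.pi + t)) (fun x => f (cis x)) hper
  have e1 : -Real.pi + 2 * Real.pi = Real.pi := by ring
  have e2 : -Real.pi + t + 2 * Real.pi = Real.pi + t := by ring
  rw [e1, e2] at h1
  rw [restrict_Ioo_eq_restrict_Ioc, h1]
  have h2 := (measurePreserving_add_right volume t).setLIntegral_comp_preimage_emb
    (MeasurableEquiv.addRight t).measurableEmbedding (fun x => f (cis x))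
    (Ioc (-Real.pi + t) (Real.pi + t))
  rw [← h2]
  congr 2
  ext x
  simp

/-- The annuli on which the dyadic averages live. -/
def shell (n : ℕ) : Set ℝ := Ioo 0 1 ∩ Ioo (1 - 9 / 8 * (1 / 2) ^ n) (1 - 3 / 8 * (1 / 2) ^ n)

theorem measurableSet_shell (n : ℕ) : MeasurableSet (shell n) :=
  measurableSet_Ioo.inter measurableSet_Ioo

/-- The reverse triangle inequality localizes the modulus, and `|cis t - 1| ≥ (2 / π) * |t|` the
angle. The angle needs `ρ` away from zero: `ρ ≥ 7 / 16` if `n ≥ 1`, while for `n = 0` the angular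
claim is just `|t| ≤ π`. -/
theorem shell_of_mem_ball {n : ℕ} {ρ t : ℝ} (hρ : 0 < ρ) (ht : |t| ≤ Real.pi)
    (h : (ρ : ℂ) * cis t ∈ Metric.ball (((1 - 3 / 4 * (1 / 2) ^ n : ℝ)) : ℂ) (3 / 8 * (1 / 2) ^ n)) :
    ρ ∈ shell n ∧ |t| ≤ Real.pi * (1 / 2) ^ n := by
  set x : ℝ := (1 / 2) ^ n with hx
  have hx0 : 0 < x := by positivity
  have hx1 : x ≤ 1 := pow_le_one₀ (by norm_num) (by norm_num)
  set m : ℝ := 1 - 3 / 4 * x with hm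
  rw [mem_ball_iff_norm] at h
  have h1 : |ρ - m| < 3 / 8 * x := by
    have := abs_norm_sub_norm_le ((ρ : ℂ) * cis t) (m : ℂ)
    rw [norm_ofReal_mul_cis hρ.le, Complex.norm_real, Real.norm_of_nonneg (by linarith)] at this
    exact this.trans_lt h
  rw [abs_lt] at h1
  refine ⟨⟨⟨hρ, by linarith⟩, by constructor <;> linarith⟩, ?_⟩
  have h2 : ρ * ‖cis t - 1‖ < 3 / 4 * x := by
    have h3 : ‖(ρ : ℂ) * cis t - ρ‖ ≤ ‖(ρ : ℂ) * cis t - m‖ + ‖(m : ℂ) - ρ‖ := by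
      simpa using norm_add_le ((ρ : ℂ) * cis t - m) ((m : ℂ) - ρ)
    have h4 : ‖(m : ℂ) - ρ‖ < 3 / 8 * x := by
      rw [← Complex.ofReal_sub, Complex.norm_real, Real.norm_eq_abs, abs_lt]
      constructor <;> linarith
    have h5 : ‖(ρ : ℂ) * cis t - ρ‖ = ρ * ‖cis t - 1‖ := by
      rw [show (ρ : ℂ) * cis t - ρ = ρ * (cis t - 1) by ring, norm_mul, Complex.norm_real,
        Real.norm_of_nonneg hρ.le]
    linarith
  have h6 : 2 / Real.pi * |t| ≤ ‖cis t - 1‖ := by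
    rw [cis, mul_comm (t : ℂ), Complex.norm_exp_I_mul_ofReal_sub_one, norm_mul,
      Real.norm_eq_abs (Real.sin _)]
    have h7 : |t / 2| ≤ Real.pi / 2 := by
      rw [abs_div, abs_two]
      linarith
    have h8 := Real.mul_abs_le_abs_sin h7
    rw [abs_div, abs_two] at h8
    have : ‖(2 : ℝ)‖ = 2 := by norm_num
    rw [this]
    have h9 : 2 / Real.pi * |t| = 2 * (2 / Real.pi * (|t| / 2)) := by ring
    rw [h9]
    linarith
  rcases Nat.eq_zero_or_pos n with h0 | h0
  · rw [hx, h0, pow_zero, mul_one]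
    exact ht
  · have hx2 : x ≤ 1 / 2 := by
      rw [hx]
      calc (1 / 2 : ℝ) ^ n ≤ (1 / 2) ^ 1 := pow_le_pow_of_le_one (by norm_num) (by norm_num) h0
        _ = _ := by norm_num
    have hρ2 : 7 / 16 ≤ ρ := by linarith
    have hpi := Real.pi_pos
    have h9 : 7 / 16 * (2 / Real.pi * |t|) ≤ 3 / 4 * x := by
      have : 7 / 16 * (2 / Real.pi * |t|) ≤ ρ * ‖cis t - 1‖ :=
        mul_le_mul hρ2 h6 (by positivity) hρ.le
      linarith
    have h10 : 2 / Real.pi * |t| ≤ 2 * x := by linarith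
    rw [div_mul_eq_mul_div, div_le_iff₀ hpi] at h10
    linarith

/-- After Fubini, the integral over all rotations depends only on the modulus `ρ` of the point in
the ball, not on its angle `t`. The admissible angles fill an interval of length at most `2 * π * (1
/ 2) ^ n`. -/
theorem lintegral_ball_rotate_le {X : ℂ → ℝ≥0∞} (hX : Measurable X) (n : ℕ) :
    ∫⁻ θ in Ioo (-Real.pi) Real.pi, ∫⁻ v in Metric.ball (((1 - 3 / 4 * (1 / 2) ^ n : ℝ)) : ℂ)
        (3 / 8 * (1 / 2) ^ n), X (cis θ * v) ≤
      ENNReal.ofReal (2 * Real.pi * (1 / 2) ^ n) *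
        ∫⁻ x in shell n ×ˢ Ioo (-Real.pi) Real.pi, ENNReal.ofReal x.1 * X (x.1 * cis x.2) := by
  set B := Metric.ball (((1 - 3 / 4 * (1 / 2) ^ n : ℝ)) : ℂ) (3 / 8 * (1 / 2) ^ n) with hB
  set I := Ioo (-Real.pi) Real.pi with hI
  have hBm : MeasurableSet B := measurableSet_ball
  have hcis : Measurable cis := continuous_cis.measurable
  have hYm : Measurable fun x : ℝ × ℝ => ENNReal.ofReal x.1 * X (x.1 * cis x.2) := by
    fun_prop
  set Ψ : ℝ → ℝ≥0∞ := fun ρ => ∫⁻ θ in I, ENNReal.ofReal ρ * X (ρ * cis θ) with hΨ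
  have hΨm : Measurable Ψ := hYm.lintegral_prod_right'
  have h1 : ∀ θ, ∫⁻ v in B, X (cis θ * v) = ∫⁻ x in Ioi (0 : ℝ) ×ˢ I,
      ENNReal.ofReal x.1 * B.indicator (fun v => X (cis θ * v)) (x.1 * cis x.2) := by
    intro θ
    rw [← lintegral_indicator hBm, lintegral_polar]
  simp_rw [h1]
  have hjoint : Measurable fun y : ℝ × (ℝ × ℝ) => ENNReal.ofReal y.2.1 *
      B.indicator (fun v => X (cis y.1 * v)) (y.2.1 * cis y.2.2) := by
    have hS : MeasurableSet {y : ℝ × (ℝ × ℝ) | (y.2.1 : ℂ) * cis y.2.2 ∈ B} :=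
      (by fun_prop : Measurable fun y : ℝ × (ℝ × ℝ) => (y.2.1 : ℂ) * cis y.2.2) hBm
    have e : (fun y : ℝ × (ℝ × ℝ) => B.indicator (fun v => X (cis y.1 * v)) (y.2.1 * cis y.2.2))
        = {y : ℝ × (ℝ × ℝ) | (y.2.1 : ℂ) * cis y.2.2 ∈ B}.indicator
          (fun y => X (cis y.1 * (y.2.1 * cis y.2.2))) := by
      funext y
      simp only [indicator, mem_ofPred_eq]
    refine Measurable.mul (by fun_prop) ?_
    rw [e]
    exact Measurable.indicator (by fun_prop) hS
  rw [lintegral_lintegral_swap hjoint.aemeasurable]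
  set J := Icc (-(Real.pi * (1 / 2) ^ n)) (Real.pi * (1 / 2) ^ n) with hJ
  calc ∫⁻ x in Ioi (0 : ℝ) ×ˢ I, ∫⁻ θ in I, ENNReal.ofReal x.1 *
        B.indicator (fun v => X (cis θ * v)) (x.1 * cis x.2)
      ≤ ∫⁻ x in Ioi (0 : ℝ) ×ˢ I, (shell n).indicator Ψ x.1 * J.indicator 1 x.2 := by
        refine setLIntegral_mono' (measurableSet_Ioi.prod measurableSet_Ioo) fun x hx => ?_
        by_cases h : (x.1 : ℂ) * cis x.2 ∈ B
        · have hx2 : |x.2| ≤ Real.pi := abs_le.2 ⟨hx.2.1.le, hx.2.2.le⟩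
          obtain ⟨h3, h4⟩ := shell_of_mem_ball hx.1 hx2 h
          simp only [indicator_of_mem h]
          rw [indicator_of_mem h3, indicator_of_mem (show x.2 ∈ J from abs_le.1 h4), Pi.one_apply,
            mul_one]
          have h5 := lintegral_cis_add (fun c => ENNReal.ofReal x.1 * X (x.1 * c)) x.2
          refine le_of_eq ?_
          rw [hΨ]
          simp only
          rw [← h5]
          refine lintegral_congr fun θ => ?_
          rw [cis_add]
          congr 2
          ring
        · simp [indicator_of_notMem h]
    _ = (∫⁻ ρ in Ioi (0 : ℝ), (shell n).indicator Ψ ρ) * ∫⁻ t in I, J.indicator 1 t := by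
        rw [Measure.volume_eq_prod, ← Measure.prod_restrict]
        exact lintegral_prod_mul (hΨm.indicator (measurableSet_shell n)).aemeasurable
          (measurable_one.indicator measurableSet_Icc).aemeasurable
    _ ≤ (∫⁻ ρ in shell n, Ψ ρ) * ENNReal.ofReal (2 * Real.pi * (1 / 2) ^ n) := by
        refine mul_le_mul' ?_ ?_
        · refine (setLIntegral_le_lintegral _ _).trans ?_
          rw [lintegral_indicator (measurableSet_shell n)]
        · refine (setLIntegral_le_lintegral _ _).trans ?_
          rw [lintegral_indicator measurableSet_Icc]
          simp only [Pi.one_apply, lintegral_const, one_mul, Measure.restrict_apply_univ]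
          rw [Real.volume_Icc]
          refine ENNReal.ofReal_le_ofReal (le_of_eq (by ring))
    _ = _ := by
        rw [mul_comm]
        congr 1
        rw [Measure.volume_eq_prod, ← Measure.prod_restrict, lintegral_prod _ hYm.aemeasurable]

theorem disjoint_shell {m n : ℕ} (h : m + 2 ≤ n) : Disjoint (shell m) (shell n) := by
  rw [Set.disjoint_left]
  rintro ρ ⟨-, h1⟩ ⟨-, h2⟩
  have h3 : (1 / 2 : ℝ) ^ n ≤ (1 / 2) ^ (m + 2) := pow_le_pow_of_le_one (by norm_num) (by norm_num) h
  rw [pow_add] at h3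
  have h4 : (0 : ℝ) < (1 / 2) ^ m := by positivity
  have := h1.2
  have := h2.1
  norm_num at h3
  linarith

/-- Only neighbouring shells overlap, so the even and the odd ones each form a disjoint family. -/
theorem tsum_lintegral_shell_le (Y : ℝ × ℝ → ℝ≥0∞) (I : Set ℝ) (hI : MeasurableSet I) :
    ∑' n, ∫⁻ x in shell n ×ˢ I, Y x ≤ 2 * ∫⁻ x in Ioo (0 : ℝ) 1 ×ˢ I, Y x := by
  have key : ∀ f : ℕ → ℕ, (∀ i j, i < j → f i + 2 ≤ f j) →
      ∑' n, ∫⁻ x in shell (f n) ×ˢ I, Y x ≤ ∫⁻ x in Ioo (0 : ℝ) 1 ×ˢ I, Y x := by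
    intro f hf
    rw [← lintegral_iUnion (fun n => (measurableSet_shell _).prod hI)]
    · refine lintegral_mono_set (iUnion_subset fun n => ?_)
      exact prod_mono inter_subset_left subset_rfl
    · intro i j hij
      have : Disjoint (shell (f i)) (shell (f j)) := by
        rcases lt_or_gt_of_ne hij with h | h
        · exact disjoint_shell (hf i j h)
        · exact (disjoint_shell (hf j i h)).symm
      exact Disjoint.set_prod_left this I I
  rw [← tsum_even_add_odd ENNReal.summable ENNReal.summable, two_mul]
  exact add_le_add (key (fun n => 2 * n) fun i j h => by omega)
    (key (fun n => 2 * n + 1) fun i j h => by omega)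

/-! ### Weighted integrals of fractional integrals -/

theorem exists_lintegral_dyadic_weight_le (α : ℝ) : ∃ K : ℝ, 0 < K ∧ ∀ n : ℕ,
    ∫⁻ r in Ico (rad n) (rad (n + 1)), ENNReal.ofReal ((1 - r ^ 2) ^ α) ≤
      ENNReal.ofReal K * ENNReal.ofReal ((1 / 2) ^ (α + 1)) ^ n := by
  obtain ⟨c, hc, h⟩ := exists_rpow_le_of_comparable α
  refine ⟨c, hc, fun n => ?_⟩
  set x : ℝ := (1 / 2) ^ n with hx
  have hx0 : 0 < x := by positivity
  have hlen : rad (n + 1) - rad n ≤ x := by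
    unfold rad
    rw [pow_succ, ← hx]
    linarith
  calc ∫⁻ r in Ico (rad n) (rad (n + 1)), ENNReal.ofReal ((1 - r ^ 2) ^ α)
      ≤ ∫⁻ r in Ico (rad n) (rad (n + 1)), ENNReal.ofReal (c * x ^ α) := by
        refine setLIntegral_mono' measurableSet_Ico fun r hr => ENNReal.ofReal_le_ofReal ?_
        have h1 : 0 ≤ r := (rad_nonneg n).trans hr.1
        have h2 : r < 1 := hr.2.trans (rad_lt_one _)
        have h3 : 1 - x ≤ r := hr.1
        have h4 : r < 1 - x / 2 := by
          have := hr.2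
          unfold rad at this
          rw [pow_succ, ← hx] at this
          linarith
        exact h x _ hx0 (by nlinarith) (by nlinarith)
    _ = ENNReal.ofReal (c * x ^ α) * ENNReal.ofReal (rad (n + 1) - rad n) := by
        rw [setLIntegral_const, Real.volume_Ico]
    _ ≤ ENNReal.ofReal (c * x ^ α) * ENNReal.ofReal x := by gcongr
    _ = _ := by
        rw [← ENNReal.ofReal_mul (by positivity), ← ENNReal.ofReal_pow (by positivity),
          ← ENNReal.ofReal_mul hc.le]
        congr 1
        rw [mul_assoc, ← Real.rpow_natCast ((1 / 2 : ℝ) ^ (α + 1)), ← Real.rpow_mul (by norm_num),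
          mul_comm (α + 1), Real.rpow_mul (by norm_num), Real.rpow_natCast, ← hx,
          Real.rpow_add_one hx0.ne']

theorem measurable_indicator_disc {f : ℂ → ℂ} (hf : f ∈ Hol) (p : ℝ) :
    Measurable (disc.indicator fun v => ENNReal.ofReal (‖f v‖ ^ p)) := by
  classical
  have h1 : Measurable (disc.indicator f) := by
    have := (continuousOn_of_hol hf).measurable_piecewise (g := fun _ => 0)
      continuousOn_const measurableSet_disc
    convert this using 1
    exact (piecewise_eq_indicator (s := disc) (f := f)).symm
  have h2 : (disc.indicator fun v => ENNReal.ofReal (‖f v‖ ^ p))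
      = disc.indicator fun v => ENNReal.ofReal (‖disc.indicator f v‖ ^ p) := by
    funext v
    by_cases hv : v ∈ disc
    · simp [hv]
    · simp [hv]
  rw [h2]
  exact Measurable.indicator (by fun_prop) measurableSet_disc

/-- On the shell `1 - ρ` lies between `3 / 8` and `9 / 8` of `(1 / 2) ^ n`, so weight and tail are
comparable to constants. -/
theorem IsDoublingWeight.exists_tail_rpow_shell_le {μ : ℝ → ℝ} (hμ : IsDoublingWeight μ)
    {p : ℝ} (hp : 0 < p) (α : ℝ) :
    ∃ K : ℝ, 0 < K ∧ ∀ (n : ℕ) (ρ : ℝ), ρ ∈ shell n →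
      tail μ (rad n) ^ p * ((1 / 2 : ℝ) ^ n) ^ α ≤ K * (tail μ ρ ^ p * (1 - ρ ^ 2) ^ α) := by
  obtain ⟨c, hc, h⟩ := exists_rpow_le_of_comparable α
  obtain ⟨A, γ, hA, hup⟩ := hμ.exists_upper_pow
  set L : ℝ := A * (8 / 3) ^ γ with hL
  refine ⟨L ^ p * c, by positivity, fun n ρ hρ => ?_⟩
  obtain ⟨⟨hρ0, hρ1⟩, hρ2, hρ3⟩ := hρ
  set x : ℝ := (1 / 2) ^ n with hx
  have hx0 : 0 < x := by positivity
  have hx1 : x ≤ 1 := pow_le_one₀ (by norm_num) (by norm_num)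
  have htρ := hμ.pos hρ0.le hρ1
  have ht : tail μ (rad n) ≤ L * tail μ ρ := by
    have h1 := hup (rad n) (1 - 3 / 8 * x) (rad_nonneg n) (by unfold rad; linarith) (by linarith)
    have h2 : (1 - rad n) / (1 - (1 - 3 / 8 * x)) = 8 / 3 := by
      unfold rad
      rw [← hx, div_eq_iff (by linarith)]
      ring
    rw [h2] at h1
    refine h1.trans ?_
    gcongr
    exact hμ.antitone hρ0.le hρ3.le (by linarith)
  have hw : x ^ α ≤ c * (1 - ρ ^ 2) ^ α := by
    refine h _ _ (by nlinarith) (by nlinarith) (by nlinarith)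
  have h1 : 0 < 1 - ρ ^ 2 := by nlinarith
  calc tail μ (rad n) ^ p * x ^ α ≤ (L * tail μ ρ) ^ p * (c * (1 - ρ ^ 2) ^ α) := by
        have := (hμ.pos (rad_nonneg n) (rad_lt_one n)).le
        gcongr
    _ = _ := by
        rw [Real.mul_rpow (by positivity) htρ.le]
        ring

/-- The analytic core of sufficiency, a Littlewood–Paley type bound for all `p > 0`. On each ray the
dyadic estimate bounds `fracInt` by partial sums of `b k θ`; Hardy's inequality in the dyadic index
removes the partial sums, and integration in `θ` turns the area means into integrals over shells. -/
theorem IsDoublingWeight.exists_lintegral_fracInt_le {μ : ℝ → ℝ} (hμ : IsDoublingWeight μ)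
    {p α : ℝ} (hp : 0 < p) (hα : -1 < α) :
    ∃ C : ℝ≥0∞, C ≠ ∞ ∧ ∀ h ∈ Hol,
      ∫⁻ z in disc, ENNReal.ofReal (‖fracInt μ h z‖ ^ p * (1 - ‖z‖ ^ 2) ^ α) ≤
        C * ∫⁻ z in disc, ENNReal.ofReal ((tail μ ‖z‖ * ‖h z‖) ^ p * (1 - ‖z‖ ^ 2) ^ α) := by
  obtain ⟨C₁, hC₁, hsub⟩ := exists_subMean hp
  obtain ⟨K₁, hK₁, hdy⟩ := exists_lintegral_dyadic_weight_le α
  obtain ⟨K₂, hK₂, hsh⟩ := hμ.exists_tail_rpow_shell_le hp α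
  set q : ℝ := (1 / 2) ^ (α + 1) with hq
  have hq0 : 0 < q := by positivity
  have hq1 : q < 1 := Real.rpow_lt_one (by norm_num) (by norm_num) (by linarith)
  obtain ⟨C₂, hC₂, hhardy⟩ := exists_discrete_hardy hp hq0 hq1
  have hpi := Real.pi_pos
  -- The `64` comes from balls of radius `y / 8`, the `2 * π` from the angular window, and the final
  -- `2` from the overlap of the shells.
  refine ⟨ENNReal.ofReal K₁ * C₂ * (ENNReal.ofReal (64 * C₁ * (2 * Real.pi) * K₂)) * 2,
    by finiteness, fun h hh => ?_⟩
  set I := Ioo (-Real.pi) Real.pi with hI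
  set X : ℂ → ℝ≥0∞ := disc.indicator fun v => ENNReal.ofReal (‖h v‖ ^ p) with hX
  have hXm : Measurable X := measurable_indicator_disc hh p
  have hcis : Measurable cis := continuous_cis.measurable
  -- The ball is centred at the midpoint of `[rad k, rad (k + 1)]`; with `y = (1 / 2) ^ k`, its
  -- radius `3 / 8 * y = y / 4 + y / 8` makes it contain the ball of radius `y / 8` about every
  -- point of that interval.
  set T : ℕ → ℝ → ℝ≥0∞ := fun k θ => ∫⁻ v in Metric.ball (((1 - 3 / 4 * (1 / 2) ^ k : ℝ)) : ℂ)
        (3 / 8 * (1 / 2) ^ k), X (cis θ * v) with hT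
  have hTm : ∀ k, Measurable (T k) := fun k =>
    Measurable.lintegral_prod_right' (f := fun y : ℝ × ℂ => X (cis y.1 * y.2)) (by fun_prop)
  set S : ℕ → ℝ → ℝ≥0∞ := fun k θ =>
    (ENNReal.ofReal (64 * C₁ * 4 ^ k) * T k θ) ^ (1 / p) with hS
  have hSm : ∀ k, Measurable (S k) := fun k => ((hTm k).const_mul _).pow_const _
  set b : ℕ → ℝ → ℝ≥0∞ := fun k θ => S k θ * ENNReal.ofReal (tail μ (rad k)) with hb
  have hbm : ∀ k, Measurable (b k) := fun k => (hSm k).mul_const _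
  have hbp : ∀ k θ, b k θ ^ p = ENNReal.ofReal (64 * C₁ * 4 ^ k) * T k θ *
      ENNReal.ofReal (tail μ (rad k) ^ p) := by
    intro k θ
    rw [hb, hS]
    simp only
    rw [ENNReal.mul_rpow_of_nonneg _ _ hp.le, ← ENNReal.rpow_mul, one_div_mul_cancel hp.ne',
      ENNReal.rpow_one, ENNReal.ofReal_rpow_of_nonneg (hμ.pos (rad_nonneg k) (rad_lt_one k)).le hp.le]
  -- the dyadic suprema are dominated by area averages
  have hsup : ∀ (k : ℕ) (θ x : ℝ), rad k ≤ x → x < rad (k + 1) →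
      ENNReal.ofReal ‖h (x * cis θ)‖ ≤ S k θ := by
    intro k θ x hx1 hx2
    set y : ℝ := (1 / 2) ^ k with hy
    have hy0 : 0 < y := by positivity
    have hx1' : 1 - y ≤ x := hx1
    have hx2' : x < 1 - y / 2 := by
      unfold rad at hx2
      rw [pow_succ, ← hy] at hx2
      linarith
    have hx0 : 0 ≤ x := (rad_nonneg k).trans hx1
    have hsubset : Metric.ball (x : ℂ) (y / 8) ⊆ disc := by
      intro v hv
      rw [mem_ball_iff_norm] at hv
      have h1 : ‖v‖ ≤ ‖v - x‖ + ‖(x : ℂ)‖ := by simpa using norm_add_le (v - x) (x : ℂ)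
      rw [Complex.norm_real, Real.norm_of_nonneg hx0] at h1
      exact mem_disc.2 (by linarith)
    have hsubset2 : Metric.ball (x : ℂ) (y / 8) ⊆
        Metric.ball (((1 - 3 / 4 * y : ℝ)) : ℂ) (3 / 8 * y) := by
      intro v hv
      rw [mem_ball_iff_norm] at hv ⊢
      have h1 : ‖v - ((1 - 3 / 4 * y : ℝ) : ℂ)‖ ≤ ‖v - x‖ + ‖(x : ℂ) - ((1 - 3 / 4 * y : ℝ) : ℂ)‖ := by
        simpa using norm_add_le (v - x) ((x : ℂ) - ((1 - 3 / 4 * y : ℝ) : ℂ))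
      have h2 : ‖(x : ℂ) - ((1 - 3 / 4 * y : ℝ) : ℂ)‖ ≤ y / 4 := by
        rw [← Complex.ofReal_sub, Complex.norm_real, Real.norm_eq_abs, abs_le]
        constructor <;> linarith
      linarith
    have hrot : (fun v => h (cis θ * v)) ∈ Hol := comp_mul_hol hh (norm_cis θ).le
    have h3 := hsub (fun v => h (cis θ * v)) x (y / 8) (by positivity)
      (DifferentiableOn.mono hrot hsubset)
    have h4 : ∫⁻ w in Metric.ball (x : ℂ) (y / 8), ENNReal.ofReal (‖h (cis θ * w)‖ ^ p) ≤ T k θ := by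
      refine le_trans ?_ (lintegral_mono_set hsubset2)
      refine setLIntegral_mono' measurableSet_ball fun w hw => ?_
      rw [hX, indicator_of_mem (mul_mem_disc (norm_cis θ).le (hsubset hw))]
    have h5 : ENNReal.ofReal (‖h (x * cis θ)‖ ^ p) ≤ ENNReal.ofReal (64 * C₁ * 4 ^ k) * T k θ := by
      have e1 : ‖h (x * cis θ)‖ ^ p = (64 * 4 ^ k) * ((y / 8) ^ 2 * ‖h (cis θ * x)‖ ^ p) := by
        have e2 : (4 : ℝ) ^ k * y ^ 2 = 1 := by
          rw [hy, ← pow_mul, mul_comm k 2, pow_mul, ← mul_pow]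
          norm_num
        rw [mul_comm (x : ℂ)]
        linear_combination (-‖h (cis θ * x)‖ ^ p) * e2
      rw [e1, ENNReal.ofReal_mul (by positivity),
        show (64 : ℝ) * C₁ * 4 ^ k = 64 * 4 ^ k * C₁ by ring,
        ENNReal.ofReal_mul (q := C₁) (by positivity), mul_assoc]
      exact mul_le_mul_right (h3.trans (mul_le_mul_right h4 _)) _
    rw [hS]
    simp only
    rw [← ENNReal.rpow_le_rpow_iff hp, ← ENNReal.rpow_mul, one_div_mul_cancel hp.ne',
      ENNReal.rpow_one, ENNReal.ofReal_rpow_of_nonneg (norm_nonneg _) hp.le]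
    exact h5
  have hpt : ∀ (n : ℕ) (θ r : ℝ), rad n ≤ r → r < rad (n + 1) →
      ENNReal.ofReal (‖fracInt μ h (r * cis θ)‖ ^ p) ≤
        (∑ k ∈ Finset.range (n + 1), b k θ) ^ p := by
    intro n θ r hr1 hr2
    have hr0 : 0 ≤ r := (rad_nonneg n).trans hr1
    rw [← ENNReal.ofReal_rpow_of_nonneg (norm_nonneg _) hp.le]
    refine ENNReal.rpow_le_rpow ?_ hp.le
    refine ofReal_norm_fracInt_le_sum hμ.nonneg hμ.integrable hh (S := fun k => S k θ)
      (by rw [norm_ofReal_mul_cis hr0]; exact hr2) ?_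
    intro k _ x hx0 _ h1 h2
    rw [norm_ofReal_mul_cis hr0] at h1 h2
    have := hsup k θ (x * r) h1 h2
    rwa [Complex.ofReal_mul, mul_assoc] at this
  set a : ℕ → ℝ → ℝ≥0∞ := fun n r =>
    (Ico (rad n) (rad (n + 1))).indicator (fun r => ENNReal.ofReal ((1 - r ^ 2) ^ α)) r with ha
  have ham : ∀ n, Measurable (a n) := fun n =>
    Measurable.indicator (by fun_prop) measurableSet_Ico
  set Bs : ℕ → ℝ → ℝ≥0∞ := fun n θ => (∑ k ∈ Finset.range (n + 1), b k θ) ^ p with hBs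
  have hBsm : ∀ n, Measurable (Bs n) := fun n =>
    (Finset.measurable_sum _ fun k _ => hbm k).pow_const _
  set R := ∫⁻ z in disc, ENNReal.ofReal ((tail μ ‖z‖ * ‖h z‖) ^ p * (1 - ‖z‖ ^ 2) ^ α) with hR
  set Q : ℝ≥0∞ := ENNReal.ofReal q with hQ
  calc ∫⁻ z in disc, ENNReal.ofReal (‖fracInt μ h z‖ ^ p * (1 - ‖z‖ ^ 2) ^ α)
      ≤ ∫⁻ x in Ioo (0 : ℝ) 1 ×ˢ I, ∑' n, a n x.1 * Bs n x.2 := by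
        rw [lintegral_disc_polar]
        refine setLIntegral_mono' (measurableSet_Ioo.prod measurableSet_Ioo) fun x hx => ?_
        obtain ⟨n, h1, h2⟩ := exists_rad hx.1.1.le hx.1.2
        refine le_trans ?_ (ENNReal.le_tsum n)
        rw [ha, hBs]
        simp only
        rw [indicator_of_mem (show x.1 ∈ Ico (rad n) (rad (n + 1)) from ⟨h1, h2⟩),
          norm_ofReal_mul_cis hx.1.1.le, ENNReal.ofReal_mul (by positivity)]
        calc ENNReal.ofReal x.1 * (ENNReal.ofReal (‖fracInt μ h (x.1 * cis x.2)‖ ^ p) *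
              ENNReal.ofReal ((1 - x.1 ^ 2) ^ α))
            ≤ 1 * ((∑ k ∈ Finset.range (n + 1), b k x.2) ^ p *
              ENNReal.ofReal ((1 - x.1 ^ 2) ^ α)) := by
              refine mul_le_mul' ?_ (mul_le_mul_left (hpt n x.2 x.1 h1 h2) _)
              rw [← ENNReal.ofReal_one]
              exact ENNReal.ofReal_le_ofReal hx.1.2.le
          _ = _ := by rw [one_mul, mul_comm]
    _ = ∑' n, (∫⁻ r in Ioo (0 : ℝ) 1, a n r) * ∫⁻ θ in I, Bs n θ := by
        have hm : ∀ n, Measurable fun x : ℝ × ℝ => a n x.1 * Bs n x.2 := fun n =>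
          ((ham n).comp measurable_fst).mul ((hBsm n).comp measurable_snd)
        rw [lintegral_tsum fun n => (hm n).aemeasurable]
        congr 1
        funext n
        rw [Measure.volume_eq_prod, ← Measure.prod_restrict]
        exact lintegral_prod_mul (ham n).aemeasurable (hBsm n).aemeasurable
    _ ≤ ∑' n, (ENNReal.ofReal K₁ * Q ^ n) * ∫⁻ θ in I, Bs n θ := by
        refine ENNReal.tsum_le_tsum fun n => mul_le_mul_left ?_ _
        refine (setLIntegral_le_lintegral _ _).trans ?_
        rw [ha, lintegral_indicator measurableSet_Ico]
        exact hdy n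
    _ = ENNReal.ofReal K₁ * ∫⁻ θ in I, ∑' n, Q ^ n * Bs n θ := by
        rw [lintegral_tsum fun n => ((hBsm n).const_mul _).aemeasurable, ← ENNReal.tsum_mul_left]
        congr 1
        funext n
        rw [lintegral_const_mul _ (hBsm n), mul_assoc]
    _ ≤ ENNReal.ofReal K₁ * ∫⁻ θ in I, C₂ * ∑' n, Q ^ n * b n θ ^ p := by
        gcongr with θ
        exact hhardy fun k => b k θ
    _ = ENNReal.ofReal K₁ * C₂ * ∑' n, Q ^ n * (ENNReal.ofReal (64 * C₁ * 4 ^ n) *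
          ENNReal.ofReal (tail μ (rad n) ^ p) * ∫⁻ θ in I, T n θ) := by
        have hbpm : ∀ n, Measurable fun θ => Q ^ n * b n θ ^ p := fun n =>
          ((hbm n).pow_const _).const_mul _
        rw [lintegral_const_mul _ (Measurable.tsum hbpm),
          lintegral_tsum fun n => (hbpm n).aemeasurable, mul_assoc]
        congr 3
        funext n
        rw [lintegral_const_mul _ ((hbm n).pow_const _)]
        congr 1
        rw [← lintegral_const_mul _ (hTm n)]
        refine lintegral_congr fun θ => ?_
        rw [hbp]
        ring
    _ ≤ ENNReal.ofReal K₁ * C₂ * ∑' n, ENNReal.ofReal (64 * C₁ * (2 * Real.pi) * K₂) *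
          ∫⁻ x in shell n ×ˢ I, ENNReal.ofReal x.1 * ENNReal.ofReal
            ((tail μ ‖(x.1 : ℂ) * cis x.2‖ * ‖h (x.1 * cis x.2)‖) ^ p *
              (1 - ‖(x.1 : ℂ) * cis x.2‖ ^ 2) ^ α) := by
        refine mul_le_mul_right (ENNReal.tsum_le_tsum fun n => ?_) _
        have hYm : Measurable fun x : ℝ × ℝ => ENNReal.ofReal x.1 * X (x.1 * cis x.2) := by
          fun_prop
        set y : ℝ := (1 / 2) ^ n with hy
        have hy0 : 0 < y := by positivity
        have htn := (hμ.pos (rad_nonneg n) (rad_lt_one n)).le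
        -- The powers balance: `q ^ n * 4 ^ n * y = y ^ (α + 1) * y ^ (-2) * y = y ^ α`, the size of
        -- the Bergman weight on the shell.
        have hcoef : Q ^ n * (ENNReal.ofReal (64 * C₁ * 4 ^ n) *
            ENNReal.ofReal (tail μ (rad n) ^ p)) * ENNReal.ofReal (2 * Real.pi * y)
            = ENNReal.ofReal (64 * C₁ * (2 * Real.pi)) *
              ENNReal.ofReal (tail μ (rad n) ^ p * y ^ α) := by
          rw [hQ, ← ENNReal.ofReal_pow hq0.le, ← ENNReal.ofReal_mul (by positivity),
            ← ENNReal.ofReal_mul (by positivity), ← ENNReal.ofReal_mul (by positivity),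
            ← ENNReal.ofReal_mul (by positivity)]
          congr 1
          have e1 : q ^ n = y ^ α * y := by
            rw [hq, ← Real.rpow_natCast ((1 / 2 : ℝ) ^ (α + 1)), ← Real.rpow_mul (by norm_num),
              mul_comm (α + 1), Real.rpow_mul (by norm_num), Real.rpow_natCast, ← hy,
              Real.rpow_add_one hy0.ne']
          have e2 : (4 : ℝ) ^ n * y ^ 2 = 1 := by
            rw [hy, ← pow_mul, mul_comm n 2, pow_mul, ← mul_pow]
            norm_num
          rw [e1]
          linear_combination (y ^ α * 64 * C₁ * tail μ (rad n) ^ p * 2 * Real.pi) * e2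
        calc Q ^ n * (ENNReal.ofReal (64 * C₁ * 4 ^ n) *
              ENNReal.ofReal (tail μ (rad n) ^ p) * ∫⁻ θ in I, T n θ)
            ≤ Q ^ n * (ENNReal.ofReal (64 * C₁ * 4 ^ n) *
              ENNReal.ofReal (tail μ (rad n) ^ p) * (ENNReal.ofReal (2 * Real.pi * y) *
              ∫⁻ x in shell n ×ˢ I, ENNReal.ofReal x.1 * X (x.1 * cis x.2))) :=
              mul_le_mul_right (mul_le_mul_right (lintegral_ball_rotate_le hXm n) _) _
          _ = ENNReal.ofReal (64 * C₁ * (2 * Real.pi)) * ∫⁻ x in shell n ×ˢ I,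
              ENNReal.ofReal (tail μ (rad n) ^ p * y ^ α) *
              (ENNReal.ofReal x.1 * X (x.1 * cis x.2)) := by
              rw [lintegral_const_mul _ hYm, ← mul_assoc (ENNReal.ofReal (64 * C₁ * (2 * Real.pi))),
                ← hcoef]
              ring
          _ ≤ ENNReal.ofReal (64 * C₁ * (2 * Real.pi)) * ∫⁻ x in shell n ×ˢ I,
              ENNReal.ofReal K₂ * (ENNReal.ofReal x.1 * ENNReal.ofReal
              ((tail μ ‖(x.1 : ℂ) * cis x.2‖ * ‖h (x.1 * cis x.2)‖) ^ p *
              (1 - ‖(x.1 : ℂ) * cis x.2‖ ^ 2) ^ α)) := by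
              refine mul_le_mul_right (setLIntegral_mono'
                ((measurableSet_shell n).prod measurableSet_Ioo) fun x hx => ?_) _
              have hx0 := hx.1.1.1
              have hx1 := hx.1.1.2
              have hdisc : (x.1 : ℂ) * cis x.2 ∈ disc := by
                rw [mem_disc, norm_ofReal_mul_cis hx0.le]
                exact hx1
              have htx := (hμ.pos hx0.le hx1).le
              have h1x : 0 ≤ 1 - x.1 ^ 2 := by nlinarith
              rw [hX, indicator_of_mem hdisc, norm_ofReal_mul_cis hx0.le]
              rw [← ENNReal.ofReal_mul hx0.le, ← ENNReal.ofReal_mul (by positivity),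
                ← ENNReal.ofReal_mul hx0.le, ← ENNReal.ofReal_mul hK₂.le]
              refine ENNReal.ofReal_le_ofReal ?_
              have h6 := hsh n x.1 hx.1
              rw [Real.mul_rpow htx (norm_nonneg _)]
              have h7 : 0 ≤ x.1 * ‖h (x.1 * cis x.2)‖ ^ p := by positivity
              calc _ = (tail μ (rad n) ^ p * y ^ α) * (x.1 * ‖h (x.1 * cis x.2)‖ ^ p) := by ring
                _ ≤ K₂ * (tail μ x.1 ^ p * (1 - x.1 ^ 2) ^ α) *
                    (x.1 * ‖h (x.1 * cis x.2)‖ ^ p) := by gcongr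
                _ = _ := by ring
          _ = _ := by
              rw [lintegral_const_mul' _ _ ENNReal.ofReal_ne_top, ← mul_assoc,
                ← ENNReal.ofReal_mul (by positivity)]
    _ ≤ ENNReal.ofReal K₁ * C₂ * (ENNReal.ofReal (64 * C₁ * (2 * Real.pi) * K₂) * (2 * R)) := by
        rw [ENNReal.tsum_mul_left, hR, lintegral_disc_polar]
        gcongr
        exact tsum_lintegral_shell_le _ I measurableSet_Ioo
    _ = _ := by ring

/-! ### The Bergman norm: growth and the upper estimate -/

/-- The unnormalized Bergman integral `∫_𝔻 |f|^p (1-|z|²)^α`. -/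
def bergmanInt (p α : ℝ) (f : ℂ → ℂ) : ℝ≥0∞ :=
  ∫⁻ z in disc, ENNReal.ofReal (‖f z‖ ^ p * (1 - ‖z‖ ^ 2) ^ α)

theorem aemeasurable_bergmanInt {f : ℂ → ℂ} (hf : f ∈ Hol) (p α : ℝ) :
    AEMeasurable (fun z => ENNReal.ofReal (‖f z‖ ^ p * (1 - ‖z‖ ^ 2) ^ α))
      (volume.restrict disc) := by
  have hgm := measurable_indicator_disc hf p
  have : Measurable fun z : ℂ => disc.indicator (fun z => ENNReal.ofReal (‖f z‖ ^ p)) z *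
    ENNReal.ofReal ((1 - ‖z‖ ^ 2) ^ α) := by fun_prop
  refine this.aemeasurable.congr ?_
  filter_upwards [ae_restrict_mem measurableSet_disc] with z hz
  rw [indicator_of_mem hz, ENNReal.ofReal_mul (by positivity)]

theorem one_sub_sq_pos {z : ℂ} (hz : z ∈ disc) : 0 < 1 - ‖z‖ ^ 2 := by
  have := mem_disc.1 hz
  nlinarith [norm_nonneg z]

theorem bergmanNorm_rpow {p α : ℝ} (hp : 0 < p) (hα : -1 < α) (f : ℂ → ℂ) :
    bergmanNorm p α f ^ p = ENNReal.ofReal ((α + 1) / Real.pi) * bergmanInt p α f := by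
  have hpi := Real.pi_pos
  have hα' : 0 ≤ α + 1 := by linarith
  unfold bergmanNorm bergmanInt dA
  rw [← ENNReal.rpow_mul, one_div_mul_cancel hp.ne', ENNReal.rpow_one, lintegral_smul_measure,
    smul_eq_mul, div_eq_inv_mul, ENNReal.ofReal_mul (by positivity), mul_assoc,
    ← lintegral_const_mul' (ENNReal.ofReal (α + 1)) _ ENNReal.ofReal_ne_top]
  congr 1
  refine lintegral_congr fun z => ?_
  rw [← ENNReal.ofReal_mul hα']
  congr 1
  ring

theorem bergmanConst_ne_zero {α : ℝ} (hα : -1 < α) :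
    ENNReal.ofReal ((α + 1) / Real.pi) ≠ 0 := by
  have hpi := Real.pi_pos
  have : 0 < α + 1 := by linarith
  simpa using (by positivity : 0 < (α + 1) / Real.pi)

theorem bergmanNorm_le_mul_of_int_le {p α : ℝ} (hp : 0 < p) (hα : -1 < α) {f g : ℂ → ℂ}
    {C : ℝ≥0∞} (h : bergmanInt p α f ≤ C ^ p * bergmanInt p α g) :
    bergmanNorm p α f ≤ C * bergmanNorm p α g := by
  rw [← ENNReal.rpow_le_rpow_iff hp, ENNReal.mul_rpow_of_nonneg _ _ hp.le,
    bergmanNorm_rpow hp hα, bergmanNorm_rpow hp hα, mul_left_comm]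
  exact mul_le_mul_right h _

theorem bergmanInt_congr {p α : ℝ} {f g : ℂ → ℂ} (h : ∀ z ∈ disc, f z = g z) :
    bergmanInt p α f = bergmanInt p α g :=
  setLIntegral_congr_fun measurableSet_disc fun z hz => by rw [h z hz]

theorem bergmanNorm_congr {p α : ℝ} (hp : 0 < p) (hα : -1 < α) {f g : ℂ → ℂ}
    (h : ∀ z ∈ disc, f z = g z) : bergmanNorm p α f = bergmanNorm p α g := by
  refine ENNReal.rpow_left_injective hp.ne' ?_
  simp only [bergmanNorm_rpow hp hα, bergmanInt_congr h]

/-- The sub-mean value estimate on the disc of radius `R = (1 - ‖z‖) / 2`, where the weight is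
comparable to `R ^ α`; together with the area factor `R ^ 2` this gives the exponent `(2 + α) / p`.
-/
theorem exists_norm_le_of_bergmanNorm_le {p α : ℝ} (hp : 0 < p) (hα : -1 < α) :
    ∃ C : ℝ, 0 < C ∧ ∀ (N : ℝ) (F : ℂ → ℂ), 0 ≤ N → F ∈ Hol →
      bergmanNorm p α F ≤ ENNReal.ofReal N → ∀ z ∈ disc,
      ‖F z‖ * (1 - ‖z‖) ^ ((2 + α) / p) ≤ C * N := by
  obtain ⟨C₁, hC₁, hsub⟩ := exists_subMean hp
  obtain ⟨c, hc, hcomp⟩ := exists_rpow_le_of_comparable α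
  have hpi := Real.pi_pos
  have hα' : 0 < α + 1 := by linarith
  set s : ℝ := (2 + α) / p with hs
  have hs0 : 0 < s := div_pos (by linarith) hp
  set k : ℝ := (α + 1) / Real.pi with hk
  have hk0 : 0 < k := by positivity
  refine ⟨2 ^ s * (C₁ * c / k) ^ (1 / p), by positivity, fun N F hN hF hFN z hz => ?_⟩
  have hz1 := mem_disc.1 hz
  set R : ℝ := (1 - ‖z‖) / 2 with hR
  have hR0 : 0 < R := by rw [hR]; linarith
  have hball : Metric.ball z R ⊆ disc := by
    intro w hw
    rw [mem_ball_iff_norm] at hw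
    have h1 : ‖w‖ ≤ ‖w - z‖ + ‖z‖ := by simpa using norm_add_le (w - z) z
    exact mem_disc.2 (by rw [hR] at hw; linarith)
  have h1 : ENNReal.ofReal ((‖F z‖ * R ^ s) ^ p) ≤
      ENNReal.ofReal (C₁ * c) * bergmanInt p α F := by
    have e : (‖F z‖ * R ^ s) ^ p = R ^ α * (R ^ 2 * ‖F z‖ ^ p) := by
      rw [Real.mul_rpow (norm_nonneg _) (by positivity), ← Real.rpow_mul hR0.le, hs,
        div_mul_cancel₀ _ hp.ne', Real.rpow_add hR0, Real.rpow_ofNat]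
      ring
    rw [e, ENNReal.ofReal_mul (by positivity)]
    calc ENNReal.ofReal (R ^ α) * ENNReal.ofReal (R ^ 2 * ‖F z‖ ^ p)
        ≤ ENNReal.ofReal (R ^ α) * (ENNReal.ofReal C₁ *
            ∫⁻ w in Metric.ball z R, ENNReal.ofReal (‖F w‖ ^ p)) :=
          mul_le_mul_right (hsub F z R hR0 (DifferentiableOn.mono hF hball)) _
      _ = ENNReal.ofReal C₁ * ∫⁻ w in Metric.ball z R,
            ENNReal.ofReal (R ^ α) * ENNReal.ofReal (‖F w‖ ^ p) := by
          rw [lintegral_const_mul' _ _ ENNReal.ofReal_ne_top, mul_left_comm]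
      _ ≤ ENNReal.ofReal C₁ * ∫⁻ w in Metric.ball z R,
            ENNReal.ofReal c * ENNReal.ofReal (‖F w‖ ^ p * (1 - ‖w‖ ^ 2) ^ α) := by
          refine mul_le_mul_right (setLIntegral_mono' measurableSet_ball fun w hw => ?_) _
          have hwd := mem_disc.1 (hball hw)
          have hpos := one_sub_sq_pos (hball hw)
          rw [← ENNReal.ofReal_mul (by positivity), ← ENNReal.ofReal_mul hc.le]
          refine ENNReal.ofReal_le_ofReal ?_
          rw [mem_ball_iff_norm] at hw
          have h1 : ‖w‖ ≤ ‖w - z‖ + ‖z‖ := by simpa using norm_add_le (w - z) z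
          have h2 : ‖z‖ ≤ ‖w - z‖ + ‖w‖ := by
            have := norm_sub_le w (w - z)
            rw [sub_sub_cancel] at this
            linarith
          have h3 := norm_nonneg w
          have h4 := hcomp (1 - ‖w‖ ^ 2) R hpos (by nlinarith) (by nlinarith)
          calc R ^ α * ‖F w‖ ^ p ≤ c * (1 - ‖w‖ ^ 2) ^ α * ‖F w‖ ^ p := by gcongr
            _ = _ := by ring
      _ = ENNReal.ofReal (C₁ * c) * ∫⁻ w in Metric.ball z R,
            ENNReal.ofReal (‖F w‖ ^ p * (1 - ‖w‖ ^ 2) ^ α) := by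
          rw [lintegral_const_mul' _ _ ENNReal.ofReal_ne_top, ENNReal.ofReal_mul hC₁.le, mul_assoc]
      _ ≤ _ := mul_le_mul_right (lintegral_mono_set hball) _
  have h2 : ENNReal.ofReal k * bergmanInt p α F ≤ ENNReal.ofReal (N ^ p) := by
    rw [← bergmanNorm_rpow hp hα, ← ENNReal.ofReal_rpow_of_nonneg hN hp.le]
    exact ENNReal.rpow_le_rpow hFN hp.le
  have h3 : ENNReal.ofReal ((‖F z‖ * R ^ s) ^ p) ≤ ENNReal.ofReal (C₁ * c / k * N ^ p) := by
    refine h1.trans ?_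
    have e : ENNReal.ofReal (C₁ * c) = ENNReal.ofReal (C₁ * c / k) * ENNReal.ofReal k := by
      rw [← ENNReal.ofReal_mul (by positivity), div_mul_cancel₀ _ hk0.ne']
    rw [e, ENNReal.ofReal_mul (by positivity), mul_assoc]
    exact mul_le_mul_right h2 _
  rw [ENNReal.ofReal_le_ofReal_iff (by positivity)] at h3
  have h4 : ‖F z‖ * R ^ s ≤ (C₁ * c / k) ^ (1 / p) * N := by
    rw [← Real.rpow_le_rpow_iff (by positivity) (by positivity) hp,
      Real.mul_rpow (by positivity) hN, ← Real.rpow_mul (by positivity),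
      one_div_mul_cancel hp.ne', Real.rpow_one]
    exact h3
  have h5 : (1 - ‖z‖) ^ s = 2 ^ s * R ^ s := by
    rw [← Real.mul_rpow (by norm_num) hR0.le]
    congr 1
    rw [hR]
    ring
  rw [h5]
  calc _ = 2 ^ s * (‖F z‖ * R ^ s) := by ring
    _ ≤ 2 ^ s * ((C₁ * c / k) ^ (1 / p) * N) := by gcongr
    _ = _ := by ring

/-- The pointwise growth of `F` on the disc of radius `(1 + ‖z‖) / 2` is inserted into the Cauchy
estimate for `D^μ`; halving the distance to the circle costs `2 ^ s`. -/
theorem IsDoublingWeight.exists_fracDeriv_le_of_bergmanNorm_le {μ : ℝ → ℝ} (hμ : IsDoublingWeight μ)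
    {p α : ℝ} (hp : 0 < p)
    (hα : -1 < α) : ∃ C : ℝ, 0 < C ∧ ∀ (N : ℝ) (F : ℂ → ℂ), 0 ≤ N → F ∈ Hol →
      bergmanNorm p α F ≤ ENNReal.ofReal N → ∀ z ∈ disc,
      tail μ ‖z‖ * ‖fracDeriv μ F z‖ * (1 - ‖z‖) ^ ((2 + α) / p) ≤ C * N := by
  obtain ⟨C₁, hC₁, h₁⟩ := exists_norm_le_of_bergmanNorm_le hp hα
  obtain ⟨C₂, hC₂, h₂⟩ := hμ.exists_norm_fracDeriv_le
  set s : ℝ := (2 + α) / p with hs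
  have hs0 : 0 < s := div_pos (by linarith) hp
  refine ⟨C₂ * C₁ * 2 ^ s, by positivity, fun N F hN hF hFN z hz => ?_⟩
  have hz1 := mem_disc.1 hz
  have ht := hμ.pos (norm_nonneg z) hz1
  have hd : 0 < 1 - ‖z‖ := by linarith
  have h3 := h₂ (C₁ * N * 2 ^ s / (1 - ‖z‖) ^ s) F z hF hz fun w hw => by
    have hw1 : ‖w‖ < 1 := by linarith
    have h4 := h₁ N F hN hF hFN w (mem_disc.2 hw1)
    rw [le_div_iff₀ (by positivity)]
    have h5 : (1 - ‖z‖) ^ s ≤ (2 * (1 - ‖w‖)) ^ s :=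
      Real.rpow_le_rpow hd.le (by linarith) hs0.le
    rw [Real.mul_rpow (by norm_num) (by linarith)] at h5
    calc ‖F w‖ * (1 - ‖z‖) ^ s ≤ ‖F w‖ * (2 ^ s * (1 - ‖w‖) ^ s) := by gcongr
      _ = (‖F w‖ * (1 - ‖w‖) ^ s) * 2 ^ s := by ring
      _ ≤ C₁ * N * 2 ^ s := by gcongr
  rw [le_div_iff₀ ht] at h3
  calc _ = (‖fracDeriv μ F z‖ * tail μ ‖z‖) * (1 - ‖z‖) ^ s := by ring
    _ ≤ C₂ * (C₁ * N * 2 ^ s / (1 - ‖z‖) ^ s) * (1 - ‖z‖) ^ s := by gcongr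
    _ = _ := by field_simp

theorem IsDoublingWeight.exists_bergmanInt_volterra_le {μ : ℝ → ℝ} (hμ : IsDoublingWeight μ)
    {p α : ℝ} (hp : 0 < p)
    (hα : -1 < α) : ∃ C : ℝ≥0∞, C ≠ ∞ ∧ ∀ g ∈ Hol, ∀ f ∈ Hol,
      bergmanInt p α (volterra μ g f) ≤ C * ∫⁻ z in disc,
        ENNReal.ofReal ((tail μ ‖z‖ * ‖fracDeriv μ g z‖) ^ p) *
          ENNReal.ofReal (‖f z‖ ^ p * (1 - ‖z‖ ^ 2) ^ α) := by
  obtain ⟨C, hC, h⟩ := hμ.exists_lintegral_fracInt_le hp hα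
  refine ⟨C, hC, fun g hg f hf => ?_⟩
  refine (h _ (mul_hol hf (hμ.fracDeriv_hol hg))).trans (mul_le_mul_right ?_ _)
  refine setLIntegral_mono' measurableSet_disc fun z hz => le_of_eq ?_
  have ht := (hμ.pos (norm_nonneg z) (mem_disc.1 hz)).le
  rw [← ENNReal.ofReal_mul (by positivity)]
  simp only [norm_mul]
  rw [show tail μ ‖z‖ * (‖f z‖ * ‖fracDeriv μ g z‖) = tail μ ‖z‖ * ‖fracDeriv μ g z‖ * ‖f z‖ by
    ring, Real.mul_rpow (by positivity) (norm_nonneg _), mul_assoc]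

theorem IsDoublingWeight.exists_bergmanNorm_volterra_le {μ : ℝ → ℝ} (hμ : IsDoublingWeight μ)
    {p α : ℝ} (hp : 0 < p)
    (hα : -1 < α) : ∃ C : ℝ≥0, ∀ g ∈ Hol, ∀ f ∈ Hol,
      bergmanNorm p α (volterra μ g f) ≤ C * fracBlochNorm μ g * bergmanNorm p α f := by
  obtain ⟨C, hC, h⟩ := hμ.exists_bergmanInt_volterra_le hp hα
  lift C to ℝ≥0 using hC
  refine ⟨C ^ (1 / p), fun g hg f hf => ?_⟩
  refine bergmanNorm_le_mul_of_int_le hp hα ((h g hg f hf).trans ?_)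
  have e : (((C ^ (1 / p) : ℝ≥0) : ℝ≥0∞) * fracBlochNorm μ g) ^ p
      = C * fracBlochNorm μ g ^ p := by
    rw [ENNReal.mul_rpow_of_nonneg _ _ hp.le, ENNReal.coe_rpow_of_nonneg _ hp.le |>.symm,
      ← NNReal.rpow_mul, one_div_mul_cancel hp.ne', NNReal.rpow_one]
  rw [e, mul_assoc]
  refine mul_le_mul_right ?_ _
  unfold bergmanInt
  rw [← lintegral_const_mul'' _ (aemeasurable_bergmanInt hf p α)]
  refine setLIntegral_mono' measurableSet_disc fun z hz => mul_le_mul_left ?_ _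
  rw [← ENNReal.ofReal_rpow_of_nonneg (mul_nonneg (hμ.pos (norm_nonneg z) (mem_disc.1 hz)).le
    (norm_nonneg _)) hp.le]
  refine ENNReal.rpow_le_rpow ?_ hp.le
  exact le_iSup₂ (f := fun z (_ : z ∈ disc) => ENNReal.ofReal (tail μ ‖z‖ * ‖fracDeriv μ g z‖)) z hz

/-! ### Test functions -/

/-- With `x = 1 - r` and `d = 1 - b`, the kernel is at most `d ^ (-κ)` and at most `x ^ (-κ)`. The
first bound is used for `x ≤ d`, integrable because `α > -1`, the second for `x > d`, integrable at
infinity because `κ > α + 1`. -/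
theorem exists_lintegral_radial_le {α κ : ℝ} (hα : -1 < α) (hκ : α + 1 < κ) :
    ∃ C : ℝ, 0 < C ∧ ∀ b : ℝ, 0 ≤ b → b < 1 →
      ∫⁻ r in Ioo (0 : ℝ) 1, ENNReal.ofReal ((1 - b * r) ^ (-κ) * (1 - r ^ 2) ^ α) ≤
        ENNReal.ofReal (C * (1 - b) ^ (α + 1 - κ)) := by
  obtain ⟨c, hc, hcomp⟩ := exists_rpow_le_of_comparable α
  have hα' : 0 < α + 1 := by linarith
  have hκ' : 0 < κ - α - 1 := by linarith
  refine ⟨c * (1 / (α + 1) + 1 / (κ - α - 1)), by positivity, fun b hb0 hb1 => ?_⟩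
  set d : ℝ := 1 - b with hd
  have hd0 : 0 < d := by rw [hd]; linarith
  set φ : ℝ → ℝ≥0∞ := fun x => (Ioc 0 d).indicator (fun x => ENNReal.ofReal (c * d ^ (-κ) * x ^ α)) x +
    (Ioi d).indicator (fun x => ENNReal.ofReal (c * x ^ (α - κ))) x with hφ
  have hle : ∀ r ∈ Ioo (0 : ℝ) 1, ENNReal.ofReal ((1 - b * r) ^ (-κ) * (1 - r ^ 2) ^ α) ≤
      φ (1 - r) := by
    intro r hr
    have hx0 : 0 < 1 - r := by linarith [hr.2]
    have h1 : (1 - r ^ 2) ^ α ≤ c * (1 - r) ^ α :=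
      hcomp _ _ hx0 (by nlinarith [hr.1]) (by nlinarith [hr.1])
    have h2 : d ≤ 1 - b * r := by rw [hd]; nlinarith [hr.2]
    have h3 : 1 - r ≤ 1 - b * r := by nlinarith [hr.1]
    have h4 : 0 ≤ (1 - r ^ 2) ^ α := Real.rpow_nonneg (by nlinarith [hr.1, hr.2]) _
    rw [hφ]
    beta_reduce
    rcases le_or_gt (1 - r) d with hrd | hrd
    · rw [indicator_of_mem (show 1 - r ∈ Ioc 0 d from ⟨hx0, hrd⟩)]
      refine (ENNReal.ofReal_le_ofReal ?_).trans le_self_add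
      have h5 : (1 - b * r) ^ (-κ) ≤ d ^ (-κ) :=
        Real.rpow_le_rpow_of_nonpos hd0 h2 (by linarith)
      calc _ ≤ d ^ (-κ) * (c * (1 - r) ^ α) := by gcongr
        _ = _ := by ring
    · rw [indicator_of_mem (show 1 - r ∈ Ioi d from hrd)]
      refine (ENNReal.ofReal_le_ofReal ?_).trans le_add_self
      have h5 : (1 - b * r) ^ (-κ) ≤ (1 - r) ^ (-κ) :=
        Real.rpow_le_rpow_of_nonpos hx0 h3 (by linarith)
      calc _ ≤ (1 - r) ^ (-κ) * (c * (1 - r) ^ α) := by gcongr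
        _ = _ := by rw [sub_eq_add_neg α, Real.rpow_add hx0]; ring
  have hi1 : ∫⁻ x in Ioc 0 d, ENNReal.ofReal (c * d ^ (-κ) * x ^ α) =
      ENNReal.ofReal (c * d ^ (-κ) * (d ^ (α + 1) / (α + 1))) := by
    have hintg : IntegrableOn (fun x : ℝ => x ^ α) (Ioc 0 d) :=
      (intervalIntegrable_iff_integrableOn_Ioc_of_le hd0.le).1
        (intervalIntegral.intervalIntegrable_rpow' hα)
    rw [← ofReal_integral_eq_lintegral_ofReal (hintg.const_mul _), integral_const_mul,
      ← intervalIntegral.integral_of_le hd0.le, integral_rpow (Or.inl hα),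
      Real.zero_rpow hα'.ne', sub_zero]
    filter_upwards [ae_restrict_mem measurableSet_Ioc] with x hx
    have := hx.1
    simp only [Pi.zero_apply]
    positivity
  have hi2 : ∫⁻ x in Ioi d, ENNReal.ofReal (c * x ^ (α - κ)) =
      ENNReal.ofReal (c * (d ^ (α - κ + 1) / (κ - α - 1))) := by
    have hlt : α - κ < -1 := by linarith
    rw [← ofReal_integral_eq_lintegral_ofReal ((integrableOn_Ioi_rpow_of_lt hlt hd0).const_mul _),
      integral_const_mul, integral_Ioi_rpow_of_lt hlt hd0]
    · congr 2
      rw [neg_div, ← div_neg]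
      congr 1
      ring
    filter_upwards [ae_restrict_mem measurableSet_Ioi] with x hx
    have : 0 < x := hd0.trans hx
    simp only [Pi.zero_apply]
    positivity
  calc _ ≤ ∫⁻ r in Ioo (0 : ℝ) 1, φ (1 - r) := setLIntegral_mono' measurableSet_Ioo hle
    _ ≤ ∫⁻ r, φ (1 - r) := setLIntegral_le_lintegral _ _
    _ = ∫⁻ r, φ r := lintegral_sub_left_eq_self φ 1
    _ = (∫⁻ x in Ioc 0 d, ENNReal.ofReal (c * d ^ (-κ) * x ^ α)) +
          ∫⁻ x in Ioi d, ENNReal.ofReal (c * x ^ (α - κ)) := by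
        rw [hφ, lintegral_add_left (Measurable.indicator (by fun_prop) measurableSet_Ioc),
          lintegral_indicator measurableSet_Ioc, lintegral_indicator measurableSet_Ioi]
    _ = _ := by
        rw [hi1, hi2, ← ENNReal.ofReal_add (by positivity) (by positivity)]
        congr 1
        have e1 : d ^ (-κ) * d ^ (α + 1) = d ^ (α + 1 - κ) := by
          rw [← Real.rpow_add hd0]
          congr 1
          ring
        have e2 : α - κ + 1 = α + 1 - κ := by ring
        rw [e2, ← e1]
        field_simp

theorem one_sub_ne_zero_of_norm_lt {x : ℂ} (hx : ‖x‖ < 1) : 1 - x ≠ 0 := by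
  intro h
  rw [sub_eq_zero] at h
  rw [← h] at hx
  simp at hx

/-- Parseval for the geometric series of `1 / (1 - w e^{iθ})`. -/
theorem lintegral_circle_inv_sq_le {w : ℂ} (hw : ‖w‖ < 1) :
    ∫⁻ θ in Ioo (-Real.pi) Real.pi, ENNReal.ofReal ((‖1 - w * cis θ‖ ^ 2)⁻¹) ≤
      ENNReal.ofReal (2 * Real.pi * (1 - ‖w‖)⁻¹) := by
  have hpi := Real.pi_pos
  set v : ℂ := (starRingEnd ℂ) w with hv
  have hvn : ‖v‖ = ‖w‖ := by rw [hv, RCLike.norm_conj]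
  have hb : Summable fun n : ℕ => ‖v ^ n‖ := by
    simp only [norm_pow, hvn]
    exact summable_geometric_of_lt_one (norm_nonneg w) hw
  have h1 := integral_normSq_tsum hb
  have e : ∀ t : ℝ, ‖∑' n : ℕ, v ^ n * Complex.exp (-(n * t * Complex.I))‖ ^ 2
      = (‖1 - w * cis t‖ ^ 2)⁻¹ := by
    intro t
    have hx : ‖v * (starRingEnd ℂ) (cis t)‖ < 1 := by
      rw [norm_mul, hvn, RCLike.norm_conj, norm_cis, mul_one]
      exact hw
    have h2 : ∀ n : ℕ, v ^ n * Complex.exp (-(n * t * Complex.I))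
        = (v * (starRingEnd ℂ) (cis t)) ^ n := by
      intro n
      rw [mul_pow, cis, ← Complex.exp_conj, ← Complex.exp_nat_mul]
      congr 2
      simp
      ring
    simp_rw [h2]
    rw [tsum_geometric_of_norm_lt_one hx, norm_inv, inv_pow]
    congr 2
    rw [← RCLike.norm_conj (1 - w * cis t)]
    simp [hv]
  simp_rw [e] at h1
  have hcont : Continuous fun t : ℝ => (‖1 - w * cis t‖ ^ 2)⁻¹ := by
    have := continuous_cis
    refine Continuous.inv₀ (by fun_prop) fun t => ?_
    have : 1 - w * cis t ≠ 0 := one_sub_ne_zero_of_norm_lt (by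
      rw [norm_mul, norm_cis, mul_one]; exact hw)
    positivity
  have hper : Function.Periodic (fun t : ℝ => (‖1 - w * cis t‖ ^ 2)⁻¹) (2 * Real.pi) := by
    intro t
    simp only [periodic_cis t]
  have h3 := hper.intervalIntegral_add_eq (-Real.pi) 0
  rw [zero_add, h1, show -Real.pi + 2 * Real.pi = Real.pi by ring,
    intervalIntegral.integral_of_le (by linarith), integral_Ioc_eq_integral_Ioo] at h3
  rw [← ofReal_integral_eq_lintegral_ofReal, h3]
  · refine ENNReal.ofReal_le_ofReal ?_
    gcongr
    rw [← tsum_geometric_of_lt_one (norm_nonneg w) hw]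
    have hle : ∀ n : ℕ, ‖v ^ n‖ ^ 2 ≤ ‖w‖ ^ n := by
      intro n
      rw [norm_pow, hvn, ← pow_mul]
      exact pow_le_pow_of_le_one (norm_nonneg w) hw.le (by omega)
    have hg := summable_geometric_of_lt_one (norm_nonneg w) hw
    exact (Summable.of_nonneg_of_le (fun n => by positivity) hle hg).tsum_le_tsum hle hg
  · exact (hcont.integrableOn_Icc (a := -Real.pi) (b := Real.pi)).mono_set Ioo_subset_Icc_self
  · exact Eventually.of_forall fun t => by positivity

/-- The surplus power `m - 2 ≥ 0` is estimated by `‖1 - āz‖ ≥ 1 - ‖a‖ * ‖z‖`; the remaining square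
is integrated over circles by Parseval, which leaves the radial integral with exponent `m - 1`. -/
theorem exists_lintegral_kernel_le {α m : ℝ} (hα : -1 < α) (hm : α + 2 < m) (hm2 : 2 ≤ m) :
    ∃ C : ℝ, 0 < C ∧ ∀ a ∈ disc,
      ∫⁻ z in disc, ENNReal.ofReal (‖1 - (starRingEnd ℂ) a * z‖ ^ (-m) * (1 - ‖z‖ ^ 2) ^ α) ≤
        ENNReal.ofReal (C * (1 - ‖a‖) ^ (α + 2 - m)) := by
  have hpi := Real.pi_pos
  obtain ⟨C, hC, hrad⟩ := exists_lintegral_radial_le (κ := m - 1) hα (by linarith)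
  refine ⟨2 * Real.pi * C, by positivity, fun a ha => ?_⟩
  have ha1 := mem_disc.1 ha
  set I := Ioo (-Real.pi) Real.pi with hI
  have hcis : Measurable cis := continuous_cis.measurable
  set b : ℂ := (starRingEnd ℂ) a with hb
  have hbn : ‖b‖ = ‖a‖ := by rw [hb, RCLike.norm_conj]
  set ψ : ℝ × ℝ → ℝ≥0∞ := fun x => ENNReal.ofReal ((1 - ‖a‖ * x.1) ^ (2 - m) * (1 - x.1 ^ 2) ^ α) *
    ENNReal.ofReal ((‖1 - (b * x.1) * cis x.2‖ ^ 2)⁻¹) with hψ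
  have hψm : Measurable ψ := by rw [hψ]; fun_prop
  rw [lintegral_disc_polar]
  calc _ ≤ ∫⁻ x in Ioo (0 : ℝ) 1 ×ˢ I, ψ x := by
        refine setLIntegral_mono' (measurableSet_Ioo.prod measurableSet_Ioo) fun x hx => ?_
        have hx0 : 0 < x.1 := hx.1.1
        have hx1 : x.1 < 1 := hx.1.2
        rw [hψ, norm_ofReal_mul_cis hx0.le]
        simp only
        have hab : 0 < 1 - ‖a‖ * x.1 := by nlinarith [norm_nonneg a]
        have hw : 0 ≤ (1 - x.1 ^ 2) ^ α := Real.rpow_nonneg (by nlinarith) _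
        have hlow : 1 - ‖a‖ * x.1 ≤ ‖1 - b * x.1 * cis x.2‖ := by
          have h1 := norm_sub_norm_le (1 : ℂ) (b * x.1 * cis x.2)
          rw [norm_one, mul_assoc, norm_mul, norm_ofReal_mul_cis hx0.le, hbn, ← mul_assoc] at h1
          exact h1
        rw [← mul_assoc] at *
        set t := ‖1 - b * x.1 * cis x.2‖ with ht
        have ht0 : 0 < t := hab.trans_le hlow
        rw [← ENNReal.ofReal_mul hx0.le, ← ENNReal.ofReal_mul (by positivity)]
        refine ENNReal.ofReal_le_ofReal ?_
        have e1 : t ^ (-m) = t ^ (2 - m) * (t ^ 2)⁻¹ := by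
          rw [← Real.rpow_ofNat, ← Real.rpow_neg ht0.le, ← Real.rpow_add ht0]
          congr 1
          ring
        have e2 : t ^ (2 - m) ≤ (1 - ‖a‖ * x.1) ^ (2 - m) :=
          Real.rpow_le_rpow_of_nonpos hab hlow (by linarith)
        calc x.1 * (t ^ (-m) * (1 - x.1 ^ 2) ^ α) ≤ 1 * (t ^ (-m) * (1 - x.1 ^ 2) ^ α) := by gcongr
          _ = t ^ (2 - m) * ((1 - x.1 ^ 2) ^ α * (t ^ 2)⁻¹) := by rw [e1]; ring
          _ ≤ (1 - ‖a‖ * x.1) ^ (2 - m) * ((1 - x.1 ^ 2) ^ α * (t ^ 2)⁻¹) := by gcongr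
          _ = _ := by ring
    _ = ∫⁻ r in Ioo (0 : ℝ) 1, ∫⁻ θ in I, ψ (r, θ) := by
        rw [Measure.volume_eq_prod, setLIntegral_prod _ hψm.aemeasurable]
    _ ≤ ∫⁻ r in Ioo (0 : ℝ) 1, ENNReal.ofReal (2 * Real.pi) *
          ENNReal.ofReal ((1 - ‖a‖ * r) ^ (-(m - 1)) * (1 - r ^ 2) ^ α) := by
        refine setLIntegral_mono' measurableSet_Ioo fun r hr => ?_
        have hab : 0 < 1 - ‖a‖ * r := by nlinarith [norm_nonneg a, hr.1, hr.2]
        have hw : 0 ≤ (1 - r ^ 2) ^ α := Real.rpow_nonneg (by nlinarith [hr.1, hr.2]) _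
        have hbr : ‖b * r‖ = ‖a‖ * r := by
          rw [norm_mul, hbn, Complex.norm_real, Real.norm_of_nonneg hr.1.le]
        rw [hψ]
        simp only
        rw [lintegral_const_mul' _ _ ENNReal.ofReal_ne_top]
        refine (mul_le_mul_right (lintegral_circle_inv_sq_le (w := b * r)
          (by rw [hbr]; linarith)) _).trans (le_of_eq ?_)
        rw [hbr, ← ENNReal.ofReal_mul (by positivity), ← ENNReal.ofReal_mul (by positivity)]
        congr 1
        rw [show -(m - 1) = (2 - m) + (-1) by ring, Real.rpow_add hab, Real.rpow_neg_one]
        ring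
    _ ≤ ENNReal.ofReal (2 * Real.pi) * ENNReal.ofReal (C * (1 - ‖a‖) ^ (α + 1 - (m - 1))) := by
        rw [lintegral_const_mul' _ _ ENNReal.ofReal_ne_top]
        exact mul_le_mul_right (hrad ‖a‖ (norm_nonneg a) ha1) _
    _ = _ := by
        rw [← ENNReal.ofReal_mul (by positivity), show α + 1 - (m - 1) = α + 2 - m by ring,
          ← mul_assoc]

/-- Functions of norm at most one in the Bergman space which are extremal for point evaluation
up to a constant, and which tend to zero locally uniformly at the boundary. -/
theorem exists_testFun {p α : ℝ} (hp : 0 < p) (hα : -1 < α) :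
    ∃ (T : ℂ → ℂ → ℂ) (C ε : ℝ) (M : ℕ), 0 < C ∧ 0 < ε ∧ ∀ a ∈ disc, T a ∈ Hol ∧
      bergmanNorm p α (T a) ≤ 1 ∧ 1 ≤ C * ‖T a a‖ * (1 - ‖a‖) ^ ((2 + α) / p) ∧
      ∀ z ∈ disc, ‖T a z‖ ≤ C * (1 - ‖a‖) ^ ε / (1 - ‖z‖) ^ M := by
  have hpi := Real.pi_pos
  have hα' : 0 < α + 1 := by linarith
  -- An integer power of `1 - āz` needs no branch of a logarithm; the size of `M` gives both `M * p
  -- > α + 2` and `M * p ≥ 2`.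
  obtain ⟨M, hM⟩ := exists_nat_gt ((|α| + 3) / p)
  rw [div_lt_iff₀ hp] at hM
  have hαabs := le_abs_self α
  have habs := abs_nonneg α
  set m : ℝ := M * p with hm
  obtain ⟨C₁, hC₁, hker⟩ := exists_lintegral_kernel_le (m := m) hα (by linarith) (by linarith)
  set k : ℝ := (α + 1) / Real.pi with hk
  have hk0 : 0 < k := by positivity
  set c : ℝ := (k * C₁) ^ (-(1 / p)) with hc
  have hc0 : 0 < c := by positivity
  have hcp : c ^ p * (k * C₁) = 1 := by
    rw [hc, ← Real.rpow_mul (by positivity), neg_mul, one_div_mul_cancel hp.ne',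
      Real.rpow_neg_one, inv_mul_cancel₀ (by positivity)]
  set s : ℝ := (2 + α) / p with hs
  set ε : ℝ := M - s with hε
  have hε0 : 0 < ε := by
    rw [hε, hs, sub_pos, div_lt_iff₀ hp, ← hm]
    linarith
  have hεp : ε * p = m - (2 + α) := by
    rw [hε, sub_mul, hs, div_mul_cancel₀ _ hp.ne', hm]
  -- The power `(1 - ‖a‖) ^ ε` normalizes the Bergman norm and also makes the functions vanish
  -- locally as `‖a‖ → 1`. In the constant, `2 ^ M / c` serves the lower bound at `a` and `c` the
  -- upper bound.
  refine ⟨fun a z => ((c * (1 - ‖a‖) ^ ε : ℝ) : ℂ) * ((1 - (starRingEnd ℂ) a * z) ^ M)⁻¹,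
    c + 2 ^ M / c, ε, M, by positivity, hε0, fun a ha => ?_⟩
  have ha1 := mem_disc.1 ha
  have hd0 : 0 < 1 - ‖a‖ := by linarith
  have hne : ∀ z ∈ disc, 1 - (starRingEnd ℂ) a * z ≠ 0 := fun z hz =>
    one_sub_ne_zero_of_norm_lt (by
      rw [norm_mul, RCLike.norm_conj]
      have := mem_disc.1 hz
      nlinarith [norm_nonneg a, norm_nonneg z])
  have hnorm : ∀ z, ‖((c * (1 - ‖a‖) ^ ε : ℝ) : ℂ) * ((1 - (starRingEnd ℂ) a * z) ^ M)⁻¹‖ =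
      c * (1 - ‖a‖) ^ ε * (‖1 - (starRingEnd ℂ) a * z‖ ^ M)⁻¹ := by
    intro z
    rw [norm_mul, norm_inv, norm_pow, Complex.norm_real, Real.norm_of_nonneg (by positivity)]
  refine ⟨?_, ?_, ?_, ?_⟩
  · intro z hz
    refine DifferentiableAt.differentiableWithinAt ?_
    have := pow_ne_zero M (hne z hz)
    fun_prop (disch := assumption)
  · rw [← ENNReal.rpow_le_rpow_iff hp, ENNReal.one_rpow, bergmanNorm_rpow hp hα]
    unfold bergmanInt
    have e : ∀ z ∈ disc, ENNReal.ofReal (‖((c * (1 - ‖a‖) ^ ε : ℝ) : ℂ) *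
        ((1 - (starRingEnd ℂ) a * z) ^ M)⁻¹‖ ^ p * (1 - ‖z‖ ^ 2) ^ α) =
        ENNReal.ofReal (c ^ p * (1 - ‖a‖) ^ (m - (2 + α))) *
        ENNReal.ofReal (‖1 - (starRingEnd ℂ) a * z‖ ^ (-m) * (1 - ‖z‖ ^ 2) ^ α) := by
      intro z hz
      rw [hnorm, ← ENNReal.ofReal_mul (by positivity), Real.mul_rpow (by positivity) (by positivity),
        Real.mul_rpow hc0.le (by positivity), ← Real.rpow_mul hd0.le, hεp,
        Real.inv_rpow (by positivity), ← Real.rpow_natCast, ← Real.rpow_mul (norm_nonneg _),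
        Real.rpow_neg (norm_nonneg _), mul_assoc]
    rw [setLIntegral_congr_fun measurableSet_disc e, lintegral_const_mul' _ _ ENNReal.ofReal_ne_top]
    refine (mul_le_mul_right (mul_le_mul_right (hker a ha) _) _).trans (le_of_eq ?_)
    rw [← ENNReal.ofReal_mul (by positivity), ← ENNReal.ofReal_mul (by positivity),
      ← ENNReal.ofReal_one]
    congr 1
    have e2 : (1 - ‖a‖) ^ (m - (2 + α)) * (1 - ‖a‖) ^ (α + 2 - m) = 1 := by
      rw [← Real.rpow_add hd0, show m - (2 + α) + (α + 2 - m) = 0 by ring, Real.rpow_zero]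
    calc _ = c ^ p * (k * C₁) * ((1 - ‖a‖) ^ (m - (2 + α)) * (1 - ‖a‖) ^ (α + 2 - m)) := by ring
      _ = 1 := by rw [hcp, e2, one_mul]
  · have h1 : ‖1 - (starRingEnd ℂ) a * a‖ ≤ 2 * (1 - ‖a‖) := by
      rw [RCLike.conj_mul, ← RCLike.ofReal_pow, ← RCLike.ofReal_one, ← RCLike.ofReal_sub,
        RCLike.norm_ofReal, abs_of_nonneg (one_sub_sq_pos ha).le]
      nlinarith [norm_nonneg a]
    have h0 : 0 < ‖1 - (starRingEnd ℂ) a * a‖ := norm_pos_iff.2 (hne a ha)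
    simp only [hnorm]
    have h2 : (2 ^ M * (1 - ‖a‖) ^ M)⁻¹ ≤ (‖1 - (starRingEnd ℂ) a * a‖ ^ M)⁻¹ := by
      rw [← mul_pow]
      gcongr
    have e3 : (1 - ‖a‖) ^ ε * (1 - ‖a‖) ^ s = (1 - ‖a‖) ^ M := by
      rw [← Real.rpow_add hd0, hε, sub_add_cancel, Real.rpow_natCast]
    calc (1 : ℝ) = 2 ^ M / c * (c * ((1 - ‖a‖) ^ ε * (1 - ‖a‖) ^ s) *
          (2 ^ M * (1 - ‖a‖) ^ M)⁻¹) := by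
          rw [e3]
          field_simp
      _ ≤ (c + 2 ^ M / c) * (c * ((1 - ‖a‖) ^ ε * (1 - ‖a‖) ^ s) *
          (‖1 - (starRingEnd ℂ) a * a‖ ^ M)⁻¹) := by
          gcongr
          linarith
      _ = _ := by ring
  · intro z hz
    simp only [hnorm]
    have hz1 := mem_disc.1 hz
    have hz2 : 0 < 1 - ‖z‖ := by linarith
    have h1 : 1 - ‖z‖ ≤ ‖1 - (starRingEnd ℂ) a * z‖ := by
      have h1 := norm_sub_norm_le (1 : ℂ) ((starRingEnd ℂ) a * z)
      rw [norm_one, norm_mul, RCLike.norm_conj] at h1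
      nlinarith [norm_nonneg z]
    rw [div_eq_mul_inv]
    have h3 : 0 ≤ 2 ^ M / c := by positivity
    gcongr
    linarith

/-! ### Boundedness -/

theorem le_toReal_of_ofReal_le {x : ℝ} {N : ℝ≥0∞} (hN : N ≠ ∞) (h : ENNReal.ofReal x ≤ N) :
    x ≤ N.toReal := by
  rwa [ENNReal.ofReal_le_iff_le_toReal hN] at h

theorem fracBlochNorm_le_iff {μ : ℝ → ℝ} {g : ℂ → ℂ} {N : ℝ≥0∞} :
    fracBlochNorm μ g ≤ N ↔
      ∀ z ∈ disc, ENNReal.ofReal (tail μ ‖z‖ * ‖fracDeriv μ g z‖) ≤ N :=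
  iSup₂_le_iff

theorem ofReal_norm_zero_le_blochNorm (g : ℂ → ℂ) : ENNReal.ofReal ‖g 0‖ ≤ blochNorm g :=
  le_self_add

theorem ofReal_deriv_le_blochNorm (g : ℂ → ℂ) {z : ℂ} (hz : z ∈ disc) :
    ENNReal.ofReal ((1 - ‖z‖ ^ 2) * ‖deriv g z‖) ≤ blochNorm g :=
  (le_iSup₂ (f := fun z (_ : z ∈ disc) => ENNReal.ofReal ((1 - ‖z‖ ^ 2) * ‖deriv g z‖)) z hz).trans
    le_add_self

theorem IsDoublingWeight.exists_fracBlochNorm_le_blochNorm {μ : ℝ → ℝ} (hμ : IsDoublingWeight μ) :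
    ∃ C : ℝ≥0, 0 < C ∧ ∀ g ∈ Hol, fracBlochNorm μ g ≤ C * blochNorm g := by
  obtain ⟨C, hC, h⟩ := hμ.exists_fracBloch_le_bloch
  refine ⟨C.toNNReal, Real.toNNReal_pos.2 hC, fun g hg => ?_⟩
  -- Here positivity of the constant matters: it makes `C * ∞ = ∞`.
  by_cases hN : blochNorm g = ∞
  · rw [hN, ENNReal.mul_top (by simpa using hC)]
    exact le_top
  rw [fracBlochNorm_le_iff]
  intro z hz
  have h1 := h (blochNorm g).toReal g hg
    (le_toReal_of_ofReal_le hN (ofReal_norm_zero_le_blochNorm g))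
    (fun z hz => le_toReal_of_ofReal_le hN (ofReal_deriv_le_blochNorm g hz)) z hz
  refine (ENNReal.ofReal_le_ofReal h1).trans (le_of_eq ?_)
  rw [ENNReal.ofReal_mul hC.le, ENNReal.ofReal_toReal hN]
  rfl

theorem IsDoublingWeight.exists_blochNorm_le_fracBlochNorm {μ : ℝ → ℝ} (hμ : IsDoublingWeight μ) :
    ∃ C : ℝ≥0, 0 < C ∧ ∀ g ∈ Hol, blochNorm g ≤ C * fracBlochNorm μ g := by
  obtain ⟨C, hC, h⟩ := hμ.exists_bloch_le_fracBloch
  refine ⟨(C + C).toNNReal, Real.toNNReal_pos.2 (by positivity), fun g hg => ?_⟩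
  by_cases hN : fracBlochNorm μ g = ∞
  · rw [hN, ENNReal.mul_top (by simpa using hC)]
    exact le_top
  obtain ⟨h1, h2⟩ := h (fracBlochNorm μ g).toReal g hg
    (fun z hz => le_toReal_of_ofReal_le hN (fracBlochNorm_le_iff.1 le_rfl z hz))
  have e : ENNReal.ofReal (C * (fracBlochNorm μ g).toReal) = ENNReal.ofReal C * fracBlochNorm μ g := by
    rw [ENNReal.ofReal_mul hC.le, ENNReal.ofReal_toReal hN]
  have e2 : (((C + C).toNNReal : ℝ≥0) : ℝ≥0∞) = ENNReal.ofReal C + ENNReal.ofReal C := by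
    rw [← ENNReal.ofReal_add hC.le hC.le]
    rfl
  rw [e2, add_mul, ← e]
  exact add_le_add (ENNReal.ofReal_le_ofReal h1)
    (iSup₂_le fun z hz => ENNReal.ofReal_le_ofReal (h2 z hz))

theorem IsDoublingWeight.exists_fracDeriv_mul_le {μ : ℝ → ℝ} (hμ : IsDoublingWeight μ)
    {p α : ℝ} (hp : 0 < p) (hα : -1 < α) :
    ∃ C : ℝ, 0 < C ∧ ∀ (N : ℝ) (g f : ℂ → ℂ), 0 ≤ N → g ∈ Hol → f ∈ Hol →
      bergmanNorm p α (volterra μ g f) ≤ ENNReal.ofReal N → ∀ a ∈ disc,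
      (tail μ ‖a‖ * ‖fracDeriv μ g a‖) * (‖f a‖ * (1 - ‖a‖) ^ ((2 + α) / p)) ≤ C * N := by
  obtain ⟨C, hC, h⟩ := hμ.exists_fracDeriv_le_of_bergmanNorm_le hp hα
  refine ⟨C, hC, fun N g f hN hg hf hle a ha => ?_⟩
  have h1 := h N _ hN (hμ.volterra_hol hf hg) hle a ha
  rw [hμ.fracDeriv_volterra hf hg ha, norm_mul] at h1
  calc _ = tail μ ‖a‖ * (‖f a‖ * ‖fracDeriv μ g a‖) * (1 - ‖a‖) ^ ((2 + α) / p) := by ring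
    _ ≤ C * N := h1

/-- The lower bound for the image is evaluated at `a` itself for the test function `T a`, whose
value there is extremal. -/
theorem IsDoublingWeight.exists_fracBlochNorm_le_opNorm {μ : ℝ → ℝ} (hμ : IsDoublingWeight μ)
    {p α : ℝ} (hp : 0 < p) (hα : -1 < α) :
    ∃ C : ℝ≥0, 0 < C ∧ ∀ g ∈ Hol, fracBlochNorm μ g ≤ C * opNorm p α (volterra μ g) := by
  obtain ⟨C₁, hC₁, h₁⟩ := hμ.exists_fracDeriv_mul_le hp hα
  obtain ⟨T, C₂, ε, M, hC₂, -, hT⟩ := exists_testFun hp hα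
  have hC : 0 < C₂ * C₁ := by positivity
  refine ⟨(C₂ * C₁).toNNReal, Real.toNNReal_pos.2 hC, fun g hg => ?_⟩
  by_cases hN : opNorm p α (volterra μ g) = ∞
  · rw [hN, ENNReal.mul_top (by simpa using hC)]
    exact le_top
  rw [fracBlochNorm_le_iff]
  intro a ha
  obtain ⟨hTh, hT1, hTa, -⟩ := hT a ha
  have h2 : bergmanNorm p α (volterra μ g (T a)) ≤ opNorm p α (volterra μ g) :=
    le_iSup₂ (f := fun f (_ : f ∈ {f | f ∈ bergman p α ∧ bergmanNorm p α f ≤ 1}) =>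
      bergmanNorm p α (volterra μ g f)) (T a) ⟨⟨hTh, hT1.trans_lt ENNReal.one_lt_top⟩, hT1⟩
  rw [← ENNReal.ofReal_toReal hN] at h2
  have h3 := h₁ _ g (T a) ENNReal.toReal_nonneg hg hTh h2 a ha
  have h4 : tail μ ‖a‖ * ‖fracDeriv μ g a‖ ≤ C₂ * C₁ * (opNorm p α (volterra μ g)).toReal := by
    have ht := (hμ.pos (norm_nonneg a) (mem_disc.1 ha)).le
    calc tail μ ‖a‖ * ‖fracDeriv μ g a‖ ≤ tail μ ‖a‖ * ‖fracDeriv μ g a‖ *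
          (C₂ * ‖T a a‖ * (1 - ‖a‖) ^ ((2 + α) / p)) :=
          le_mul_of_one_le_right (by positivity) hTa
      _ = C₂ * ((tail μ ‖a‖ * ‖fracDeriv μ g a‖) * (‖T a a‖ * (1 - ‖a‖) ^ ((2 + α) / p))) := by ring
      _ ≤ C₂ * (C₁ * (opNorm p α (volterra μ g)).toReal) := by gcongr
      _ = _ := by ring
  refine (ENNReal.ofReal_le_ofReal h4).trans (le_of_eq ?_)
  rw [ENNReal.ofReal_mul hC.le, ENNReal.ofReal_toReal hN]
  rfl

theorem IsDoublingWeight.exists_opNorm_le_fracBlochNorm {μ : ℝ → ℝ} (hμ : IsDoublingWeight μ)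
    {p α : ℝ} (hp : 0 < p) (hα : -1 < α) :
    ∃ C : ℝ≥0, ∀ g ∈ Hol, opNorm p α (volterra μ g) ≤ C * fracBlochNorm μ g := by
  obtain ⟨C, h⟩ := hμ.exists_bergmanNorm_volterra_le hp hα
  refine ⟨C, fun g hg => iSup₂_le fun f hf => (h g hg f hf.1.1).trans ?_⟩
  exact (mul_le_mul_right hf.2 _).trans (mul_one _).le

theorem IsDoublingWeight.boundedOn_iff_fracBloch {μ : ℝ → ℝ} (hμ : IsDoublingWeight μ)
    {p α : ℝ} (hp : 0 < p) (hα : -1 < α) {g : ℂ → ℂ}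
    (hg : g ∈ Hol) : BoundedOn p α (volterra μ g) ↔ g ∈ fracBloch μ := by
  constructor
  · rintro ⟨-, C, hC⟩
    obtain ⟨C', -, h⟩ := hμ.exists_fracBlochNorm_le_opNorm hp hα
    refine ⟨hg, (h g hg).trans_lt (ENNReal.mul_lt_top ENNReal.coe_lt_top ?_)⟩
    refine lt_of_le_of_lt (b := (C : ℝ≥0∞)) (iSup₂_le fun f hf => (hC f hf.1).trans ?_)
      ENNReal.coe_lt_top
    exact (mul_le_mul_right hf.2 _).trans (mul_one _).le
  · rintro ⟨-, hN⟩
    obtain ⟨C, h⟩ := hμ.exists_bergmanNorm_volterra_le hp hα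
    lift fracBlochNorm μ g to ℝ≥0 using hN.ne with N hN'
    have h1 : ∀ f ∈ bergman p α, bergmanNorm p α (volterra μ g f) ≤
        ((C * N : ℝ≥0) : ℝ≥0∞) * bergmanNorm p α f := by
      intro f hf
      have := h g hg f hf.1
      rwa [← hN', ← ENNReal.coe_mul] at this
    exact ⟨fun f hf => ⟨hμ.volterra_hol hf.1 hg,
      (h1 f hf).trans_lt (ENNReal.mul_lt_top ENNReal.coe_lt_top hf.2)⟩, _, h1⟩

theorem IsDoublingWeight.fracBloch_iff_bloch {μ : ℝ → ℝ} (hμ : IsDoublingWeight μ)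
    {g : ℂ → ℂ} (hg : g ∈ Hol) :
    g ∈ fracBloch μ ↔ g ∈ bloch := by
  constructor
  · rintro ⟨-, hN⟩
    obtain ⟨C, -, h⟩ := hμ.exists_blochNorm_le_fracBlochNorm
    exact ⟨hg, (h g hg).trans_lt (ENNReal.mul_lt_top ENNReal.coe_lt_top hN)⟩
  · rintro ⟨-, hN⟩
    obtain ⟨C, -, h⟩ := hμ.exists_fracBlochNorm_le_blochNorm
    exact ⟨hg, (h g hg).trans_lt (ENNReal.mul_lt_top ENNReal.coe_lt_top hN)⟩

/-! ### The little Bloch spaces -/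

theorem tendsto_toCircle_iff {u : ℂ → ℝ} :
    Tendsto u toCircle (𝓝 0) ↔
      ∀ ε > 0, ∃ R : ℝ, 0 ≤ R ∧ R < 1 ∧ ∀ z ∈ disc, R < ‖z‖ → |u z| < ε := by
  have hb : (𝓝[<] (1 : ℝ)).HasBasis (fun R => R < 1) fun R => Ioo R 1 := nhdsLT_basis 1
  rw [toCircle, ((hb.comap norm).tendsto_iff Metric.nhds_basis_ball)]
  refine forall₂_congr fun ε _ => ?_
  constructor
  · rintro ⟨R, hR, h⟩
    refine ⟨max R 0, le_max_right _ _, max_lt hR one_pos, fun z hz hzR => ?_⟩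
    simpa using h z ⟨(le_max_left _ _).trans_lt hzR, mem_disc.1 hz⟩
  · rintro ⟨R, -, hR, h⟩
    refine ⟨R, hR, fun z hz => ?_⟩
    simpa using h z (mem_disc.2 hz.2) hz.1

/-- The form in which approximation by dilates is used: the approximation error is `ε`, and the
bounded dilate contributes `v ‖z‖ * B`. -/
theorem tendsto_toCircle_of_le {u : ℂ → ℝ} {v : ℝ → ℝ} (hv : Tendsto v (𝓝[<] 1) (𝓝 0))
    (hu : ∀ z ∈ disc, 0 ≤ u z)
    (h : ∀ ε > 0, ∃ B : ℝ, ∀ z ∈ disc, u z ≤ ε + v ‖z‖ * B) : Tendsto u toCircle (𝓝 0) := by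
  have hvB : ∀ B, Tendsto (fun z : ℂ => v ‖z‖ * B) toCircle (𝓝 0) := by
    intro B
    have := (hv.comp (tendsto_comap (f := (norm : ℂ → ℝ)))).mul_const B
    rwa [zero_mul] at this
  rw [tendsto_toCircle_iff]
  intro ε hε
  obtain ⟨B, hB⟩ := h (ε / 2) (by positivity)
  obtain ⟨R, hR0, hR1, hR⟩ := tendsto_toCircle_iff.1 (hvB B) (ε / 2) (by positivity)
  refine ⟨R, hR0, hR1, fun z hz hzR => ?_⟩
  rw [abs_of_nonneg (hu z hz)]
  have h1 := hB z hz
  have h2 := (abs_lt.1 (hR z hz hzR)).2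
  linarith

theorem norm_ofReal_of_nonneg {x : ℝ} (hx : 0 ≤ x) : ‖(x : ℂ)‖ = x := by
  rw [Complex.norm_real, Real.norm_of_nonneg hx]

/-- A function that is small at the boundary relative to a decreasing weight is approximated by
its dilations. -/
theorem exists_dilation_close {v : ℝ → ℝ} (hv0 : ∀ r, 0 ≤ r → r < 1 → 0 ≤ v r)
    (hv : ∀ r t, 0 ≤ r → r ≤ t → t < 1 → v t ≤ v r) {G : ℂ → ℂ} (hG : ContinuousOn G disc)
    (h : Tendsto (fun z => v ‖z‖ * ‖G z‖) toCircle (𝓝 0)) (k : ℕ) {ε : ℝ} (hε : 0 < ε) :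
    ∃ ρ : ℝ, 0 < ρ ∧ ρ < 1 ∧ ∀ z ∈ disc, v ‖z‖ * ‖G z - (ρ : ℂ) ^ k * G (ρ * z)‖ ≤ ε := by
  obtain ⟨R, hR0, hR1, hR⟩ := tendsto_toCircle_iff.1 h (ε / 2) (by positivity)
  set S : ℝ := (2 + R) / 3 with hS
  have hRS : R < S := by rw [hS]; linarith
  have hS1 : S < 1 := by rw [hS]; linarith
  have hS0 : 0 < S := by rw [hS]; linarith
  set K : Set (ℝ × ℂ) := Icc 0 1 ×ˢ Metric.closedBall 0 S with hK
  have hKc : IsCompact K := isCompact_Icc.prod (isCompact_closedBall 0 S)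
  have hcont : ContinuousOn (fun x : ℝ × ℂ => (x.1 : ℂ) ^ k * G (x.1 * x.2)) K := by
    refine ContinuousOn.mul (by fun_prop) (hG.comp (by fun_prop) ?_)
    rintro ⟨ρ, z⟩ ⟨hρ, hz⟩
    refine mul_mem_disc ?_ (mem_disc.2 ((mem_closedBall_zero_iff.1 hz).trans_lt hS1))
    rw [norm_ofReal_of_nonneg hρ.1]
    exact hρ.2
  have huc := hKc.uniformContinuousOn_of_continuous hcont
  rw [Metric.uniformContinuousOn_iff] at huc
  have hv00 := hv0 0 le_rfl one_pos
  obtain ⟨δ, hδ, hunif⟩ := huc (ε / (v 0 + 1)) (by positivity)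
  -- Closeness to `1` within `δ` serves the compact part `‖z‖ ≤ S`. The bound `(1 + 2 * R) / (2 +
  -- R)` gives `ρ * S > (1 + 2 * R) / 3 > R`, so for `‖z‖ > S` the dilated point stays where `G` is
  -- already small.
  obtain ⟨ρ, hρ1, hρ2⟩ := exists_between
    (show max (max (1 - δ) 0) (max (1 / 2) ((1 + 2 * R) / (2 + R))) < 1 by
      refine max_lt (max_lt (by linarith) one_pos) (max_lt (by norm_num) ?_)
      rw [div_lt_one (by linarith)]
      linarith)
  rw [max_lt_iff, max_lt_iff, max_lt_iff] at hρ1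
  obtain ⟨⟨hρδ, hρ0⟩, -, hρR⟩ := hρ1
  refine ⟨ρ, hρ0, hρ2, fun z hz => ?_⟩
  have hz1 := mem_disc.1 hz
  have hvz := hv0 _ (norm_nonneg z) hz1
  have hρn := norm_ofReal_of_nonneg hρ0.le
  rcases le_or_gt ‖z‖ S with hzS | hzS
  · have h1 := hunif (1, z) ⟨by simp, by simpa using hzS⟩ (ρ, z)
      ⟨⟨hρ0.le, hρ2.le⟩, by simpa using hzS⟩ (by
        rw [Prod.dist_eq, dist_self, max_lt_iff, Real.dist_eq, abs_of_pos (by linarith)]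
        exact ⟨by linarith, hδ⟩)
    rw [dist_eq_norm] at h1
    simp only [Complex.ofReal_one, one_pow, one_mul] at h1
    rw [lt_div_iff₀ (by positivity)] at h1
    have h2 := hv 0 ‖z‖ le_rfl (norm_nonneg z) hz1
    nlinarith [norm_nonneg (G z - (ρ : ℂ) ^ k * G (ρ * z))]
  · have hρz : ‖(ρ : ℂ) * z‖ = ρ * ‖z‖ := by rw [norm_mul, hρn]
    have hle : ρ * ‖z‖ ≤ ‖z‖ := mul_le_of_le_one_left (norm_nonneg z) hρ2.le
    have hd : (ρ : ℂ) * z ∈ disc := mul_mem_disc (by rw [hρn]; exact hρ2.le) hz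
    have hρz2 : R < ‖(ρ : ℂ) * z‖ := by
      rw [hρz]
      rw [div_lt_iff₀ (by linarith)] at hρR
      rw [hS] at hzS
      nlinarith
    have h1 := (abs_lt.1 (hR z hz (hRS.trans hzS))).2
    have h2 := (abs_lt.1 (hR _ hd hρz2)).2
    have h3 : v ‖z‖ ≤ v ‖(ρ : ℂ) * z‖ := hv _ _ (norm_nonneg _) (by rw [hρz]; exact hle) hz1
    have h4 : ‖G z - (ρ : ℂ) ^ k * G (ρ * z)‖ ≤ ‖G z‖ + ‖G (ρ * z)‖ := by
      refine (norm_sub_le _ _).trans ?_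
      rw [norm_mul, norm_pow, hρn]
      gcongr
      exact mul_le_of_le_one_left (norm_nonneg _) (pow_le_one₀ hρ0.le hρ2.le)
    calc v ‖z‖ * ‖G z - (ρ : ℂ) ^ k * G (ρ * z)‖ ≤ v ‖z‖ * (‖G z‖ + ‖G (ρ * z)‖) := by gcongr
      _ = v ‖z‖ * ‖G z‖ + v ‖z‖ * ‖G (ρ * z)‖ := by ring
      _ ≤ v ‖z‖ * ‖G z‖ + v ‖(ρ : ℂ) * z‖ * ‖G (ρ * z)‖ := by gcongr
      _ ≤ ε := by linarith

theorem exists_norm_dilation_le {G : ℂ → ℂ} (hG : ContinuousOn G disc) {ρ : ℝ} (hρ0 : 0 < ρ)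
    (hρ1 : ρ < 1) : ∃ B : ℝ, 0 ≤ B ∧ ∀ z ∈ disc, ‖G (ρ * z)‖ ≤ B := by
  have hsub : Metric.closedBall (0 : ℂ) ρ ⊆ disc := fun w hw =>
    mem_disc.2 ((mem_closedBall_zero_iff.1 hw).trans_lt hρ1)
  obtain ⟨B, hB⟩ := (isCompact_closedBall (0 : ℂ) ρ).exists_bound_of_continuousOn (hG.mono hsub)
  refine ⟨max B 0, le_max_right _ _, fun z hz => (hB _ ?_).trans (le_max_left _ _)⟩
  rw [mem_closedBall_zero_iff, norm_mul, norm_ofReal_of_nonneg hρ0.le]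
  exact mul_le_of_le_one_right hρ0.le (mem_disc.1 hz).le

theorem coeff_sub {f g : ℂ → ℂ} (hf : f ∈ Hol) (hg : g ∈ Hol) (n : ℕ) :
    coeff (f - g) n = coeff f n - coeff g n := by
  have h : ∀ {f : ℂ → ℂ}, f ∈ Hol → ContDiffAt ℂ n f 0 := fun hf =>
    (DifferentiableOn.analyticAt hf (isOpen_disc.mem_nhds zero_mem_disc)).contDiffAt
  rw [coeff, coeff, coeff, iteratedDeriv_sub (h hf) (h hg), sub_div]

theorem deriv_sub_dilation {g : ℂ → ℂ} (hg : g ∈ Hol) {ρ : ℝ} (hρ0 : 0 < ρ) (hρ1 : ρ < 1) {z : ℂ}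
    (hz : z ∈ disc) :
    deriv (g - fun w => g (ρ * w)) z = deriv g z - (ρ : ℂ) ^ 1 * deriv g (ρ * z) := by
  have hρn := norm_ofReal_of_nonneg hρ0.le
  have h1 : DifferentiableAt ℂ g z := DifferentiableOn.differentiableAt hg (isOpen_disc.mem_nhds hz)
  have h2 : (fun w => g ((ρ : ℂ) * w)) ∈ Hol := comp_mul_hol hg (by rw [hρn]; exact hρ1.le)
  have h3 := DifferentiableOn.differentiableAt h2 (isOpen_disc.mem_nhds hz)
  rw [deriv_sub h1 h3, deriv_comp_mul_left, pow_one, smul_eq_mul]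

theorem IsDoublingWeight.fracDeriv_sub {μ : ℝ → ℝ} (hμ : IsDoublingWeight μ)
    {f g : ℂ → ℂ} (hf : f ∈ Hol) (hg : g ∈ Hol) {z : ℂ}
    (hz : z ∈ disc) : fracDeriv μ (f - g) z = fracDeriv μ f z - fracDeriv μ g z := by
  have h : ∀ {f : ℂ → ℂ}, f ∈ Hol →
      Summable fun n => coeff f n / (moment μ (2 * n + 1) : ℂ) * z ^ n := fun hf =>
    (hμ.discSummable_div_moment (discSummable_coeff hf)).summable hz
  unfold fracDeriv
  rw [← (h hf).tsum_sub (h hg)]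
  congr 1
  funext n
  rw [coeff_sub hf hg]
  ring

theorem IsDoublingWeight.fracDeriv_sub_dilation {μ : ℝ → ℝ} (hμ : IsDoublingWeight μ)
    {g : ℂ → ℂ} (hg : g ∈ Hol) {ρ : ℝ} (hρ0 : 0 < ρ)
    (hρ1 : ρ < 1) {z : ℂ} (hz : z ∈ disc) :
    fracDeriv μ (g - fun w => g (ρ * w)) z = fracDeriv μ g z - fracDeriv μ g (ρ * z) := by
  have hρn : ‖(ρ : ℂ)‖ ≤ 1 := by rw [norm_ofReal_of_nonneg hρ0.le]; exact hρ1.le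
  rw [hμ.fracDeriv_sub hg (comp_mul_hol hg hρn) hz, fracDeriv_comp_mul μ hg hρn]

/-- The norm comparison is applied to `g - g(ρ ·)`, which is small because `g` is approximated by
its dilates; `D^μ` of a dilate is bounded and the tail vanishes at the circle. The exponent `1` in
`exists_dilation_close` is the chain-rule factor, absent in the converse direction. -/
theorem IsDoublingWeight.tendsto_fracBloch_of_bloch {μ : ℝ → ℝ} (hμ : IsDoublingWeight μ)
    {g : ℂ → ℂ} (hg : g ∈ Hol)
    (h : Tendsto (fun z => (1 - ‖z‖ ^ 2) * ‖deriv g z‖) toCircle (𝓝 0)) :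
    Tendsto (fun z => tail μ ‖z‖ * ‖fracDeriv μ g z‖) toCircle (𝓝 0) := by
  obtain ⟨C, hC, hle⟩ := hμ.exists_fracBloch_le_bloch
  refine tendsto_toCircle_of_le hμ.tendsto_tail (fun z hz =>
    mul_nonneg (hμ.pos (norm_nonneg z) (mem_disc.1 hz)).le (norm_nonneg _)) fun ε hε => ?_
  obtain ⟨ρ, hρ0, hρ1, hρ⟩ := exists_dilation_close (v := fun r => 1 - r ^ 2) (G := deriv g)
    (fun r h0 h1 => by nlinarith) (fun r t h0 h1 h2 => by nlinarith)
    (continuousOn_of_hol (deriv_hol hg)) h 1 (show 0 < ε / C by positivity)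
  have hρn : ‖(ρ : ℂ)‖ ≤ 1 := by rw [norm_ofReal_of_nonneg hρ0.le]; exact hρ1.le
  have h1 := hle (ε / C) (g - fun w => g (ρ * w)) (sub_hol hg (comp_mul_hol hg hρn))
    (by simp; positivity) (fun z hz => by rw [deriv_sub_dilation hg hρ0 hρ1 hz]; exact hρ z hz)
  obtain ⟨B, hB0, hB⟩ := exists_norm_dilation_le (continuousOn_of_hol (hμ.fracDeriv_hol hg)) hρ0 hρ1
  refine ⟨B, fun z hz => ?_⟩
  have h2 := h1 z hz
  rw [hμ.fracDeriv_sub_dilation hg hρ0 hρ1 hz, mul_div_cancel₀ _ hC.ne'] at h2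
  have ht := (hμ.pos (norm_nonneg z) (mem_disc.1 hz)).le
  have h3 : ‖fracDeriv μ g z‖ ≤
      ‖fracDeriv μ g z - fracDeriv μ g (ρ * z)‖ + ‖fracDeriv μ g (ρ * z)‖ := by
    simpa using norm_add_le (fracDeriv μ g z - fracDeriv μ g (ρ * z)) (fracDeriv μ g (ρ * z))
  calc tail μ ‖z‖ * ‖fracDeriv μ g z‖ ≤ tail μ ‖z‖ *
        (‖fracDeriv μ g z - fracDeriv μ g (ρ * z)‖ + ‖fracDeriv μ g (ρ * z)‖) := by gcongr
    _ = tail μ ‖z‖ * ‖fracDeriv μ g z - fracDeriv μ g (ρ * z)‖ +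
        tail μ ‖z‖ * ‖fracDeriv μ g (ρ * z)‖ := by ring
    _ ≤ ε + tail μ ‖z‖ * B := by
        gcongr
        exact hB z hz

theorem IsDoublingWeight.tendsto_bloch_of_fracBloch {μ : ℝ → ℝ} (hμ : IsDoublingWeight μ)
    {g : ℂ → ℂ} (hg : g ∈ Hol)
    (h : Tendsto (fun z => tail μ ‖z‖ * ‖fracDeriv μ g z‖) toCircle (𝓝 0)) :
    Tendsto (fun z => (1 - ‖z‖ ^ 2) * ‖deriv g z‖) toCircle (𝓝 0) := by
  obtain ⟨C, hC, hle⟩ := hμ.exists_bloch_le_fracBloch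
  have hlim : Tendsto (fun r : ℝ => 1 - r ^ 2) (𝓝[<] 1) (𝓝 0) := by
    have : Tendsto (fun r : ℝ => 1 - r ^ 2) (𝓝 1) (𝓝 (1 - 1 ^ 2)) :=
      Continuous.tendsto (by fun_prop) 1
    rw [one_pow, sub_self] at this
    exact this.mono_left nhdsWithin_le_nhds
  refine tendsto_toCircle_of_le hlim (fun z hz =>
    mul_nonneg (one_sub_sq_pos hz).le (norm_nonneg _)) fun ε hε => ?_
  obtain ⟨ρ, hρ0, hρ1, hρ⟩ := exists_dilation_close (v := tail μ) (G := fracDeriv μ g)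
    (fun r h0 h1 => (hμ.pos h0 h1).le) (fun r t h0 h1 h2 => hμ.antitone h0 h1 h2.le)
    (continuousOn_of_hol (hμ.fracDeriv_hol hg)) h 0 (show 0 < ε / C by positivity)
  have hρn : ‖(ρ : ℂ)‖ ≤ 1 := by rw [norm_ofReal_of_nonneg hρ0.le]; exact hρ1.le
  have h1 := (hle (ε / C) (g - fun w => g (ρ * w)) (sub_hol hg (comp_mul_hol hg hρn))
    (fun z hz => by
      rw [hμ.fracDeriv_sub_dilation hg hρ0 hρ1 hz]
      simpa using hρ z hz)).2
  obtain ⟨B, hB0, hB⟩ := exists_norm_dilation_le (continuousOn_of_hol (deriv_hol hg)) hρ0 hρ1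
  refine ⟨B, fun z hz => ?_⟩
  have h2 := h1 z hz
  rw [deriv_sub_dilation hg hρ0 hρ1 hz, mul_div_cancel₀ _ hC.ne', pow_one] at h2
  have ht := (one_sub_sq_pos hz).le
  have h3 : ‖deriv g z‖ ≤ ‖deriv g z - ρ * deriv g (ρ * z)‖ + B := by
    have h4 : ‖deriv g z‖ ≤ ‖deriv g z - ρ * deriv g (ρ * z)‖ + ‖ρ * deriv g (ρ * z)‖ := by
      simpa using norm_add_le (deriv g z - ρ * deriv g (ρ * z)) (ρ * deriv g (ρ * z))
    have h5 : ‖ρ * deriv g (ρ * z)‖ ≤ B := by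
      rw [norm_mul]
      exact (mul_le_of_le_one_left (norm_nonneg _) hρn).trans (hB z hz)
    linarith
  calc (1 - ‖z‖ ^ 2) * ‖deriv g z‖ ≤ (1 - ‖z‖ ^ 2) *
        (‖deriv g z - ρ * deriv g (ρ * z)‖ + B) := by gcongr
    _ = (1 - ‖z‖ ^ 2) * ‖deriv g z - ρ * deriv g (ρ * z)‖ + (1 - ‖z‖ ^ 2) * B := by ring
    _ ≤ ε + (1 - ‖z‖ ^ 2) * B := by gcongr

theorem IsDoublingWeight.littleFracBloch_iff_littleBloch {μ : ℝ → ℝ} (hμ : IsDoublingWeight μ)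
    {g : ℂ → ℂ} (hg : g ∈ Hol) :
    g ∈ littleFracBloch μ ↔ g ∈ littleBloch :=
  and_congr (hμ.fracBloch_iff_bloch hg)
    ⟨hμ.tendsto_bloch_of_fracBloch hg, hμ.tendsto_fracBloch_of_bloch hg⟩

/-! ### Compactness -/

theorem closedBall_subset_disc {r : ℝ} (hr : r < 1) : Metric.closedBall (0 : ℂ) r ⊆ disc :=
  fun _ hw => mem_disc.2 ((mem_closedBall_zero_iff.1 hw).trans_lt hr)

theorem norm_coeff_le {f : ℂ → ℂ} (hf : f ∈ Hol) {r B : ℝ} (hr0 : 0 < r) (hr1 : r < 1)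
    (hB : ∀ z, ‖z‖ ≤ r → ‖f z‖ ≤ B) (n : ℕ) : ‖coeff f n‖ ≤ B / r ^ n := by
  have hd : DiffContOnCl ℂ f (Metric.ball 0 r) := by
    refine DifferentiableOn.diffContOnCl (DifferentiableOn.mono hf ?_)
    rw [closure_ball 0 hr0.ne']
    exact closedBall_subset_disc hr1
  have h := Complex.norm_iteratedDeriv_le_of_forall_mem_sphere_norm_le n hr0 hd
    (fun z hz => hB z (mem_sphere_zero_iff_norm.1 hz).le)
  rw [coeff, norm_div, Complex.norm_natCast, div_le_iff₀ (by positivity)]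
  refine h.trans (le_of_eq ?_)
  ring

/-- A locally uniformly bounded sequence of analytic functions has a pointwise convergent
subsequence with analytic limit. -/
theorem exists_subseq_tendsto {F : ℕ → ℂ → ℂ} (hF : ∀ n, F n ∈ Hol) (B : ℝ → ℝ)
    (hB : ∀ n z, z ∈ disc → ‖F n z‖ ≤ B ‖z‖) (hmono : ∀ r t, 0 ≤ r → r ≤ t → t < 1 → B r ≤ B t) :
    ∃ f ∈ Hol, ∃ φ : ℕ → ℕ, StrictMono φ ∧
      ∀ z ∈ disc, Tendsto (fun n => F (φ n) z) atTop (𝓝 (f z)) := by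
  have hB' : ∀ r, 0 < r → r < 1 → ∀ n k, ‖coeff (F n) k‖ ≤ B r / r ^ k :=
    fun r h0 h1 n k => norm_coeff_le (hF n) h0 h1 (fun z hz =>
      (hB n z (mem_disc.2 (hz.trans_lt h1))).trans (hmono _ _ (norm_nonneg z) hz h1)) k
  -- Compactness of a countable product of closed discs replaces the diagonal argument on Taylor
  -- coefficients; the radius `1 / 2` is arbitrary. Cauchy bounds at larger radii then pass to the
  -- limit and dominate the Taylor series.
  obtain ⟨a, -, φ, hφ, ha⟩ := (isCompact_univ_pi fun k : ℕ =>
    isCompact_closedBall (0 : ℂ) (B (1 / 2) / (1 / 2) ^ k)).tendsto_subseq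
    (x := fun n k => coeff (F n) k) (fun n k _ => by
      rw [mem_closedBall_zero_iff]
      exact hB' (1 / 2) (by norm_num) (by norm_num) n k)
  have ha' : ∀ k, Tendsto (fun n => coeff (F (φ n)) k) atTop (𝓝 (a k)) := tendsto_pi_nhds.1 ha
  have haB : ∀ r, 0 < r → r < 1 → ∀ k, ‖a k‖ ≤ B r / r ^ k := fun r h0 h1 k =>
    le_of_tendsto (ha' k).norm (Eventually.of_forall fun n => hB' r h0 h1 _ k)
  have hsum : ∀ r s : ℝ, 0 ≤ r → r < s → Summable fun k : ℕ => B s / s ^ k * r ^ k := by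
    intro r s hr0 hrs
    have hs : 0 < s := hr0.trans_lt hrs
    have := (summable_geometric_of_lt_one (r := r / s) (by positivity)
      ((div_lt_one hs).2 hrs)).mul_left (B s)
    refine this.congr fun k => ?_
    rw [div_pow]
    ring
  have had : DiscSummable a := by
    intro r hr0 hr1
    obtain ⟨s, hrs, hs1⟩ := exists_between hr1
    refine Summable.of_nonneg_of_le (fun k => by positivity) (fun k => ?_) (hsum r s hr0 hrs)
    gcongr
    exact haB s (hr0.trans_lt hrs) hs1 k
  refine ⟨powerSum a, powerSum_hol had, φ, hφ, fun z hz => ?_⟩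
  obtain ⟨s, hrs, hs1⟩ := exists_between (mem_disc.1 hz)
  have h := tendsto_tsum_of_dominated_convergence (𝓕 := atTop)
    (f := fun n k => coeff (F (φ n)) k * z ^ k) (g := fun k => a k * z ^ k)
    (hsum ‖z‖ s (norm_nonneg z) hrs) (fun k => (ha' k).mul_const _)
    (Eventually.of_forall fun n k => by
      rw [norm_mul, norm_pow]
      gcongr
      exact hB' s ((norm_nonneg z).trans_lt hrs) hs1 _ k)
  refine h.congr fun n => ?_
  exact (hasSum_coeff (hF _) hz).tsum_eq

/-- Fatou's lemma; it puts the pointwise limit of a bounded sequence back into the space. -/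
theorem bergmanInt_le_of_tendsto {p α : ℝ} (hp : 0 < p) {F : ℕ → ℂ → ℂ} {f : ℂ → ℂ}
    (hF : ∀ n, F n ∈ Hol) (h : ∀ z ∈ disc, Tendsto (fun n => F n z) atTop (𝓝 (f z))) {M : ℝ≥0∞}
    (hM : ∀ n, bergmanInt p α (F n) ≤ M) : bergmanInt p α f ≤ M := by
  calc bergmanInt p α f = ∫⁻ z in disc, liminf (fun n =>
        ENNReal.ofReal (‖F n z‖ ^ p * (1 - ‖z‖ ^ 2) ^ α)) atTop := by
        refine setLIntegral_congr_fun measurableSet_disc fun z hz => ?_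
        refine (Tendsto.liminf_eq ?_).symm
        refine (ENNReal.continuous_ofReal.tendsto _).comp (Tendsto.mul_const _ ?_)
        exact (h z hz).norm.rpow_const (Or.inr hp.le)
    _ ≤ liminf (fun n => bergmanInt p α (F n)) atTop :=
        lintegral_liminf_le' fun n => aemeasurable_bergmanInt (hF n) p α
    _ ≤ M := by
        refine (liminf_le_liminf (Eventually.of_forall hM)).trans ?_
        simp

/-- A quasi-triangle inequality that treats `p < 1` and `p ≥ 1` alike. -/
theorem norm_sub_rpow_le {p : ℝ} (hp : 0 < p) (x y : ℂ) :
    ‖x - y‖ ^ p ≤ 2 ^ p * (‖x‖ ^ p + ‖y‖ ^ p) := by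
  have h1 : ‖x - y‖ ≤ 2 * max ‖x‖ ‖y‖ := by
    have := norm_sub_le x y
    have := le_max_left ‖x‖ ‖y‖
    have := le_max_right ‖x‖ ‖y‖
    linarith
  have h0 : 0 ≤ max ‖x‖ ‖y‖ := (norm_nonneg x).trans (le_max_left _ _)
  calc ‖x - y‖ ^ p ≤ (2 * max ‖x‖ ‖y‖) ^ p := by gcongr
    _ = 2 ^ p * max ‖x‖ ‖y‖ ^ p := Real.mul_rpow (by norm_num) h0
    _ ≤ _ := by
        gcongr
        rcases max_cases ‖x‖ ‖y‖ with h | h <;> rw [h.1]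
        · exact le_add_of_nonneg_right (by positivity)
        · exact le_add_of_nonneg_left (by positivity)

theorem bergmanInt_sub_le {p α : ℝ} (hp : 0 < p) {f g : ℂ → ℂ} (hf : f ∈ Hol) :
    bergmanInt p α (f - g) ≤
      ENNReal.ofReal (2 ^ p) * (bergmanInt p α f + bergmanInt p α g) := by
  unfold bergmanInt
  rw [← lintegral_add_left' (aemeasurable_bergmanInt hf p α),
    ← lintegral_const_mul' _ _ ENNReal.ofReal_ne_top]
  refine setLIntegral_mono' measurableSet_disc fun z hz => ?_
  have hw : 0 ≤ (1 - ‖z‖ ^ 2) ^ α := Real.rpow_nonneg (one_sub_sq_pos hz).le _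
  rw [← ENNReal.ofReal_add (by positivity) (by positivity), ← ENNReal.ofReal_mul (by positivity)]
  refine ENNReal.ofReal_le_ofReal ?_
  calc _ ≤ 2 ^ p * (‖f z‖ ^ p + ‖g z‖ ^ p) * (1 - ‖z‖ ^ 2) ^ α := by
        gcongr
        exact norm_sub_rpow_le hp _ _
    _ = _ := by ring

theorem bergmanNorm_lt_top_iff {p α : ℝ} (hp : 0 < p) (hα : -1 < α) {f : ℂ → ℂ} :
    bergmanNorm p α f < ∞ ↔ bergmanInt p α f < ∞ := by
  have h := bergmanNorm_rpow hp hα f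
  constructor
  · intro h1
    have h2 : ENNReal.ofReal ((α + 1) / Real.pi) * bergmanInt p α f < ∞ := by
      rw [← h]
      exact ENNReal.rpow_lt_top_of_nonneg hp.le h1.ne
    rcases ENNReal.mul_lt_top_iff.1 h2 with h3 | h3 | h3
    · exact h3.2
    · exact absurd h3 (bergmanConst_ne_zero hα)
    · rw [h3]
      exact ENNReal.zero_lt_top
  · intro h1
    have h2 : bergmanNorm p α f ^ p < ∞ := by
      rw [h]
      exact ENNReal.mul_lt_top ENNReal.ofReal_lt_top h1
    exact (ENNReal.rpow_lt_top_iff_of_pos hp).1 h2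

theorem tendsto_bergmanNorm_of_int {p α : ℝ} (hp : 0 < p) (hα : -1 < α) {F : ℕ → ℂ → ℂ}
    (h : Tendsto (fun n => bergmanInt p α (F n)) atTop (𝓝 0)) :
    Tendsto (fun n => bergmanNorm p α (F n)) atTop (𝓝 0) := by
  have h1 := ENNReal.Tendsto.const_mul (a := ENNReal.ofReal ((α + 1) / Real.pi)) h
    (Or.inr ENNReal.ofReal_ne_top)
  rw [mul_zero] at h1
  have h2 := (ENNReal.continuous_rpow_const (y := 1 / p)).tendsto 0 |>.comp h1
  rw [ENNReal.zero_rpow_of_pos (by positivity)] at h2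
  refine h2.congr fun n => ?_
  simp only [Function.comp_apply]
  rw [← bergmanNorm_rpow hp hα, ← ENNReal.rpow_mul, mul_one_div_cancel hp.ne', ENNReal.rpow_one]

theorem fracInt_sub {ν : ℝ → ℝ} (hi : IntegrableOn ν (Ico 0 1)) {h k : ℂ → ℂ} (hh : h ∈ Hol)
    (hk : k ∈ Hol) {z : ℂ} (hz : z ∈ disc) :
    fracInt ν (h - k) z = fracInt ν h z - fracInt ν k z := by
  unfold fracInt
  rw [← ((discSummable_moment_mul hi hh).summable hz).tsum_sub
    ((discSummable_moment_mul hi hk).summable hz)]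
  congr 1
  funext n
  rw [coeff_sub hh hk]
  ring

theorem norm_fracInt_le {ν : ℝ → ℝ} (h0 : ∀ r ∈ Ico (0 : ℝ) 1, 0 ≤ ν r)
    (hi : IntegrableOn ν (Ico 0 1)) {h : ℂ → ℂ} (hh : h ∈ Hol) {z : ℂ} (hz : z ∈ disc) {B : ℝ}
    (hB : ∀ w, ‖w‖ ≤ ‖z‖ → ‖h w‖ ≤ B) : ‖fracInt ν h z‖ ≤ B * ∫ s in Ico (0 : ℝ) 1, ν s := by
  rw [fracInt_eq_integral hi hh hz, ← integral_const_mul]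
  refine norm_integral_le_of_norm_le (hi.const_mul B) ?_
  filter_upwards [ae_restrict_mem measurableSet_Ico] with s hs
  have hB0 : 0 ≤ B := (norm_nonneg _).trans (hB z le_rfl)
  rw [norm_mul, norm_mul, norm_ofReal_of_nonneg hs.1, norm_ofReal_of_nonneg (h0 s hs)]
  have h1 : ‖h ((s : ℂ) ^ 2 * z)‖ ≤ B := by
    refine hB _ ?_
    rw [norm_mul, norm_pow, norm_ofReal_of_nonneg hs.1]
    exact mul_le_of_le_one_left (norm_nonneg z) (pow_le_one₀ hs.1 hs.2.le)
  have h2 := h0 s hs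
  calc s * ‖h ((s : ℂ) ^ 2 * z)‖ * ν s ≤ 1 * B * ν s := by
        have := hs.2.le
        have := hs.1
        gcongr
    _ = _ := by rw [one_mul]

theorem IsDoublingWeight.volterra_sub {μ : ℝ → ℝ} (hμ : IsDoublingWeight μ)
    {f k g : ℂ → ℂ} (hf : f ∈ Hol) (hk : k ∈ Hol) (hg : g ∈ Hol)
    {z : ℂ} (hz : z ∈ disc) :
    volterra μ g (f - k) z = volterra μ g f z - volterra μ g k z := by
  have hD := hμ.fracDeriv_hol hg
  unfold volterra
  rw [← fracInt_sub hμ.integrable (mul_hol hf hD) (mul_hol hk hD) hz]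
  refine fracInt_congr (fun w _ => ?_) z
  simp only [Pi.sub_apply]
  ring

theorem IsDoublingWeight.exists_fracBloch_local_le {μ : ℝ → ℝ} (hμ : IsDoublingWeight μ)
    {g : ℂ → ℂ} (hg : g ∈ Hol) {R : ℝ}
    (hR1 : R < 1) : ∃ B : ℝ, 0 ≤ B ∧ ∀ z : ℂ, ‖z‖ ≤ R → tail μ ‖z‖ * ‖fracDeriv μ g z‖ ≤ B := by
  obtain ⟨B, hB⟩ := (isCompact_closedBall (0 : ℂ) R).exists_bound_of_continuousOn
    ((continuousOn_of_hol (hμ.fracDeriv_hol hg)).mono (closedBall_subset_disc hR1))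
  have ht0 := (hμ.pos le_rfl one_pos).le
  refine ⟨tail μ 0 * max B 0, by positivity, fun z hz => ?_⟩
  have h1 := hB z (mem_closedBall_zero_iff.2 hz)
  have hz1 : ‖z‖ < 1 := hz.trans_lt hR1
  have h2 := hμ.antitone le_rfl (norm_nonneg z) hz1.le
  gcongr
  exact h1.trans (le_max_left _ _)

/-- Smallness near the circle and continuity on the remaining compact disc together give a global
bound. -/
theorem IsDoublingWeight.fracBloch_of_tendsto {μ : ℝ → ℝ} (hμ : IsDoublingWeight μ)
    {g : ℂ → ℂ} (hg : g ∈ Hol)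
    (h : Tendsto (fun z => tail μ ‖z‖ * ‖fracDeriv μ g z‖) toCircle (𝓝 0)) : g ∈ fracBloch μ := by
  obtain ⟨R, hR0, hR1, hR⟩ := tendsto_toCircle_iff.1 h 1 one_pos
  obtain ⟨B, -, hB⟩ := hμ.exists_fracBloch_local_le hg hR1
  refine ⟨hg, lt_of_le_of_lt (b := ENNReal.ofReal (max B 1)) ?_ ENNReal.ofReal_lt_top⟩
  rw [fracBlochNorm_le_iff]
  intro z hz
  refine ENNReal.ofReal_le_ofReal ?_
  rcases le_or_gt ‖z‖ R with hzR | hzR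
  · exact (hB z hzR).trans (le_max_left _ _)
  · exact ((le_abs_self _).trans (hR z hz hzR).le).trans (le_max_right _ _)

/-- In the integral bounding `V_{μ,g} G_n`, the collar contributes little uniformly in `n` since
`tail * |D^μ g|` is small there, and the compact disc contributes little for large `n` by dominated
convergence. -/
theorem IsDoublingWeight.tendsto_bergmanNorm_volterra {μ : ℝ → ℝ} (hμ : IsDoublingWeight μ)
    {p α : ℝ} (hp : 0 < p) (hα : -1 < α)
    {g : ℂ → ℂ} (hg : g ∈ littleFracBloch μ) {G : ℕ → ℂ → ℂ} (hG : ∀ n, G n ∈ Hol) {M : ℝ≥0∞}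
    (hM : M ≠ ∞) (hGM : ∀ n, bergmanInt p α (G n) ≤ M) (B : ℝ → ℝ)
    (hB : ∀ n z, z ∈ disc → ‖G n z‖ ≤ B ‖z‖) (hmono : ∀ r t, 0 ≤ r → r ≤ t → t < 1 → B r ≤ B t)
    (hlim : ∀ z ∈ disc, Tendsto (fun n => G n z) atTop (𝓝 0)) :
    Tendsto (fun n => bergmanNorm p α (volterra μ g (G n))) atTop (𝓝 0) := by
  obtain ⟨⟨hgh, -⟩, hg0⟩ := hg
  obtain ⟨C, hC, hle⟩ := hμ.exists_bergmanInt_volterra_le hp hα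
  refine tendsto_bergmanNorm_of_int hp hα (ENNReal.tendsto_nhds_zero.2 fun ε hε => ?_)
  have hε2 : ε / 2 ≠ 0 := by simpa using hε.ne'
  -- `δ` is the allowed size of the `p`-th power of `tail * |D^μ g|` on the collar, hence the
  -- threshold `δ ^ (1 / p)` below.
  obtain ⟨δ, hδ, hδε⟩ := ENNReal.exists_nnreal_pos_mul_lt (ENNReal.mul_ne_top hC hM) hε2
  have hδ0 : (0 : ℝ) < δ := hδ
  obtain ⟨R, hR0, hR1, hR⟩ := tendsto_toCircle_iff.1 hg0 ((δ : ℝ) ^ (1 / p)) (by positivity)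
  obtain ⟨B₁, hB₁0, hB₁⟩ := hμ.exists_fracBloch_local_le hgh hR1
  set K : Set ℂ := Metric.closedBall 0 R with hK
  have hKd : K ⊆ disc := closedBall_subset_disc hR1
  obtain ⟨B₂, hB₂⟩ := (isCompact_closedBall (0 : ℂ) R).exists_bound_of_continuousOn
    (f := fun z : ℂ => (1 - ‖z‖ ^ 2) ^ α) (by
      intro z hz
      refine ContinuousAt.continuousWithinAt (ContinuousAt.rpow_const (by fun_prop) (Or.inl ?_))
      exact (one_sub_sq_pos (hKd hz)).ne')
  have hlocal : Tendsto (fun n => ∫⁻ z in K, ENNReal.ofReal (‖G n z‖ ^ p)) atTop (𝓝 0) := by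
    have := tendsto_lintegral_of_dominated_convergence' (μ := volume.restrict K)
      (F := fun n z => ENNReal.ofReal (‖G n z‖ ^ p)) (f := fun _ => 0)
      (fun _ => ENNReal.ofReal (B R ^ p)) (fun n => by
        have h1 : ContinuousOn (fun z => ENNReal.ofReal (‖G n z‖ ^ p)) K :=
          ENNReal.continuous_ofReal.comp_continuousOn
            ((((continuousOn_of_hol (hG n)).mono hKd).norm).rpow_const fun _ _ => Or.inr hp.le)
        exact h1.aemeasurable measurableSet_closedBall)
      (fun n => by
        filter_upwards [ae_restrict_mem measurableSet_closedBall] with z hz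
        refine ENNReal.ofReal_le_ofReal (Real.rpow_le_rpow (norm_nonneg _) ?_ hp.le)
        exact (hB n z (hKd hz)).trans (hmono _ _ (norm_nonneg z) (mem_closedBall_zero_iff.1 hz) hR1))
      (by
        rw [lintegral_const, Measure.restrict_apply_univ]
        exact ENNReal.mul_ne_top ENNReal.ofReal_ne_top measure_closedBall_lt_top.ne)
      (by
        filter_upwards [ae_restrict_mem measurableSet_closedBall] with z hz
        have h1 := ((hlim z (hKd hz)).norm).rpow_const (p := p) (Or.inr hp.le)
        rw [norm_zero, Real.zero_rpow hp.ne'] at h1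
        simpa using ENNReal.tendsto_ofReal h1)
    simpa using this
  have hK' := ENNReal.Tendsto.const_mul (a := C * ENNReal.ofReal (B₁ ^ p * B₂)) hlocal
    (Or.inr (ENNReal.mul_ne_top hC ENNReal.ofReal_ne_top))
  rw [mul_zero] at hK'
  filter_upwards [ENNReal.tendsto_nhds_zero.1 hK' (ε / 2) (pos_iff_ne_zero.2 hε2)] with n hn
  set ψ : ℂ → ℝ≥0∞ := fun z => ENNReal.ofReal ((tail μ ‖z‖ * ‖fracDeriv μ g z‖) ^ p) *
          ENNReal.ofReal (‖G n z‖ ^ p * (1 - ‖z‖ ^ 2) ^ α) with hψ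
  have hu0 : ∀ z ∈ disc, 0 ≤ tail μ ‖z‖ * ‖fracDeriv μ g z‖ := fun z hz =>
    mul_nonneg (hμ.pos (norm_nonneg z) (mem_disc.1 hz)).le (norm_nonneg _)
  have h1 : ∫⁻ z in K, ψ z ≤
      ENNReal.ofReal (B₁ ^ p * B₂) * ∫⁻ z in K, ENNReal.ofReal (‖G n z‖ ^ p) := by
    rw [← lintegral_const_mul' _ _ ENNReal.ofReal_ne_top]
    refine setLIntegral_mono' measurableSet_closedBall fun z hz => ?_
    have hzd := hKd hz
    have h2 := hB₁ z (mem_closedBall_zero_iff.1 hz)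
    have h3 : (1 - ‖z‖ ^ 2) ^ α ≤ B₂ := (le_abs_self _).trans (hB₂ z hz)
    have h4 : 0 ≤ (1 - ‖z‖ ^ 2) ^ α := Real.rpow_nonneg (one_sub_sq_pos hzd).le _
    have h5 := hu0 z hzd
    have h6 := h4.trans h3
    rw [hψ]
    simp only
    rw [← ENNReal.ofReal_mul (by positivity), ← ENNReal.ofReal_mul (by positivity)]
    refine ENNReal.ofReal_le_ofReal ?_
    calc _ ≤ B₁ ^ p * (‖G n z‖ ^ p * B₂) := by gcongr
      _ = _ := by ring
  have h2 : ∫⁻ z in disc \ K, ψ z ≤ δ * M := by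
    refine le_trans ?_ (mul_le_mul_right (hGM n) _)
    unfold bergmanInt
    rw [← lintegral_const_mul' _ _ ENNReal.coe_ne_top]
    refine le_trans ?_ (lintegral_mono_set (sdiff_subset (s := disc) (t := K)))
    refine setLIntegral_mono' (measurableSet_disc.diff measurableSet_closedBall) fun z hz => ?_
    refine mul_le_mul_left ?_ _
    have hzR : R < ‖z‖ := by
      by_contra hcon
      exact hz.2 (mem_closedBall_zero_iff.2 (not_lt.1 hcon))
    have h3 := (le_abs_self _).trans (hR z hz.1 hzR).le
    have h4 : (tail μ ‖z‖ * ‖fracDeriv μ g z‖) ^ p ≤ δ := by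
      refine (Real.rpow_le_rpow (hu0 z hz.1) h3 hp.le).trans (le_of_eq ?_)
      rw [← Real.rpow_mul hδ0.le, one_div_mul_cancel hp.ne', Real.rpow_one]
    refine (ENNReal.ofReal_le_ofReal h4).trans (le_of_eq ?_)
    exact ENNReal.ofReal_coe_nnreal
  calc bergmanInt p α (volterra μ g (G n)) ≤ C * ∫⁻ z in disc, ψ z := hle g hgh _ (hG n)
    _ ≤ C * ((∫⁻ z in K, ψ z) + ∫⁻ z in disc \ K, ψ z) := by
        refine mul_le_mul_right ?_ _
        refine le_trans (le_of_eq ?_) (lintegral_union_le ψ K (disc \ K))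
        rw [union_sdiff_cancel hKd]
    _ ≤ C * (ENNReal.ofReal (B₁ ^ p * B₂) * (∫⁻ z in K, ENNReal.ofReal (‖G n z‖ ^ p)) + δ * M) :=
        mul_le_mul_right (add_le_add h1 h2) _
    _ = C * ENNReal.ofReal (B₁ ^ p * B₂) * (∫⁻ z in K, ENNReal.ofReal (‖G n z‖ ^ p)) +
          δ * (C * M) := by ring
    _ ≤ ε / 2 + ε / 2 := add_le_add hn hδε.le
    _ = ε := ENNReal.add_halves ε

theorem bergmanInt_le_of_bergmanNorm_le {p α : ℝ} (hp : 0 < p) (hα : -1 < α) {f : ℂ → ℂ} {M : ℝ≥0∞}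
    (h : bergmanNorm p α f ≤ M) :
    bergmanInt p α f ≤ M ^ p / ENNReal.ofReal ((α + 1) / Real.pi) := by
  rw [ENNReal.le_div_iff_mul_le (Or.inl (bergmanConst_ne_zero hα)) (Or.inl ENNReal.ofReal_ne_top),
    mul_comm, ← bergmanNorm_rpow hp hα]
  exact ENNReal.rpow_le_rpow h hp.le

/-- Bounded sequences are locally uniformly bounded by pointwise growth, so a subsequence converges
pointwise to some `f`, which lies in the space by Fatou. The vanishing statement is applied to the
differences from `f`, and linearity of `V_{μ,g}` concludes. -/
theorem IsDoublingWeight.compactOn_of_littleFracBloch {μ : ℝ → ℝ} (hμ : IsDoublingWeight μ)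
    {p α : ℝ} (hp : 0 < p) (hα : -1 < α)
    {g : ℂ → ℂ} (hg : g ∈ littleFracBloch μ) : CompactOn p α (volterra μ g) := by
  have hgh : g ∈ Hol := hg.1.1
  have hbd := (hμ.boundedOn_iff_fracBloch hp hα hgh).2 hg.1
  refine ⟨hbd.1, ?_⟩
  rintro F hF ⟨M, hM⟩
  obtain ⟨C, hC, hgrow⟩ := exists_norm_le_of_bergmanNorm_le hp hα
  set s : ℝ := (2 + α) / p with hs
  have hs0 : 0 < s := div_pos (by linarith) hp
  set B : ℝ → ℝ := fun r => C * M / (1 - r) ^ s with hB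
  have hBmono : ∀ r t, 0 ≤ r → r ≤ t → t < 1 → B r ≤ B t := by
    intro r t _ hrt ht
    have : 0 < 1 - t := by linarith
    simp only [hB]
    gcongr
  have hFB : ∀ n z, z ∈ disc → ‖F n z‖ ≤ B ‖z‖ := by
    intro n z hz
    have hz1 : 0 < 1 - ‖z‖ := by linarith [mem_disc.1 hz]
    rw [hB, le_div_iff₀ (by positivity)]
    exact hgrow M (F n) M.2 (hF n).1 ((hM n).trans (by rw [ENNReal.ofReal_coe_nnreal])) z hz
  obtain ⟨f, hf, φ, hφ, hlim⟩ := exists_subseq_tendsto (fun n => (hF n).1) B hFB hBmono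
  set M₁ : ℝ≥0∞ := (M : ℝ≥0∞) ^ p / ENNReal.ofReal ((α + 1) / Real.pi) with hM₁
  have hM₁t : M₁ ≠ ∞ := ENNReal.div_ne_top
    (ENNReal.rpow_ne_top_of_nonneg hp.le ENNReal.coe_ne_top) (bergmanConst_ne_zero hα)
  have hFM : ∀ n, bergmanInt p α (F n) ≤ M₁ := fun n =>
    bergmanInt_le_of_bergmanNorm_le hp hα (hM n)
  have hfM : bergmanInt p α f ≤ M₁ :=
    bergmanInt_le_of_tendsto hp (fun n => (hF (φ n)).1) hlim fun n => hFM _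
  have hfb : f ∈ bergman p α :=
    ⟨hf, (bergmanNorm_lt_top_iff hp hα).2 (hfM.trans_lt hM₁t.lt_top)⟩
  refine ⟨volterra μ g f, hbd.1 f hfb, φ, hφ, ?_⟩
  have hfB : ∀ z ∈ disc, ‖f z‖ ≤ B ‖z‖ := fun z hz =>
    le_of_tendsto (hlim z hz).norm (Eventually.of_forall fun n => hFB _ z hz)
  have key := hμ.tendsto_bergmanNorm_volterra hp hα hg (G := fun n => F (φ n) - f)
    (fun n => sub_hol (hF _).1 hf) (M := ENNReal.ofReal (2 ^ p) * (M₁ + M₁))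
    (ENNReal.mul_ne_top ENNReal.ofReal_ne_top (ENNReal.add_ne_top.2 ⟨hM₁t, hM₁t⟩))
    (fun n => (bergmanInt_sub_le hp (hF _).1).trans
      (mul_le_mul_right (add_le_add (hFM _) hfM) _))
    (fun r => B r + B r)
    (fun n z hz => (norm_sub_le _ _).trans (add_le_add (hFB _ z hz) (hfB z hz)))
    (fun r t h0 h1 h2 => add_le_add (hBmono r t h0 h1 h2) (hBmono r t h0 h1 h2))
    (fun z hz => by
      have := (hlim z hz).sub_const (f z)
      rwa [sub_self] at this)
  refine key.congr fun n => bergmanNorm_congr hp hα fun z hz => ?_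
  exact hμ.volterra_sub (hF _).1 hf hgh hz

/-- If the limit fails, there are points `a n` tending to the circle with `tail * |D^μ g| ≥ ε`. The
images of the test functions at these points have norm bounded below, yet along a subsequence they
converge in norm to their pointwise limit, zero. -/
theorem IsDoublingWeight.tendsto_fracBloch_of_compactOn {μ : ℝ → ℝ} (hμ : IsDoublingWeight μ)
    {p α : ℝ} (hp : 0 < p) (hα : -1 < α)
    {g : ℂ → ℂ} (hg : g ∈ Hol) (hc : CompactOn p α (volterra μ g)) :
    Tendsto (fun z => tail μ ‖z‖ * ‖fracDeriv μ g z‖) toCircle (𝓝 0) := by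
  by_contra hcon
  rw [tendsto_toCircle_iff] at hcon
  push Not at hcon
  obtain ⟨ε, hε, hex⟩ := hcon
  choose a had har hau using fun n : ℕ => hex (rad n) (rad_nonneg n) (rad_lt_one n)
  obtain ⟨C₁, hC₁, h₁⟩ := hμ.exists_fracDeriv_mul_le hp hα
  obtain ⟨C₃, hC₃, hgrow⟩ := exists_norm_le_of_bergmanNorm_le hp hα
  obtain ⟨T, C₂, e, m, hC₂, he, hT⟩ := exists_testFun hp hα
  have hTb : ∀ n, T (a n) ∈ bergman p α := fun n =>
    ⟨(hT _ (had n)).1, (hT _ (had n)).2.1.trans_lt ENNReal.one_lt_top⟩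
  obtain ⟨h, hh, φ, hφ, hlim⟩ := hc.2 (fun n => T (a n)) hTb
    ⟨1, fun n => by simpa using (hT _ (had n)).2.1⟩
  have hVb : ∀ n, volterra μ g (T (a n)) ∈ bergman p α := fun n => hc.1 _ (hTb n)
  -- the images of the test functions tend to zero pointwise
  have hpt : ∀ z ∈ disc, Tendsto (fun n => volterra μ g (T (a (φ n))) z) atTop (𝓝 0) := by
    intro z hz
    have hz1 := mem_disc.1 hz
    have hz2 : 0 < 1 - ‖z‖ := by linarith
    obtain ⟨B, hB⟩ := (isCompact_closedBall (0 : ℂ) ‖z‖).exists_bound_of_continuousOn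
      ((continuousOn_of_hol (hμ.fracDeriv_hol hg)).mono (closedBall_subset_disc hz1))
    have hbound : ∀ n, ‖volterra μ g (T (a (φ n))) z‖ ≤
        C₂ * (1 - ‖a (φ n)‖) ^ e / (1 - ‖z‖) ^ m * B * ∫ s in Ico (0 : ℝ) 1, μ s := by
      intro n
      have hd := had (φ n)
      refine norm_fracInt_le hμ.nonneg hμ.integrable
        (mul_hol (hTb _).1 (hμ.fracDeriv_hol hg)) hz fun w hw => ?_
      rw [norm_mul]
      have h2 := (hT _ hd).2.2.2 w (mem_disc.2 (hw.trans_lt hz1))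
      have h3 : 0 < 1 - ‖a (φ n)‖ := by linarith [mem_disc.1 hd]
      have h4 : ‖T (a (φ n)) w‖ ≤ C₂ * (1 - ‖a (φ n)‖) ^ e / (1 - ‖z‖) ^ m :=
        h2.trans (by gcongr)
      exact mul_le_mul h4 (hB w (mem_closedBall_zero_iff.2 hw)) (norm_nonneg _) (by positivity)
    have hax : Tendsto (fun n => 1 - ‖a (φ n)‖) atTop (𝓝 0) := by
      have hg2 : Tendsto (fun n => (1 / 2 : ℝ) ^ φ n) atTop (𝓝 0) :=
        (tendsto_pow_atTop_nhds_zero_of_lt_one (by norm_num) (by norm_num)).comp hφ.tendsto_atTop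
      refine squeeze_zero (fun n => by linarith [mem_disc.1 (had (φ n))]) (fun n => ?_) hg2
      have := har (φ n)
      unfold rad at this
      linarith
    have h5 := hax.rpow_const (p := e) (Or.inr he.le)
    rw [Real.zero_rpow he.ne'] at h5
    have h6 := (((h5.const_mul C₂).div_const ((1 - ‖z‖) ^ m)).mul_const B).mul_const
      (∫ s in Ico (0 : ℝ) 1, μ s)
    simp only [mul_zero, zero_div, zero_mul] at h6
    exact squeeze_zero_norm hbound h6
  -- Bergman convergence implies pointwise convergence by the growth estimate, so the norm limit
  -- equals the pointwise limit.
  have hh0 : ∀ z ∈ disc, h z = 0 := by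
    intro z hz
    have hz1 := mem_disc.1 hz
    have hw : 0 < (1 - ‖z‖) ^ ((2 + α) / p) := Real.rpow_pos_of_pos (by linarith) _
    have h2 : Tendsto (fun n => volterra μ g (T (a (φ n))) z - h z) atTop (𝓝 0) := by
      have h3 : Tendsto (fun n => C₃ * (bergmanNorm p α
          (volterra μ g (T (a (φ n))) - h)).toReal / (1 - ‖z‖) ^ ((2 + α) / p)) atTop (𝓝 0) := by
        have h4 := (ENNReal.tendsto_toReal ENNReal.zero_ne_top).comp hlim
        have h5 := (h4.const_mul C₃).div_const ((1 - ‖z‖) ^ ((2 + α) / p))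
        simpa using h5
      refine squeeze_zero_norm' ?_ h3
      filter_upwards [ENNReal.tendsto_nhds_zero.1 hlim 1 one_pos] with n hn
      rw [le_div_iff₀ hw]
      have hne : bergmanNorm p α (volterra μ g (T (a (φ n))) - h) ≠ ∞ :=
        (hn.trans_lt ENNReal.one_lt_top).ne
      exact hgrow _ _ ENNReal.toReal_nonneg (sub_hol (hVb _).1 hh.1)
        (by rw [ENNReal.ofReal_toReal hne]) z hz
    have h3 := (hpt z hz).sub_const (h z)
    rw [zero_sub] at h3
    simpa using tendsto_nhds_unique h3 h2
  have hlim0 : Tendsto (fun n => bergmanNorm p α (volterra μ g (T (a (φ n))))) atTop (𝓝 0) := by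
    refine hlim.congr fun n => bergmanNorm_congr hp hα fun z hz => ?_
    rw [Pi.sub_apply, hh0 z hz, sub_zero]
  have hle : ∀ n, ε ≤ C₂ * (C₁ * (bergmanNorm p α (volterra μ g (T (a (φ n))))).toReal) := by
    intro n
    have hd := had (φ n)
    obtain ⟨hTh, -, hTa, -⟩ := hT _ hd
    have h2 := hau (φ n)
    have ht := (hμ.pos (norm_nonneg _) (mem_disc.1 hd)).le
    rw [abs_of_nonneg (by positivity)] at h2
    have h3 := h₁ _ g _ ENNReal.toReal_nonneg hg hTh
      (by rw [ENNReal.ofReal_toReal (hVb _).2.ne]) _ hd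
    set b := a (φ n)
    calc ε ≤ tail μ ‖b‖ * ‖fracDeriv μ g b‖ := h2
      _ ≤ tail μ ‖b‖ * ‖fracDeriv μ g b‖ * (C₂ * ‖T b b‖ * (1 - ‖b‖) ^ ((2 + α) / p)) :=
          le_mul_of_one_le_right (by positivity) hTa
      _ = C₂ * ((tail μ ‖b‖ * ‖fracDeriv μ g b‖) * (‖T b b‖ * (1 - ‖b‖) ^ ((2 + α) / p))) := by ring
      _ ≤ _ := by gcongr
  have hlim1 := (((ENNReal.tendsto_toReal ENNReal.zero_ne_top).comp hlim0).const_mul C₁).const_mul C₂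
  simp only [ENNReal.toReal_zero, mul_zero] at hlim1
  exact absurd (ge_of_tendsto' hlim1 hle) (not_le.2 hε)

theorem IsDoublingWeight.compactOn_iff_littleFracBloch {μ : ℝ → ℝ} (hμ : IsDoublingWeight μ)
    {p α : ℝ} (hp : 0 < p) (hα : -1 < α)
    {g : ℂ → ℂ} (hg : g ∈ Hol) : CompactOn p α (volterra μ g) ↔ g ∈ littleFracBloch μ :=
  ⟨fun hc => by
    have h := hμ.tendsto_fracBloch_of_compactOn hp hα hg hc
    exact ⟨hμ.fracBloch_of_tendsto hg h, h⟩, hμ.compactOn_of_littleFracBloch hp hα⟩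

end FracVolterra

end

theorem theorem5 (μ : ℝ → ℝ) (hμ : IsDoublingWeight μ) (p α : ℝ) (hp : 0 < p) (hα : -1 < α) :
    (∀ g ∈ Hol,
      (BoundedOn p α (volterra μ g) ↔ g ∈ fracBloch μ) ∧
      (BoundedOn p α (volterra μ g) ↔ g ∈ bloch)) ∧
    (∃ C : ℝ≥0, 0 < C ∧ ∀ g ∈ Hol,
      opNorm p α (volterra μ g) ≤ C * fracBlochNorm μ g ∧
      fracBlochNorm μ g ≤ C * opNorm p α (volterra μ g) ∧
      fracBlochNorm μ g ≤ C * blochNorm g ∧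
      blochNorm g ≤ C * fracBlochNorm μ g) ∧
    (∀ g ∈ Hol,
      (CompactOn p α (volterra μ g) ↔ g ∈ littleFracBloch μ) ∧
      (CompactOn p α (volterra μ g) ↔ g ∈ littleBloch)) := by
  obtain ⟨C₁, h₁⟩ := hμ.exists_opNorm_le_fracBlochNorm hp hα
  obtain ⟨C₂, hC₂, h₂⟩ := hμ.exists_fracBlochNorm_le_opNorm hp hα
  obtain ⟨C₃, -, h₃⟩ := hμ.exists_fracBlochNorm_le_blochNorm
  obtain ⟨C₄, -, h₄⟩ := hμ.exists_blochNorm_le_fracBlochNorm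
  refine ⟨fun g hg => ⟨hμ.boundedOn_iff_fracBloch hp hα hg,
    (hμ.boundedOn_iff_fracBloch hp hα hg).trans (hμ.fracBloch_iff_bloch hg)⟩,
    ⟨C₁ + C₂ + C₃ + C₄, by positivity, fun g hg => ?_⟩,
    fun g hg => ⟨hμ.compactOn_iff_littleFracBloch hp hα hg,
      (hμ.compactOn_iff_littleFracBloch hp hα hg).trans (hμ.littleFracBloch_iff_littleBloch hg)⟩⟩
  have hle : ∀ {c : ℝ≥0} {x y : ℝ≥0∞}, x ≤ c * y → c ≤ C₁ + C₂ + C₃ + C₄ →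
      x ≤ ((C₁ + C₂ + C₃ + C₄ : ℝ≥0) : ℝ≥0∞) * y := fun h hc =>
    h.trans (mul_le_mul_left (ENNReal.coe_le_coe.2 hc) _)
  exact ⟨hle (h₁ g hg) ((le_self_add.trans le_self_add).trans le_self_add),
    hle (h₂ g hg) ((le_add_self.trans le_self_add).trans le_self_add),
    hle (h₃ g hg) (le_add_self.trans le_self_add), hle (h₄ g hg) le_add_self⟩
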